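/- Let $d\in\{2,3\}$, let $M\subset\mathbb R^d$ be a bounded open set with smooth boundary, let $T>0$, and let $\varepsilon(\rho,s)$ be an internal energy density that is smooth on an open set $D\subset\mathbb R^2$. Let $\mathbf u$ (velocity, with $\mathbf u|_{\partial M}=0$), $\rho$ (mass density), $s$ (entropy density), $\gamma$ (thermal displacement), $\sigma$, $\boldsymbol\sigma^{\rm fr}$ (friction stress tensor), $\mathbf j_S$ (entropy flux) and $r$ (external heat power) be fields on $[0,T]\times M$, smooth up to the boundary, with $(\rho,s)\in D$ on $[0,T]\times\overline M$. Let $$\ell(\mathbf u,\rho,s)=\int_M\Big[\tfrac12\rho|\mathbf u|^2-\varepsilon(\rho,s)\Big]\,dx,$$ let $\frac{\delta\ell}{\delta s}$ be its variational derivative with respect to $s$ (for the $L^2$ pairing) along these fields, let $\theta:=-\frac{\delta\ell}{\delta s}$ be the temperature, and assume that $\theta\ne0$ on $[0,T]\times\overline M$. Consider the relations on $[0,T]\times M$ $$\text{(T)}\quad \frac{\delta\ell}{\delta s}=-\big(\partial_t\gamma+\mathbf d\gamma(\mathbf u)\big),\qquad \text{(R)}\quad \partial_t(s-\sigma)+\operatorname{div}\big((s-\sigma)\mathbf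 u\big)=-\operatorname{div}\mathbf j_S,$$ and the phenomenological constraint $$\text{(P)}\quad \frac{\delta\ell}{\delta s}\big(\partial_t\sigma+\operatorname{div}(\sigma\mathbf u)\big)=-\boldsymbol\sigma^{\rm fr}:\nabla\mathbf u+\mathbf j_S\cdot\mathbf d\big(\partial_t\gamma+\mathbf d\gamma(\mathbf u)\big)-\rho r .$$ (1) Suppose that the motion is critical for the variational condition $$\delta\int_0^T\Big[\ell(\mathbf u,\rho,s)+\int_M(s-\sigma)\big(\partial_t\gamma+\mathbf d\gamma(\mathbf u)\big)\,dx\Big]dt=0$$ with respect to all smooth variations $\delta\mathbf u=\partial_t\boldsymbol\zeta+[\mathbf u,\boldsymbol\zeta]$, $\delta\rho=-\operatorname{div}(\rho\boldsymbol\zeta)$, $\delta s$, $\delta\gamma$, $\delta\sigma$, where $\boldsymbol\zeta$ and $\delta\gamma$ vanish on $\partial M$ and at $t=0,T$, that satisfy the variational constraint $$\frac{\delta\ell}{\delta s}\big(\delta\sigma+\operatorname{div}(\sigma\boldsymbol\zeta)\big)=-\boldsymbol\sigma^{\rm fr}:\nabla\boldsymbol\zeta+\mathbf j_S\cdot\mathbf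 d\big(\delta\gamma+\mathbf d\gamma(\boldsymbol\zeta)\big).$$ Then (T) and (R) hold. (2) Suppose that (T), (R) and (P) hold (in particular, by (1), if the motion satisfies the variational condition of (1) and (P)). Then on $[0,T]\times M$ the local balance of entropy holds: $$\partial_t s+\operatorname{div}(s\mathbf u)+\operatorname{div}\mathbf j_S=\partial_t\sigma+\operatorname{div}(\sigma\mathbf u)=\frac1\theta\big(\boldsymbol\sigma^{\rm fr}:\nabla\mathbf u-\mathbf j_S\cdot\mathbf d\theta\big)+\frac{\rho r}{\theta}.$$ Moreover, $\mathsf S(t)=\int_M s(t,x)\,dx$ is differentiable on $[0,T]$ (one-sidedly at the endpoints), all the integrals below converge, and the global balance of entropy holds for every $t\in[0,T]$: $$\frac{d\mathsf S}{dt}+\int_{\partial M}\mathbf j_S\cdot d\mathbf S=\underbrace{\int_M\frac1\theta\big(\boldsymbol\sigma^{\rm fr}:\nabla\mathbf u-\mathbf j_S\cdot\mathbf d\theta\big)\,dx}_{\text{internal source}}+\underbrace{\int_M\frac{\rho r}{\theta}\,dx}_{\text{external source}} .$$ Here $d\mathbf S=\mathbf n\,dS$ with $\mathbf n$ the outward unit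 normal. -/

import Mathlib

open Set MeasureTheory
open scoped ContDiff

namespace NSF

noncomputable section

/-- Euclidean `d`-space. -/
abbrev Space (d : ℕ) : Type := EuclideanSpace ℝ (Fin d)

/-! ### Domains with smooth boundary, outward normal, flux through the boundary -/

/-- `φ` is a smooth local defining function of `M` on the open set `U`: it has no critical point
in `U`, and inside `U` the set `M` is the sublevel set `φ < 0`. -/
structure IsDefiningFunction {d : ℕ} (M U : Set (Space d)) (φ : Space d → ℝ) : Prop where
  isOpen : IsOpen U
  smooth : ContDiffOn ℝ ∞ φ U
  gradient_ne_zero : ∀ y ∈ U, gradient φ y ≠ 0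
  inter_eq : M ∩ U = {y ∈ U | φ y < 0}

/-- Bounded open subset of `ℝᵈ` with smooth boundary, lying locally on one side of it. -/
structure IsSmoothBoundedDomain {d : ℕ} (M : Set (Space d)) : Prop where
  isOpen : IsOpen M
  isBounded : Bornology.IsBounded M
  smooth_boundary : ∀ x ∈ frontier M, ∃ U φ, x ∈ U ∧ IsDefiningFunction M U φ

/-- `v` is the outward unit normal of `M` at the boundary point `x`: the normalized gradient of a
local defining function (it does not depend on the defining function). -/
def IsOutwardUnitNormal {d : ℕ} (M : Set (Space d)) (x v : Space d) : Prop :=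
  ∃ U φ, x ∈ U ∧ IsDefiningFunction M U φ ∧ v = ‖gradient φ x‖⁻¹ • gradient φ x

open Classical in
/-- The outward unit normal vector field (with value `0` where there is none). -/
def outwardNormal {d : ℕ} (M : Set (Space d)) (x : Space d) : Space d :=
  if h : ∃ v, IsOutwardUnitNormal M x v then h.choose else 0

/-- The surface measure of `∂M`: the `(d-1)`-dimensional Hausdorff measure (normalized so as to
agree with Lebesgue measure in dimension `d-1`), restricted to `∂M`. -/
def surfaceMeasure {d : ℕ} (M : Set (Space d)) : Measure (Space d) :=
  (Measure.euclideanHausdorffMeasure (d - 1) : Measure (Space d)).restrict (frontier M)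

/-- The integrand of `∫_{∂M} F · d𝐒`, i.e. `F · n`. -/
def normalComponent {d : ℕ} (M : Set (Space d)) (F : Space d → Space d) (x : Space d) : ℝ :=
  inner ℝ (F x) (outwardNormal M x)

/-- The flux `∫_{∂M} F · d𝐒`. -/
def flux {d : ℕ} (M : Set (Space d)) (F : Space d → Space d) : ℝ :=
  ∫ x, normalComponent M F x ∂(surfaceMeasure M)

/-! ### Fields on `[0,T] × M` and differential operators -/

/-- A field, as a function of time and position, that is smooth on `[0,T] × M` up to the
boundary. -/
def SmoothField {d : ℕ} {F : Type*} [NormedAddCommGroup F] [NormedSpace ℝ F]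
    (T : ℝ) (M : Set (Space d)) (f : ℝ → Space d → F) : Prop :=
  ContDiffOn ℝ ∞ (fun p : ℝ × Space d => f p.1 p.2) (Icc 0 T ×ˢ closure M)

/-- `∂ₜ f` at `(t, x)` (one-sided at `t = 0` and `t = T`). -/
def dt {d : ℕ} {F : Type*} [NormedAddCommGroup F] [NormedSpace ℝ F]
    (T : ℝ) (f : ℝ → Space d → F) (t : ℝ) (x : Space d) : F :=
  derivWithin (fun τ => f τ x) (Icc 0 T) t

/-- The divergence `∑ᵢ ∂ᵢ Fᵢ` of a vector field. -/
def div {d : ℕ} (F : Space d → Space d) (x : Space d) : ℝ :=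
  ∑ i, fderiv ℝ F x (EuclideanSpace.single i 1) i

/-- The full contraction `A : ∇F = ∑ᵢⱼ Aᵢⱼ ∂ⱼ Fᵢ`. -/
def contractGrad {d : ℕ} (A : Matrix (Fin d) (Fin d) ℝ) (F : Space d → Space d)
    (x : Space d) : ℝ :=
  ∑ i, ∑ j, A i j * fderiv ℝ F x (EuclideanSpace.single j 1) i

/-- Rate of change of a density along the flow of `u`: `∂ₜ f + div (f u)`. -/
def densityRate {d : ℕ} (T : ℝ) (u : ℝ → Space d → Space d) (f : ℝ → Space d → ℝ)
    (t : ℝ) (x : Space d) : ℝ :=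
  dt T f t x + div (fun y => f t y • u t y) x

/-- Rate of change of a function along the flow of `u`: `∂ₜ f + df(u)`. -/
def functionRate {d : ℕ} (T : ℝ) (u : ℝ → Space d → Space d) (f : ℝ → Space d → ℝ)
    (t : ℝ) (x : Space d) : ℝ :=
  dt T f t x + fderiv ℝ (f t) x (u t x)

/-! ### The spatial Lagrangian and its variational derivative -/

/-- The spatial Lagrangian `ℓ(u,ρ,s) = ∫_M [½ ρ |u|² - ε(ρ,s)] dx`. -/
def lagrangian {d : ℕ} (M : Set (Space d)) (ε : ℝ → ℝ → ℝ)
    (u : Space d → Space d) (ρ s : Space d → ℝ) : ℝ :=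
  ∫ x in M, (1 / 2 * ρ x * inner ℝ (u x) (u x) - ε (ρ x) (s x))

/-- `w = δℓ/δs (u,ρ,s)`: the continuous function `w` represents the derivative of `ℓ` in the
direction of an arbitrary variation `δs`, via the `L²` pairing. -/
structure IsVariationalDerivative {d : ℕ} (M : Set (Space d)) (ε : ℝ → ℝ → ℝ)
    (u : Space d → Space d) (ρ s : Space d → ℝ) (w : Space d → ℝ) : Prop where
  continuousOn : ContinuousOn w (closure M)
  hasDerivAt : ∀ δs : Space d → ℝ, ContDiffOn ℝ ∞ δs (closure M) →
    HasDerivAt (fun η : ℝ => lagrangian M ε u ρ (fun x => s x + η * δs x))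
      (∫ x in M, w x * δs x) 0

/-! ### The spatial variational principle -/

/-- The time-dependent fields that are varied: velocity `u`, mass density `ρ`, entropy density
`s`, thermal displacement `γ` and the density `σ`. -/
structure Motion (d : ℕ) where
  u : ℝ → Space d → Space d
  ρ : ℝ → Space d → ℝ
  s : ℝ → Space d → ℝ
  γ : ℝ → Space d → ℝ
  σ : ℝ → Space d → ℝ

/-- Smooth fields, no-slip condition `u = 0` on `∂M`. -/
structure Motion.IsRegular {d : ℕ} (T : ℝ) (M : Set (Space d)) (m : Motion d) : Prop where
  u : SmoothField T M m.u
  ρ : SmoothField T M m.ρ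
  s : SmoothField T M m.s
  γ : SmoothField T M m.γ
  σ : SmoothField T M m.σ
  noSlip : ∀ t ∈ Icc 0 T, ∀ x ∈ frontier M, m.u t x = 0

/-- The action `∫₀ᵀ [ℓ(u,ρ,s) + ∫_M (s - σ)(∂ₜγ + dγ(u)) dx] dt`. -/
def action {d : ℕ} (T : ℝ) (M : Set (Space d)) (ε : ℝ → ℝ → ℝ) (m : Motion d) : ℝ :=
  ∫ t in (0 : ℝ)..T, (lagrangian M ε (m.u t) (m.ρ t) (m.s t)
    + ∫ x in M, (m.s t x - m.σ t x) * functionRate T m.u m.γ t x)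

/-- Data of a variation: `ζ` generates `δu` and `δρ`; `δs`, `δγ`, `δσ` are the variations of
`s`, `γ`, `σ`. -/
structure Variation (d : ℕ) where
  ζ : ℝ → Space d → Space d
  δs : ℝ → Space d → ℝ
  δγ : ℝ → Space d → ℝ
  δσ : ℝ → Space d → ℝ

/-- The varied motion with parameter `η`, where `δu = ∂ₜζ + [u,ζ]` (Jacobi-Lie bracket
`[u,ζ] = (u·∇)ζ - (ζ·∇)u`) and `δρ = - div (ρ ζ)`. -/
def Motion.vary {d : ℕ} (T : ℝ) (m : Motion d) (v : Variation d) (η : ℝ) : Motion d where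
  u t x := m.u t x + η • (dt T v.ζ t x + VectorField.lieBracket ℝ (m.u t) (v.ζ t) x)
  ρ t x := m.ρ t x + η * (-div (fun y => m.ρ t y • v.ζ t y) x)
  s t x := m.s t x + η * v.δs t x
  γ t x := m.γ t x + η * v.δγ t x
  σ t x := m.σ t x + η * v.δσ t x

/-- Admissible variations: smooth, `ζ = 0` and `δγ = 0` on `∂M` and at `t = 0, T`, and subject to
the variational constraint
`δℓ/δs (δσ + div (σ ζ)) = - σᶠʳ : ∇ζ + j · d(δγ + dγ(ζ))`. The field `dlds` is `δℓ/δs`. -/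
structure Variation.IsAdmissible {d : ℕ} (T : ℝ) (M : Set (Space d)) (m : Motion d)
    (dlds : ℝ → Space d → ℝ) (σfr : ℝ → Space d → Matrix (Fin d) (Fin d) ℝ)
    (j : ℝ → Space d → Space d) (v : Variation d) : Prop where
  ζ : SmoothField T M v.ζ
  δs : SmoothField T M v.δs
  δγ : SmoothField T M v.δγ
  δσ : SmoothField T M v.δσ
  ζ_boundary : ∀ t ∈ Icc 0 T, ∀ x ∈ frontier M, v.ζ t x = 0
  δγ_boundary : ∀ t ∈ Icc 0 T, ∀ x ∈ frontier M, v.δγ t x = 0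
  ζ_endpoints : ∀ x ∈ closure M, v.ζ 0 x = 0 ∧ v.ζ T x = 0
  δγ_endpoints : ∀ x ∈ closure M, v.δγ 0 x = 0 ∧ v.δγ T x = 0
  constraint : ∀ t ∈ Icc 0 T, ∀ x ∈ M,
    dlds t x * (v.δσ t x + div (fun y => m.σ t y • v.ζ t y) x)
      = -contractGrad (σfr t x) (v.ζ t) x
        + fderiv ℝ (fun y => v.δγ t y + fderiv ℝ (m.γ t) y (v.ζ t y)) x (j t x)

/-- The variational condition: the action is stationary at `m` for all admissible variations. -/
def IsCritical {d : ℕ} (T : ℝ) (M : Set (Space d)) (ε : ℝ → ℝ → ℝ) (m : Motion d)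
    (dlds : ℝ → Space d → ℝ) (σfr : ℝ → Space d → Matrix (Fin d) (Fin d) ℝ)
    (j : ℝ → Space d → Space d) : Prop :=
  ∀ v : Variation d, v.IsAdmissible T M m dlds σfr j →
    HasDerivAt (fun η : ℝ => action T M ε (m.vary T v η)) 0 0

/-- The phenomenological constraint
`δℓ/δs (∂ₜσ + div (σ u)) = - σᶠʳ : ∇u + j · d(∂ₜγ + dγ(u)) - ρ r`. -/
def PhenomenologicalConstraint {d : ℕ} (T : ℝ) (M : Set (Space d)) (m : Motion d)
    (dlds : ℝ → Space d → ℝ) (σfr : ℝ → Space d → Matrix (Fin d) (Fin d) ℝ)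
    (j : ℝ → Space d → Space d) (r : ℝ → Space d → ℝ) : Prop :=
  ∀ t ∈ Icc 0 T, ∀ x ∈ M,
    dlds t x * densityRate T m.u m.σ t x
      = -contractGrad (σfr t x) (m.u t) x
        + fderiv ℝ (functionRate T m.u m.γ t) x (j t x) - m.ρ t x * r t x

/-- The temperature relation `δℓ/δs = - (∂ₜγ + dγ(u))`. -/
def TemperatureRelation {d : ℕ} (T : ℝ) (M : Set (Space d)) (m : Motion d)
    (dlds : ℝ → Space d → ℝ) : Prop :=
  ∀ t ∈ Icc 0 T, ∀ x ∈ M, dlds t x = -functionRate T m.u m.γ t x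

/-- The relation `∂ₜ(s - σ) + div ((s - σ) u) = - div j`. -/
def EntropyFluxRelation {d : ℕ} (T : ℝ) (M : Set (Space d)) (m : Motion d)
    (j : ℝ → Space d → Space d) : Prop :=
  ∀ t ∈ Icc 0 T, ∀ x ∈ M,
    densityRate T m.u (fun τ y => m.s τ y - m.σ τ y) t x = -div (j t) x

/-! ### Entropy production -/

/-- Internal entropy production `(1/θ)(σᶠʳ : ∇u - j · dθ)`. -/
def internalProduction {d : ℕ} (m : Motion d) (θ : ℝ → Space d → ℝ)
    (σfr : ℝ → Space d → Matrix (Fin d) (Fin d) ℝ) (j : ℝ → Space d → Space d)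
    (t : ℝ) (x : Space d) : ℝ :=
  1 / θ t x * (contractGrad (σfr t x) (m.u t) x - fderiv ℝ (θ t) x (j t x))

/-- External entropy production `ρ r / θ`. -/
def externalProduction {d : ℕ} (m : Motion d) (θ r : ℝ → Space d → ℝ)
    (t : ℝ) (x : Space d) : ℝ :=
  m.ρ t x * r t x / θ t x

end

end NSF

open NSF

/-! Entropy balance. Part (2) is algebra followed by integration. Subtracting the density rates in
(R) gives the first local equality. By (T) the rate of `γ` equals `θ` on the open set `M`, so its
spatial differential is that of `θ`, and (P) divided by `-θ` gives the second. Integrating over `M`,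
the time derivative comes out of the integral, `div (s u)` contributes nothing because `u = 0` on
the boundary, and `div j` becomes a flux by the divergence theorem.

For part (1) the variations with `ζ = 0` suffice. First, `dlds` is only assumed to represent the
derivative of the Lagrangian; the fundamental lemma identifies it with `-∂ε/∂s`, hence it is smooth.
Varying `s` alone gives (T). Varying `γ` by a test function `ψ` forces `δσ = dψ(j) / dlds`; with (T)
the term `-δσ (∂ₜγ + dγ(u))` becomes `dψ(j)`, and integration by parts in space-time gives (R).

The bulk of the work is the divergence theorem for the Hausdorff surface measure
(`integral_div_eq_flux`). Near a boundary point with normalized defining function `φ`, replacing the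
normal coordinate by `φ` gives a map whose derivative at that point is the identity, so on a small
neighbourhood it is an isometry up to a relative error `c`. Testing with `ψ * cutoff (n φ)` and
letting `n` grow, the layer term concentrates on the boundary; after a change of variables it is an
integral over a piece of hyperplane (`IsFlatChart.integral_div_eq`). The image of Lebesgue measure
on the hyperplane and the surface measure dominate each other up to powers of `(1 - c)⁻¹`, by
Lipschitz bounds alone. So the theorem holds in each chart up to a small multiple of `∫ |ψ F · n|`.
Such errors add up under a nonnegative partition of unity to a small multiple of `∫ |F · n|`, which
is finite, and the multiple is arbitrary. No area formula is needed. -/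

namespace NSF

open Filter Topology Metric

variable {d : ℕ} {M U : Set (Space d)} {φ : Space d → ℝ}

/-! ### Geometry of a smooth boundary -/

/-- A function with negative derivative along `w` decreases along `w`. -/
theorem eventually_lt_of_hasFDerivAt {φ : Space d → ℝ} {φ' : Space d →L[ℝ] ℝ} {x w : Space d}
    (h : HasFDerivAt φ φ' x) (hw : φ' w < 0) : ∀ᶠ t : ℝ in 𝓝[>] 0, φ (x + t • w) < φ x := by
  have h1 : HasDerivAt (fun t : ℝ => φ (x + t • w)) (φ' w) 0 := by
    have h2 : HasDerivAt (fun t : ℝ => x + t • w) w 0 := by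
      simpa using ((hasDerivAt_id (0 : ℝ)).smul_const w).const_add x
    exact HasFDerivAt.comp_hasDerivAt (x := (0 : ℝ)) (by simpa using h) h2
  have h3 := (hasDerivAt_iff_tendsto_slope.1 h1).mono_left
    (nhdsWithin_mono 0 (fun t (ht : 0 < t) => ht.ne'))
  filter_upwards [h3.eventually_lt_const hw, self_mem_nhdsWithin] with t ht (ht0 : 0 < t)
  rw [slope_def_field] at ht
  simp only [zero_smul, add_zero, sub_zero] at ht
  have := (div_lt_iff₀ ht0).1 ht
  linarith

theorem fderiv_eq_inner_gradient (φ : Space d → ℝ) (x w : Space d) :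
    fderiv ℝ φ x w = inner ℝ (gradient φ x) w := by
  rw [gradient, InnerProductSpace.toDual_symm_apply]

namespace IsDefiningFunction

theorem hasFDerivAt (h : IsDefiningFunction M U φ) {x : Space d} (hx : x ∈ U) :
    HasFDerivAt φ (fderiv ℝ φ x) x :=
  (((h.smooth.contDiffAt (h.isOpen.mem_nhds hx)).differentiableAt (by simp))).hasFDerivAt

theorem continuousOn (h : IsDefiningFunction M U φ) : ContinuousOn φ U := h.smooth.continuousOn

theorem continuousOn_fderiv (h : IsDefiningFunction M U φ) : ContinuousOn (fderiv ℝ φ) U :=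
  h.smooth.continuousOn_fderiv_of_isOpen h.isOpen (by simp)

theorem continuousOn_gradient (h : IsDefiningFunction M U φ) : ContinuousOn (gradient φ) U :=
  (InnerProductSpace.toDual ℝ (Space d)).symm.continuous.comp_continuousOn h.continuousOn_fderiv

theorem mem_iff (h : IsDefiningFunction M U φ) {x : Space d} (hx : x ∈ U) : x ∈ M ↔ φ x < 0 := by
  have := Set.ext_iff.1 h.inter_eq x
  simp only [mem_inter_iff, hx, and_true, mem_ofPred_eq, true_and] at this
  exact this

theorem eventually_mem (h : IsDefiningFunction M U φ) {x w : Space d} (hx : x ∈ U)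
    (h0 : φ x ≤ 0) (hw : fderiv ℝ φ x w < 0) : ∀ᶠ t : ℝ in 𝓝[>] 0, x + t • w ∈ M := by
  have hc : Tendsto (fun t : ℝ => x + t • w) (𝓝[>] 0) (𝓝 x) := by
    have : Continuous (fun t : ℝ => x + t • w) := by fun_prop
    simpa using (this.tendsto 0).mono_left nhdsWithin_le_nhds
  filter_upwards [eventually_lt_of_hasFDerivAt (h.hasFDerivAt hx) hw,
    hc.eventually (h.isOpen.mem_nhds hx)] with t ht hU
  exact (h.mem_iff hU).2 (ht.trans_le h0)

theorem fderiv_neg_gradient (h : IsDefiningFunction M U φ) {x : Space d} (hx : x ∈ U) :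
    fderiv ℝ φ x (-gradient φ x) < 0 := by
  rw [fderiv_eq_inner_gradient, inner_neg_right, real_inner_self_eq_norm_sq]
  have := norm_pos_iff.2 (h.gradient_ne_zero x hx)
  simp only [Left.neg_neg_iff]; positivity

/-- The gradient does not vanish, so from any point with `φ ≤ 0` a short move along `-gradient φ`
enters `M`. This excludes zeros of `φ` that are not limits of points of `M`. -/
theorem mem_closure_iff (h : IsDefiningFunction M U φ) {x : Space d} (hx : x ∈ U) :
    x ∈ closure M ↔ φ x ≤ 0 := by
  constructor
  · intro hc
    by_contra hp
    push Not at hp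
    have hn : U ∩ φ ⁻¹' Ioi 0 ∈ 𝓝 x :=
      (h.continuousOn.isOpen_inter_preimage h.isOpen isOpen_Ioi).mem_nhds ⟨hx, hp⟩
    obtain ⟨y, ⟨hyU, hy⟩, hyM⟩ := mem_closure_iff_nhds.1 hc _ hn
    exact absurd ((h.mem_iff hyU).1 hyM) (not_lt.2 (le_of_lt hy))
  · intro h0
    have hc : Tendsto (fun t : ℝ => x + t • (-gradient φ x)) (𝓝[>] 0) (𝓝 x) := by
      have : Continuous (fun t : ℝ => x + t • (-gradient φ x)) := by fun_prop
      simpa using (this.tendsto 0).mono_left nhdsWithin_le_nhds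
    exact mem_closure_of_tendsto hc (h.eventually_mem hx h0 (h.fderiv_neg_gradient hx))

theorem mem_frontier_iff (hM : IsOpen M) (h : IsDefiningFunction M U φ) {x : Space d}
    (hx : x ∈ U) : x ∈ frontier M ↔ φ x = 0 := by
  rw [hM.frontier_eq, Set.mem_sdiff, h.mem_closure_iff hx, h.mem_iff hx, not_lt]
  exact ⟨fun h => le_antisymm h.1 h.2, fun h => ⟨h.le, h.ge⟩⟩

/-- The tangent cone contains the nonempty open half-space where `fderiv ℝ φ x` is negative, and an
open set spans. This makes derivatives within `closure M` meaningful up to the boundary. -/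
theorem uniqueDiffWithinAt (h : IsDefiningFunction M U φ) {x : Space d}
    (hx : x ∈ U) (h0 : φ x ≤ 0) : UniqueDiffWithinAt ℝ (closure M) x := by
  refine ⟨?_, subset_closure ((h.mem_closure_iff hx).2 h0)⟩
  have hsub : {w | fderiv ℝ φ x w < 0} ⊆ tangentConeAt ℝ (closure M) x := by
    intro w hw
    have hev := h.eventually_mem hx h0 hw
    refine mem_tangentConeAt_of_add_smul_mem (l := 𝓝[>] (0 : ℝ)) (c := fun t => t) ?_ ?_
    · exact tendsto_nhdsWithin_mono_right (fun t (ht : 0 < t) => ht.ne')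
        (tendsto_id)
    · exact hev.mono fun t ht => subset_closure ht
  have ho : IsOpen {w | fderiv ℝ φ x w < 0} :=
    isOpen_lt (fderiv ℝ φ x).continuous continuous_const
  have htop : Submodule.span ℝ {w | fderiv ℝ φ x w < 0} = ⊤ := by
    refine Submodule.eq_top_of_nonempty_interior' _ ⟨-gradient φ x, ?_⟩
    exact interior_maximal Submodule.subset_span ho (h.fderiv_neg_gradient hx)
  have : Submodule.span ℝ (tangentConeAt ℝ (closure M) x) = ⊤ :=
    top_le_iff.1 (htop ▸ Submodule.span_mono hsub)
  rw [this]
  exact dense_univ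

/-- The normalized gradients of two defining functions agree on the boundary. -/
theorem unit_gradient_unique (hM : IsOpen M) {V : Set (Space d)} {ψ : Space d → ℝ}
    (h : IsDefiningFunction M U φ) (h' : IsDefiningFunction M V ψ) {x : Space d}
    (hxU : x ∈ U) (hxV : x ∈ V) (hx : x ∈ frontier M) :
    ‖gradient φ x‖⁻¹ • gradient φ x = ‖gradient ψ x‖⁻¹ • gradient ψ x := by
  have h0 := (h.mem_frontier_iff hM hxU).1 hx
  have h0' := (h'.mem_frontier_iff hM hxV).1 hx
  set a := gradient φ x with ha
  set b := gradient ψ x with hb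
  have ha0 : a ≠ 0 := h.gradient_ne_zero x hxU
  have hb0 : b ≠ 0 := h'.gradient_ne_zero x hxV
  -- A direction that decreases `φ` points into `M`, so it cannot increase `ψ` from its value `0`.
  have key : ∀ w, inner ℝ a w < 0 → inner ℝ b w ≤ 0 := by
    intro w hw
    by_contra hp
    push Not at hp
    have e1 := h.eventually_mem hxU h0.le (w := w) (by rwa [fderiv_eq_inner_gradient])
    have e2 := eventually_lt_of_hasFDerivAt (h'.hasFDerivAt hxV).neg (w := w)
      (by
        rw [neg_apply, fderiv_eq_inner_gradient]; exact neg_neg_of_pos hp)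
    have hc : Tendsto (fun t : ℝ => x + t • w) (𝓝[>] 0) (𝓝 x) := by
      have : Continuous (fun t : ℝ => x + t • w) := by fun_prop
      simpa using (this.tendsto 0).mono_left nhdsWithin_le_nhds
    obtain ⟨t, ht1, ht2, ht3⟩ :=
      (e1.and (e2.and (hc.eventually (h'.isOpen.mem_nhds hxV)))).exists
    have := (h'.mem_iff ht3).1 ht1
    simp only [Pi.neg_apply] at ht2
    linarith
  have hna : 0 < ‖a‖ := norm_pos_iff.2 ha0
  have hnb : 0 < ‖b‖ := norm_pos_iff.2 hb0
  have hle : ‖a‖ * ‖b‖ ≤ inner ℝ a b := by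
    by_contra hlt
    push Not at hlt
    -- If Cauchy-Schwarz were strict, this vector would have negative product with `a` and positive
    -- product with `b`. The equality case then makes the two gradients positively parallel.
    have h1 := key (‖a‖ • b - ‖b‖ • a) ?_
    · rw [inner_sub_right, inner_smul_right, inner_smul_right, real_inner_self_eq_norm_sq,
        real_inner_comm] at h1
      nlinarith
    · rw [inner_sub_right, inner_smul_right, inner_smul_right, real_inner_self_eq_norm_sq]
      nlinarith
  have heq := le_antisymm (real_inner_le_norm a b) hle
  rw [inner_eq_norm_mul_iff_real] at heq
  rw [inv_smul_eq_iff₀ hna.ne', smul_comm, ← heq, smul_smul, inv_mul_cancel₀ hnb.ne', one_smul]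

end IsDefiningFunction

theorem outwardNormal_eq (hM : IsOpen M) (h : IsDefiningFunction M U φ) {x : Space d}
    (hxU : x ∈ U) (hx : x ∈ frontier M) :
    outwardNormal M x = ‖gradient φ x‖⁻¹ • gradient φ x := by
  have hex : ∃ v, IsOutwardUnitNormal M x v := ⟨_, U, φ, hxU, h, rfl⟩
  rw [outwardNormal, dif_pos hex]
  obtain ⟨V, ψ, hxV, hψ, hv⟩ := hex.choose_spec
  rw [hv]
  exact (h.unit_gradient_unique hM hψ hxU hxV hx).symm

namespace IsSmoothBoundedDomain

theorem isCompact_closure (hM : IsSmoothBoundedDomain M) : IsCompact (closure M) :=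
  hM.isBounded.isCompact_closure

theorem uniqueDiffOn_closure (hM : IsSmoothBoundedDomain M) : UniqueDiffOn ℝ (closure M) := by
  intro x hx
  by_cases hxM : x ∈ M
  · exact (hM.isOpen.uniqueDiffWithinAt hxM).mono subset_closure
  · have hf : x ∈ frontier M := by rw [hM.isOpen.frontier_eq]; exact ⟨hx, hxM⟩
    obtain ⟨U, φ, hxU, h⟩ := hM.smooth_boundary x hf
    exact h.uniqueDiffWithinAt hxU ((h.mem_closure_iff hxU).1 hx)

theorem continuousOn_outwardNormal (hM : IsSmoothBoundedDomain M) :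
    ContinuousOn (outwardNormal M) (frontier M) := by
  intro x hx
  obtain ⟨U, φ, hxU, h⟩ := hM.smooth_boundary x hx
  have hc : ContinuousAt (fun y => ‖gradient φ y‖⁻¹ • gradient φ y) x := by
    have := h.continuousOn_gradient.continuousAt (h.isOpen.mem_nhds hxU)
    exact (this.norm.inv₀ (norm_ne_zero_iff.2 (h.gradient_ne_zero x hxU))).smul this
  refine hc.continuousWithinAt.congr_of_eventuallyEq ?_ (outwardNormal_eq hM.isOpen h hxU hx)
  filter_upwards [self_mem_nhdsWithin, mem_nhdsWithin_of_mem_nhds (h.isOpen.mem_nhds hxU)]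
    with y hy hyU
  exact outwardNormal_eq hM.isOpen h hyU hy

end IsSmoothBoundedDomain

end NSF

namespace NSF

open Filter Topology Metric

/-! ### Integration by parts against compactly supported functions -/

/-- Nothing is known about `f` outside `O`, but every product carries a factor supported in
`tsupport g ⊆ O`, so it is continuous with compact support on the whole space. -/
theorem integral_mul_fderiv_of_tsupport_subset {E : Type*} [NormedAddCommGroup E]
    [NormedSpace ℝ E] [FiniteDimensional ℝ E] [MeasurableSpace E] [BorelSpace E] (μ : Measure E)
    [μ.IsAddHaarMeasure] {O : Set E} (hO : IsOpen O) {f g : E → ℝ} (hf : ContDiffOn ℝ 1 f O)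
    (hg : ContDiff ℝ 1 g) (hc : HasCompactSupport g) (hs : tsupport g ⊆ O) (v : E) :
    Integrable (fun x => f x * fderiv ℝ g x v) μ ∧ Integrable (fun x => fderiv ℝ f x v * g x) μ ∧
    ∫ x, f x * fderiv ℝ g x v ∂μ = -∫ x, fderiv ℝ f x v * g x ∂μ := by
  have hgc : Continuous fun x => fderiv ℝ g x v :=
    (hg.continuous_fderiv (by simp)).clm_apply continuous_const
  have hsv : tsupport (fun x => fderiv ℝ g x v) ⊆ tsupport g := tsupport_fderiv_apply_subset ℝ v
  have key : ∀ (h k : E → ℝ), ContinuousOn h O → Continuous k → tsupport k ⊆ tsupport g →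
      Integrable (fun x => h x * k x) μ := by
    intro h k hh hk hkg
    have hss : tsupport (fun x => h x * k x) ⊆ tsupport k := tsupport_mul_subset_right
    have hct : Continuous (fun x => h x * k x) :=
      (hh.mul hk.continuousOn).continuous_of_tsupport_subset hO ((hss.trans hkg).trans hs)
    exact hct.integrable_of_hasCompactSupport
      (hc.of_isClosed_subset (isClosed_tsupport _) (hss.trans hkg))
  have hf'c : ContinuousOn (fun x => fderiv ℝ f x v) O :=
    (hf.continuousOn_fderiv_of_isOpen hO (by simp)).clm_apply continuousOn_const
  have i1 := key f _ hf.continuousOn hgc hsv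
  have i2 := key _ g hf'c hg.continuous subset_rfl
  refine ⟨i1, i2, ?_⟩
  exact integral_mul_fderiv_eq_neg_fderiv_mul_of_integrable i2 i1
    (key f g hf.continuousOn hg.continuous subset_rfl)
    (fun x hx => (hf.contDiffAt (hO.mem_nhds (hs hx))).differentiableAt (by simp))
    (fun x _ => (hg.differentiable (by simp)) x)

theorem clm_apply_eq_sum {d : ℕ} (L : Space d →L[ℝ] ℝ) (v : Space d) :
    L v = ∑ i, v i * L (EuclideanSpace.single i 1) := by
  conv_lhs => rw [← (EuclideanSpace.basisFun (Fin d) ℝ).sum_repr v]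
  simp [map_sum]

theorem fderiv_coord {d : ℕ} {F : Space d → Space d} {x : Space d}
    (h : DifferentiableAt ℝ F x) (v : Space d) (i : Fin d) :
    fderiv ℝ (fun y => F y i) x v = fderiv ℝ F x v i := by
  have := ((EuclideanSpace.proj (𝕜 := ℝ) i).hasFDerivAt.comp x h.hasFDerivAt).fderiv
  simp only [Function.comp_def, PiLp.proj_apply] at this
  rw [this]; simp

theorem contDiffOn_coord {d : ℕ} {n : WithTop ℕ∞} {F : Space d → Space d} {s : Set (Space d)}
    (h : ContDiffOn ℝ n F s) (i : Fin d) : ContDiffOn ℝ n (fun y => F y i) s :=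
  (EuclideanSpace.proj (𝕜 := ℝ) i).contDiff.comp_contDiffOn h

/-- The divergence theorem for `g F` when `g` has compact support in the domain of `F`. -/
theorem integral_fderiv_apply_eq_neg_integral_mul_div {d : ℕ} {O : Set (Space d)} (hO : IsOpen O)
    {F : Space d → Space d} {g : Space d → ℝ} (hF : ContDiffOn ℝ 1 F O)
    (hg : ContDiff ℝ 1 g) (hc : HasCompactSupport g) (hs : tsupport g ⊆ O) :
    ∫ x, fderiv ℝ g x (F x) = -∫ x, g x * div F x := by
  have key := fun i => integral_mul_fderiv_of_tsupport_subset volume hO (contDiffOn_coord hF i) hg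
    hc hs (EuclideanSpace.single i 1)
  have e1 : ∀ x, fderiv ℝ g x (F x) = ∑ i, F x i * fderiv ℝ g x (EuclideanSpace.single i 1) :=
    fun x => clm_apply_eq_sum _ _
  have e2 : ∀ x, g x * div F x
      = ∑ i, fderiv ℝ (fun y => F y i) x (EuclideanSpace.single i 1) * g x := by
    intro x
    by_cases hx : x ∈ tsupport g
    · have hd : DifferentiableAt ℝ F x :=
        (hF.contDiffAt (hO.mem_nhds (hs hx))).differentiableAt (by simp)
      simp only [fderiv_coord hd, div, Finset.mul_sum, mul_comm]
    · simp [image_eq_zero_of_notMem_tsupport hx]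
  simp only [e1, e2]
  rw [integral_finsetSum _ fun i _ => (key i).1, integral_finsetSum _ fun i _ => (key i).2.1,
    ← Finset.sum_neg_distrib]
  exact Finset.sum_congr rfl fun i _ => (key i).2.2

/-! ### A smooth cutoff -/

/-- A smooth function that vanishes on `[-1, ∞)` and is `1` on `(-∞, -2]`. -/
noncomputable def cutoff (t : ℝ) : ℝ := Real.smoothTransition (-1 - t)

theorem contDiff_cutoff : ContDiff ℝ ∞ cutoff :=
  Real.smoothTransition.contDiff.comp (contDiff_const.sub contDiff_id)

theorem cutoff_eq_zero {t : ℝ} (h : -1 ≤ t) : cutoff t = 0 :=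
  Real.smoothTransition.zero_of_nonpos (by linarith)

theorem cutoff_eq_one {t : ℝ} (h : t ≤ -2) : cutoff t = 1 :=
  Real.smoothTransition.one_of_one_le (by linarith)

theorem abs_cutoff_le (t : ℝ) : |cutoff t| ≤ 1 := by
  rw [cutoff, abs_of_nonneg (Real.smoothTransition.nonneg _)]
  exact Real.smoothTransition.le_one _

theorem deriv_cutoff_eq_zero {t : ℝ} (h : t ∉ Icc (-2 : ℝ) (-1)) : deriv cutoff t = 0 := by
  rw [mem_Icc, not_and_or, not_le, not_le] at h
  rcases h with h | h
  · have : cutoff =ᶠ[𝓝 t] fun _ => 1 := by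
      filter_upwards [Iio_mem_nhds h] with s hs using cutoff_eq_one (le_of_lt hs)
    rw [this.deriv_eq]; simp
  · have : cutoff =ᶠ[𝓝 t] fun _ => 0 := by
      filter_upwards [Ioi_mem_nhds h] with s hs using cutoff_eq_zero (le_of_lt hs)
    rw [this.deriv_eq]; simp

theorem continuous_deriv_cutoff : Continuous (deriv cutoff) :=
  contDiff_cutoff.continuous_deriv (by simp)

theorem hasCompactSupport_deriv_cutoff : HasCompactSupport (deriv cutoff) :=
  HasCompactSupport.of_support_subset_isCompact isCompact_Icc fun t ht => by
    by_contra h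
    exact ht (deriv_cutoff_eq_zero h)

theorem integrable_deriv_cutoff : Integrable (deriv cutoff) :=
  continuous_deriv_cutoff.integrable_of_hasCompactSupport hasCompactSupport_deriv_cutoff

theorem integral_deriv_cutoff : ∫ t, deriv cutoff t = -1 := by
  have h1 : ∫ t in (-3 : ℝ)..0, deriv cutoff t = ∫ t, deriv cutoff t := by
    apply intervalIntegral.integral_eq_integral_of_support_subset
    intro t ht
    by_contra h
    refine ht (deriv_cutoff_eq_zero fun h' => h ⟨by linarith [h'.1], by linarith [h'.2]⟩)
  rw [← h1, intervalIntegral.integral_deriv_eq_sub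
    (fun t _ => (contDiff_cutoff.differentiable (by simp)) t)
    (continuous_deriv_cutoff.intervalIntegrable _ _), cutoff_eq_zero (by norm_num),
    cutoff_eq_one (by norm_num)]
  norm_num

/-! ### Concentration on a hyperplane -/

/-- Volume is the product of arc length along a unit vector and volume of the orthogonal
hyperplane. -/
theorem measurePreserving_add_smul_add {d : ℕ} (x₀ : Space d) {e : Space d} (he : ‖e‖ = 1) :
    MeasurePreserving (fun p : ℝ × ((ℝ ∙ e)ᗮ : Submodule ℝ (Space d)) => x₀ + p.1 • e + p.2)
      (volume.prod volume) volume := by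
  have h1 := ((ℝ ∙ e).measurePreserving_measurableEquivProd x₀).symm
  have hr : Module.finrank ℝ (Space d) = d := by simp
  rw [hr, EuclideanSpace.euclideanHausdorffMeasure_eq_volume] at h1
  have h2 := (LinearIsometryEquiv.toSpanUnitSingleton e he).measurePreserving
  have h3 := h2.prod (MeasurePreserving.id (volume : Measure ((ℝ ∙ e)ᗮ : Submodule ℝ (Space d))))
  have h4 := h1.comp h3
  have h5 : (fun p : ℝ × ((ℝ ∙ e)ᗮ : Submodule ℝ (Space d)) => x₀ + p.1 • e + p.2)
      = (⇑((ℝ ∙ e).measurableEquivProd x₀).symm ∘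
        Prod.map (⇑(LinearIsometryEquiv.toSpanUnitSingleton e he)) id) := by
    funext p
    simp [add_comm, add_left_comm]
  rw [h5]
  exact h4

/-- Integrating against an approximate unit that concentrates on one side of a hyperplane yields
in the limit the integral over that hyperplane. -/
theorem tendsto_integral_mul_deriv_cutoff {d : ℕ} (x₀ : Space d) {e : Space d} (he : ‖e‖ = 1)
    {W : Space d → ℝ} (hW : Measurable W) {C R : ℝ} (hC : ∀ z, |W z| ≤ C)
    (hR : ∀ z, R < ‖z - x₀‖ → W z = 0)
    (hlim : ∀ y : ((ℝ ∙ e)ᗮ : Submodule ℝ (Space d)),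
      Tendsto (fun t : ℝ => W (x₀ + t • e + y)) (𝓝[<] 0) (𝓝 (W (x₀ + y)))) :
    Tendsto (fun n : ℕ => ∫ z, W z * ((n + 1) * deriv cutoff ((n + 1) * inner ℝ e (z - x₀))))
      atTop (𝓝 (-∫ y : ((ℝ ∙ e)ᗮ : Submodule ℝ (Space d)), W (x₀ + y))) := by
  set S := ((ℝ ∙ e)ᗮ : Submodule ℝ (Space d)) with hS
  have hmp := measurePreserving_add_smul_add x₀ he
  have hey : ∀ y : S, inner ℝ e (y : Space d) = 0 := fun y =>
    Submodule.mem_orthogonal_singleton_iff_inner_right.1 y.2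
  have hin : ∀ (t : ℝ) (y : S), inner ℝ e (x₀ + t • e + (y : Space d) - x₀) = t := by
    intro t y
    rw [show x₀ + t • e + (y : Space d) - x₀ = t • e + y by abel, inner_add_right, hey,
      inner_smul_right, real_inner_self_eq_norm_sq, he]
    simp
  have hny : ∀ (t : ℝ) (y : S), ‖(y : Space d)‖ ≤ ‖x₀ + t • e + (y : Space d) - x₀‖ := by
    intro t y
    rw [show x₀ + t • e + (y : Space d) - x₀ = t • e + y by abel]
    have : inner ℝ (t • e) (y : Space d) = 0 := by rw [inner_smul_left, hey]; simp
    have h2 := norm_add_sq_real (t • e) (y : Space d)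
    rw [this] at h2
    refine le_of_sq_le_sq ?_ (norm_nonneg _)
    nlinarith [sq_nonneg ‖t • e‖]
  have hC0 : 0 ≤ C := (abs_nonneg _).trans (hC 0)
  have hWm : AEStronglyMeasurable (fun p : ℝ × S => W (x₀ + p.1 • e + p.2))
      (volume.prod volume) := (hW.comp hmp.measurable).aestronglyMeasurable
  -- By Pythagoras `W` vanishes once the hyperplane component is longer than `R`, so `C * b` is an
  -- integrable majorant in `y`, uniform in `t`.
  set b : S → ℝ := indicator (closedBall 0 R) (fun _ => 1) with hb
  have hb1 : Integrable b :=
    (integrable_indicator_iff measurableSet_closedBall).2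
      (integrableOn_const (measure_closedBall_lt_top).ne)
  have hWb : ∀ (t : ℝ) (y : S), |W (x₀ + t • e + y)| ≤ C * b y := by
    intro t y
    by_cases hy : y ∈ closedBall (0 : S) R
    · rw [hb, indicator_of_mem hy, mul_one]; exact hC _
    · rw [hb, indicator_of_notMem hy, hR]
      · simp
      · refine lt_of_lt_of_le ?_ (hny t y)
        rw [mem_closedBall, dist_zero_right, not_le] at hy
        exact hy
  -- Fubini along `e` and its orthogonal complement, then the substitution `τ = (n + 1) t`, which
  -- absorbs the factor `n + 1`.
  have hint : ∀ n : ℕ, ∫ z, W z * ((n + 1) * deriv cutoff ((n + 1) * inner ℝ e (z - x₀)))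
      = ∫ y : S, ∫ τ : ℝ, W (x₀ + (τ / (n + 1)) • e + y) * deriv cutoff τ := by
    intro n
    have hn : (0 : ℝ) < n + 1 := by positivity
    have hm1 : AEStronglyMeasurable
        (fun z => W z * ((n + 1) * deriv cutoff ((n + 1) * inner ℝ e (z - x₀)))) := by
      refine hW.aestronglyMeasurable.mul (Continuous.aestronglyMeasurable ?_)
      exact continuous_const.mul (continuous_deriv_cutoff.comp (by fun_prop))
    have hm2 : ∫ z, W z * ((n + 1) * deriv cutoff ((n + 1) * inner ℝ e (z - x₀)))
        = ∫ p : ℝ × S, W (x₀ + p.1 • e + p.2) * ((n + 1) * deriv cutoff ((n + 1) * p.1))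
          ∂(volume.prod volume) := by
      conv_lhs => rw [← hmp.map_eq]
      rw [integral_map hmp.aemeasurable (by rwa [hmp.map_eq])]
      simp only [hin]
      rfl
    rw [hm2]
    rw [integral_prod_symm]
    · congr 1
      ext y
      have := Measure.integral_comp_mul_left
        (fun τ => W (x₀ + (τ / (n + 1)) • e + y) * deriv cutoff τ) ((n : ℝ) + 1)
      rw [abs_of_pos (inv_pos.2 hn), smul_eq_mul, eq_inv_mul_iff_mul_eq₀ hn.ne',
        ← integral_const_mul] at this
      rw [← this]
      congr 1
      ext t
      rw [mul_div_cancel_left₀ _ hn.ne']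
      ring
    · have hb := ((integrable_deriv_cutoff.comp_mul_left' hn.ne').norm.const_mul
        (C * (n + 1))).mul_prod hb1
      refine hb.mono' (hWm.mul (Continuous.aestronglyMeasurable ?_)) (Eventually.of_forall ?_)
      · exact continuous_const.mul (continuous_deriv_cutoff.comp (by fun_prop))
      · rintro ⟨t, y⟩
        have := hWb t y
        simp only [norm_mul, Real.norm_eq_abs, abs_of_pos hn]
        calc _ ≤ (C * b y) * ((n + 1) * |deriv cutoff ((n + 1) * t)|) := by gcongr
          _ = _ := by ring
  simp only [hint]
  have hlim2 : ∀ y : S, Tendsto (fun n : ℕ =>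
      ∫ τ : ℝ, W (x₀ + (τ / (n + 1)) • e + y) * deriv cutoff τ) atTop (𝓝 (-W (x₀ + y))) := by
    intro y
    have : -W (x₀ + y) = ∫ τ : ℝ, W (x₀ + y) * deriv cutoff τ := by
      rw [integral_const_mul, integral_deriv_cutoff]; ring
    rw [this]
    refine tendsto_integral_of_dominated_convergence (fun τ => C * ‖deriv cutoff τ‖) ?_
      (integrable_deriv_cutoff.norm.const_mul C) ?_ ?_
    · intro n
      refine ((hW.comp ?_).mul continuous_deriv_cutoff.measurable).aestronglyMeasurable
      exact Continuous.measurable (by fun_prop)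
    · intro n
      refine Eventually.of_forall fun τ => ?_
      rw [norm_mul, Real.norm_eq_abs]
      gcongr
      exact hC _
    · refine Eventually.of_forall fun τ => ?_
      -- The derivative of `cutoff` lives on negative `τ`, so `τ / (n + 1)` tends to `0` from the
      -- left. Hence only the one-sided limit `hlim` is needed, and `W` may jump across the
      -- hyperplane.
      by_cases hτ : τ ∈ Icc (-2 : ℝ) (-1)
      · refine Tendsto.mul_const _ ((hlim y).comp ?_)
        rw [tendsto_nhdsWithin_iff]
        refine ⟨by simpa [div_eq_mul_inv] using (tendsto_one_div_add_atTop_nhds_zero_nat (𝕜 := ℝ)).const_mul τ, Eventually.of_forall fun n => ?_⟩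
        have hn : (0 : ℝ) < n + 1 := by positivity
        exact div_neg_of_neg_of_pos (by linarith [hτ.2]) hn
      · simp [deriv_cutoff_eq_zero hτ]
  rw [← integral_neg]
  refine tendsto_integral_of_dominated_convergence
    (fun y => (C * ∫ τ, ‖deriv cutoff τ‖) * b y) ?_ (hb1.const_mul _) ?_ ?_
  · intro n
    refine AEStronglyMeasurable.integral_prod_right' (μ := volume) (ν := volume)
      (f := fun p : S × ℝ => W (x₀ + (p.2 / (n + 1)) • e + p.1) * deriv cutoff p.2) ?_
    refine ((hW.comp ?_).mul (continuous_deriv_cutoff.measurable.comp measurable_snd)).aestronglyMeasurable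
    exact Continuous.measurable (by fun_prop)
  · intro n
    refine Eventually.of_forall fun y => ?_
    calc _ ≤ ∫ τ : ℝ, ‖W (x₀ + (τ / (n + 1)) • e + y) * deriv cutoff τ‖ :=
          norm_integral_le_integral_norm _
      _ ≤ ∫ τ, C * b y * ‖deriv cutoff τ‖ := by
          refine integral_mono_of_nonneg (Eventually.of_forall fun _ => norm_nonneg _)
            (integrable_deriv_cutoff.norm.const_mul _) (Eventually.of_forall fun τ => ?_)
          simp only [norm_mul, Real.norm_eq_abs]
          gcongr
          exact hWb _ _
      _ = _ := by rw [integral_const_mul]; ring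
  · exact Eventually.of_forall hlim2

/-! ### Comparable measures -/

/-- For nonnegative integrands each integral is at most `C` times the other, so they differ by at
most `(C - 1) ∫ f ∂μ`. The positive and negative parts of `g` are treated separately, and their
bounds add up to `∫ |g|`. -/
theorem abs_integral_sub_integral_le {α : Type*} [MeasurableSpace α] {μ ν : Measure α}
    {C : NNReal} (hC : 1 ≤ C) (h1 : ν ≤ C • μ) (h2 : μ ≤ C • ν) {g : α → ℝ}
    (hg : Integrable g μ) : |∫ x, g x ∂ν - ∫ x, g x ∂μ| ≤ (C - 1) * ∫ x, |g x| ∂μ := by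
  have hC1 : (1 : ℝ) ≤ C := hC
  have hgν : Integrable g ν := (hg.smul_measure_nnreal (c := C)).mono_measure h1
  have hgC : ∀ f : α → ℝ, Integrable f ν → Integrable f (C • ν) := fun f hf =>
    hf.smul_measure_nnreal (c := C)
  have key : ∀ f : α → ℝ, (∀ x, 0 ≤ f x) → Integrable f μ →
      |∫ x, f x ∂ν - ∫ x, f x ∂μ| ≤ (C - 1) * ∫ x, f x ∂μ := by
    intro f hf0 hf
    have hfν : Integrable f ν := (hf.smul_measure_nnreal (c := C)).mono_measure h1
    have a1 := integral_mono_measure h1 (Eventually.of_forall hf0) (hf.smul_measure_nnreal (c := C))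
    have a2 := integral_mono_measure h2 (Eventually.of_forall hf0) (hfν.smul_measure_nnreal (c := C))
    rw [integral_smul_nnreal_measure] at a1 a2
    have p1 : 0 ≤ ∫ x, f x ∂μ := integral_nonneg hf0
    have p2 : 0 ≤ ∫ x, f x ∂ν := integral_nonneg hf0
    simp only [NNReal.smul_def, smul_eq_mul] at a1 a2
    rw [abs_le]
    constructor
    · by_cases hle : ∫ x, f x ∂μ ≤ ∫ x, f x ∂ν
      · nlinarith
      · push Not at hle
        nlinarith
    · nlinarith
  have hp := key _ (fun x => le_max_right (g x) 0) hg.pos_part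
  have hn := key _ (fun x => le_max_right (-g x) 0) hg.neg_part
  have e : ∀ x, g x = max (g x) 0 - max (-g x) 0 := fun x => by
    rcases le_total (g x) 0 with h | h
    · rw [max_eq_right h, max_eq_left (by linarith)]; ring
    · rw [max_eq_left h, max_eq_right (by linarith)]; ring
  have e' : ∀ x, |g x| = max (g x) 0 + max (-g x) 0 := fun x => by
    rcases le_total (g x) 0 with h | h
    · rw [max_eq_right h, max_eq_left (by linarith), abs_of_nonpos h]; ring
    · rw [max_eq_left h, max_eq_right (by linarith), abs_of_nonneg h]; ring
  have i1 : ∫ x, g x ∂μ = ∫ x, max (g x) 0 ∂μ - ∫ x, max (-g x) 0 ∂μ := by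
    rw [← integral_sub hg.pos_part hg.neg_part]; exact integral_congr_ae (.of_forall e)
  have i2 : ∫ x, g x ∂ν = ∫ x, max (g x) 0 ∂ν - ∫ x, max (-g x) 0 ∂ν := by
    rw [← integral_sub hgν.pos_part hgν.neg_part]; exact integral_congr_ae (.of_forall e)
  have i3 : ∫ x, |g x| ∂μ = ∫ x, max (g x) 0 ∂μ + ∫ x, max (-g x) 0 ∂μ := by
    rw [← integral_add hg.pos_part hg.neg_part]; exact integral_congr_ae (.of_forall e')
  rw [i1, i2, i3]
  rw [abs_le] at hp hn ⊢
  constructor <;> linarith [hp.1, hp.2, hn.1, hn.2]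

/-- Used with the surface measure as `μ`, the flattened one as `ν`, and the density `κ` that a chart
introduces. The two error sources are split as `κ - 1` and `ν - μ`. -/
theorem abs_integral_mul_sub_integral_le {α : Type*} [MeasurableSpace α] {μ ν : Measure α}
    {C : NNReal} (hC : 1 ≤ C) (h1 : ν ≤ C • μ) (h2 : μ ≤ C • ν) {g κ : α → ℝ}
    (hg : Integrable g μ) (hκ : AEStronglyMeasurable κ ν) {c : ℝ}
    (hκc : ∀ᵐ x ∂ν, |κ x - 1| ≤ c) (hc : 0 ≤ c) :
    |∫ x, g x * κ x ∂ν - ∫ x, g x ∂μ| ≤ (c * C + (C - 1)) * ∫ x, |g x| ∂μ := by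
  have hgν : Integrable g ν := (hg.smul_measure_nnreal (c := C)).mono_measure h1
  have hgκ : Integrable (fun x => g x * (κ x - 1)) ν := by
    refine (hgν.norm.const_mul c).mono' (hgν.1.mul (hκ.sub aestronglyMeasurable_const)) ?_
    filter_upwards [hκc] with x hx
    rw [norm_mul, mul_comm]
    exact mul_le_mul_of_nonneg_right hx (norm_nonneg _)
  have e1 : ∫ x, g x * κ x ∂ν = ∫ x, g x * (κ x - 1) ∂ν + ∫ x, g x ∂ν := by
    rw [← integral_add hgκ hgν]
    exact integral_congr_ae (.of_forall fun x => by ring)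
  have e2 : |∫ x, g x * (κ x - 1) ∂ν| ≤ c * ∫ x, |g x| ∂ν := by
    rw [← integral_const_mul]
    refine norm_integral_le_of_norm_le (f := fun x => g x * (κ x - 1)) (hgν.norm.const_mul c) ?_
    filter_upwards [hκc] with x hx
    rw [norm_mul, mul_comm]
    exact mul_le_mul_of_nonneg_right hx (norm_nonneg _)
  have e3 : ∫ x, |g x| ∂ν ≤ C * ∫ x, |g x| ∂μ := by
    have := integral_mono_measure h1 (Eventually.of_forall fun x => abs_nonneg (g x))
      (hg.abs.smul_measure_nnreal (c := C))
    rwa [integral_smul_nnreal_measure] at this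
  have e4 := abs_integral_sub_integral_le hC h1 h2 hg
  have e5 := mul_le_mul_of_nonneg_left e3 hc
  calc |∫ x, g x * κ x ∂ν - ∫ x, g x ∂μ|
      = |∫ x, g x * (κ x - 1) ∂ν + (∫ x, g x ∂ν - ∫ x, g x ∂μ)| := by rw [e1]; ring_nf
    _ ≤ _ := abs_add_le _ _
    _ ≤ _ := by linarith

end NSF

namespace NSF

open Filter Topology Metric
open scoped NNReal ENNReal

variable {d : ℕ} {M U B : Set (Space d)} {φ : Space d → ℝ} {x₀ e : Space d} {c : ℝ≥0}

/-! ### Flattening the boundary -/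

theorem IsDefiningFunction.mono (h : IsDefiningFunction M U φ) {V : Set (Space d)}
    (hV : IsOpen V) (hVU : V ⊆ U) : IsDefiningFunction M V φ where
  isOpen := hV
  smooth := h.smooth.mono hVU
  gradient_ne_zero y hy := h.gradient_ne_zero y (hVU hy)
  inter_eq := by
    ext y
    simp only [mem_inter_iff, mem_ofPred_eq]
    exact ⟨fun hy => ⟨hy.2, (h.mem_iff (hVU hy.2)).1 hy.1⟩,
      fun hy => ⟨(h.mem_iff (hVU hy.1)).2 hy.2, hy.1⟩⟩

theorem gradient_const_mul {x : Space d} (h : DifferentiableAt ℝ φ x) (a : ℝ) :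
    gradient (fun y => a * φ y) x = a • gradient φ x := by
  rw [gradient, gradient, fderiv_const_mul h, map_smul]

theorem IsDefiningFunction.const_mul (h : IsDefiningFunction M U φ) {a : ℝ} (ha : 0 < a) :
    IsDefiningFunction M U (fun y => a * φ y) where
  isOpen := h.isOpen
  smooth := contDiffOn_const.mul h.smooth
  gradient_ne_zero y hy := by
    rw [gradient_const_mul (h.hasFDerivAt hy).differentiableAt]
    exact smul_ne_zero ha.ne' (h.gradient_ne_zero y hy)
  inter_eq := by
    rw [h.inter_eq]
    ext y
    simp only [mem_ofPred_eq, mul_neg_iff, ha, true_and, not_lt.2 ha.le, false_and, or_false]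

/-- The map that replaces the coordinate of `x - x₀` along `e` by `φ x`. -/
noncomputable def flatten (φ : Space d → ℝ) (x₀ e x : Space d) : Space d :=
  x + (φ x - inner ℝ e (x - x₀)) • e

/-- A neighbourhood `B` of a boundary point on which flattening the boundary is, up to a relative
error `c`, an isometry that maps the unit normal to `e`. -/
structure IsFlatChart (M B : Set (Space d)) (φ : Space d → ℝ) (x₀ e : Space d) (c : ℝ≥0) :
    Prop where
  defining : IsDefiningFunction M B φ
  norm_eq : ‖e‖ = 1
  isBounded : Bornology.IsBounded B
  lt_one : c < 1
  approx : ApproximatesLinearOn (flatten φ x₀ e)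
    (ContinuousLinearEquiv.refl ℝ (Space d) : Space d →L[ℝ] Space d) B c
  det_ne_zero : ∀ x ∈ B, (fderiv ℝ (flatten φ x₀ e) x).det ≠ 0
  ratio : ∀ x ∈ B, |‖gradient φ x‖ / |(fderiv ℝ (flatten φ x₀ e) x).det| - 1| ≤ c

theorem contDiffOn_flatten (h : IsDefiningFunction M U φ) (x₀ e : Space d) :
    ContDiffOn ℝ ∞ (flatten φ x₀ e) U := by
  refine contDiffOn_id.add ((h.smooth.sub ?_).smul contDiffOn_const)
  exact (contDiff_const.inner ℝ (contDiff_id.sub contDiff_const)).contDiffOn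

/-- Once `φ` is rescaled so that its gradient at `x₀` is a unit vector `e`, the flattening map has
derivative the identity at `x₀`. Every condition on the chart then holds at `x₀` with room to spare
and persists on a small ball. -/
theorem exists_isFlatChart (hM : IsSmoothBoundedDomain M) (hx₀ : x₀ ∈ frontier M) (hc0 : 0 < c)
    (hc1 : c < 1) : ∃ B φ e, x₀ ∈ B ∧ IsFlatChart M B φ x₀ e c := by
  obtain ⟨U, φ₀, hxU, h₀⟩ := hM.smooth_boundary x₀ hx₀
  have hg : 0 < ‖gradient φ₀ x₀‖ := norm_pos_iff.2 (h₀.gradient_ne_zero x₀ hxU)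
  set a := ‖gradient φ₀ x₀‖⁻¹ with ha
  have ha0 : 0 < a := inv_pos.2 hg
  have h := h₀.const_mul ha0
  set φ := fun y => a * φ₀ y with hφ
  set e := gradient φ x₀ with he
  have hne : ‖e‖ = 1 := by
    rw [he, gradient_const_mul (h₀.hasFDerivAt hxU).differentiableAt, norm_smul, ha, norm_inv,
      norm_norm, inv_mul_cancel₀ hg.ne']
  have hcd := contDiffOn_flatten h x₀ e
  have hcda : ContDiffAt ℝ ∞ (flatten φ x₀ e) x₀ := hcd.contDiffAt (h.isOpen.mem_nhds hxU)
  have hd : HasFDerivAt (flatten φ x₀ e) (ContinuousLinearMap.id ℝ (Space d)) x₀ := by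
    -- The correction that flattening adds has zero derivative at `x₀`, because `e` is the gradient
    -- of `φ` there.
    have h1 : HasFDerivAt (fun x => φ x - inner ℝ e (x - x₀)) (0 : Space d →L[ℝ] ℝ) x₀ := by
      have h2 : HasFDerivAt (fun x => inner ℝ e (x - x₀)) (innerSL ℝ e) x₀ :=
        ((innerSL ℝ e).hasFDerivAt).comp x₀ ((hasFDerivAt_id x₀).sub_const x₀)
      have h3 := (h.hasFDerivAt hxU).sub h2
      convert! h3 using 1
      ext w
      simp [he]
    have h4 := (hasFDerivAt_id x₀).add (h1.smul_const e)
    convert! h4 using 1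
    ext w
    simp
  have hstrict : HasStrictFDerivAt (flatten φ x₀ e) (ContinuousLinearMap.id ℝ (Space d)) x₀ := by
    have := hcda.hasStrictFDerivAt (by simp)
    rwa [hd.fderiv] at this
  obtain ⟨s, hs, happ⟩ := hstrict.approximates_deriv_on_nhds (Or.inr hc0)
  have hdc : ContinuousAt (fun x => (fderiv ℝ (flatten φ x₀ e) x).det) x₀ :=
    ContinuousLinearMap.continuous_det.continuousAt.comp
      ((hcd.continuousOn_fderiv_of_isOpen h.isOpen (by simp)).continuousAt
        (h.isOpen.mem_nhds hxU))
  have hdet : (fderiv ℝ (flatten φ x₀ e) x₀).det = 1 := by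
    rw [hd.fderiv]; exact LinearMap.det_id
  have hrc : ContinuousAt (fun x => |‖gradient φ x‖ / |(fderiv ℝ (flatten φ x₀ e) x).det| - 1|)
      x₀ := by
    refine (((h.continuousOn_gradient.continuousAt (h.isOpen.mem_nhds hxU)).norm.div hdc.abs
      ?_).sub continuousAt_const).abs
    rw [hdet]; simp
  have e1 : ∀ᶠ x in 𝓝 x₀, (fderiv ℝ (flatten φ x₀ e) x).det ≠ 0 :=
    hdc.eventually_ne (by rw [hdet]; exact one_ne_zero)
  have e2 : ∀ᶠ x in 𝓝 x₀, |‖gradient φ x‖ / |(fderiv ℝ (flatten φ x₀ e) x).det| - 1| < c := by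
    refine hrc.eventually_lt continuousAt_const ?_
    rw [hdet, ← he, hne]
    simpa using hc0
  obtain ⟨r, hr, hrs⟩ := Metric.mem_nhds_iff.1
    (inter_mem hs (inter_mem (h.isOpen.mem_nhds hxU) (e1.and e2)))
  refine ⟨ball x₀ r, φ, e, mem_ball_self hr, ?_, hne, isBounded_ball, hc1, ?_, ?_, ?_⟩
  · exact h.mono isOpen_ball fun x hx => (hrs hx).2.1
  · exact happ.mono_set fun x hx => (hrs hx).1
  · exact fun x hx => (hrs hx).2.2.1
  · exact fun x hx => (hrs hx).2.2.2.le

theorem euclideanHausdorffMeasure_image_le {X Y : Type*} [EMetricSpace X] [EMetricSpace Y]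
    [MeasurableSpace X] [BorelSpace X] [MeasurableSpace Y] [BorelSpace Y] {f : X → Y} {s : Set X}
    {K : ℝ≥0} (h : LipschitzOnWith K f s) (k : ℕ) :
    Measure.euclideanHausdorffMeasure k (f '' s)
      ≤ (K : ℝ≥0∞) ^ k * Measure.euclideanHausdorffMeasure k s := by
  simp only [Measure.euclideanHausdorffMeasure_def, Measure.smul_apply]
  rw [mul_smul_comm]
  have := h.hausdorffMeasure_image_le (d := k) (by positivity)
  rw [ENNReal.rpow_natCast] at this
  gcongr

namespace IsFlatChart

variable (h : IsFlatChart M B φ x₀ e c)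
include h

theorem inner_flatten (x : Space d) : inner ℝ e (flatten φ x₀ e x - x₀) = φ x := by
  rw [flatten, show x + (φ x - inner ℝ e (x - x₀)) • e - x₀
    = (x - x₀) + (φ x - inner ℝ e (x - x₀)) • e by abel, inner_add_right, inner_smul_right,
    real_inner_self_eq_norm_sq, h.norm_eq]
  ring

theorem nnnorm_symm : Subsingleton (Space d) ∨
    c < ‖((ContinuousLinearEquiv.refl ℝ (Space d)).symm : Space d →L[ℝ] Space d)‖₊⁻¹ := by
  rcases subsingleton_or_nontrivial (Space d) with hs | hs
  · exact Or.inl hs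
  · right
    have : ‖((ContinuousLinearEquiv.refl ℝ (Space d)).symm : Space d →L[ℝ] Space d)‖₊ = 1 :=
      ContinuousLinearMap.nnnorm_id
    rw [this, inv_one]
    exact h.lt_one

/-- The flattening map as a homeomorphism of `B` onto its image. -/
noncomputable def homeo : OpenPartialHomeomorph (Space d) (Space d) :=
  h.approx.toOpenPartialHomeomorph _ _ h.nnnorm_symm h.defining.isOpen

theorem homeo_target : h.homeo.target = flatten φ x₀ e '' B := rfl

theorem symm_flatten {x : Space d} (hx : x ∈ B) : h.homeo.symm (flatten φ x₀ e x) = x :=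
  h.homeo.left_inv hx

theorem flatten_symm {z : Space d} (hz : z ∈ h.homeo.target) :
    flatten φ x₀ e (h.homeo.symm z) = z :=
  h.homeo.right_inv hz

theorem symm_mem {z : Space d} (hz : z ∈ h.homeo.target) : h.homeo.symm z ∈ B :=
  h.homeo.map_target hz

theorem phi_symm {z : Space d} (hz : z ∈ h.homeo.target) :
    φ (h.homeo.symm z) = inner ℝ e (z - x₀) := by
  rw [← h.inner_flatten, h.flatten_symm hz]

theorem norm_flatten_sub_le {x y : Space d} (hx : x ∈ B) (hy : y ∈ B) :
    ‖flatten φ x₀ e x - flatten φ x₀ e y‖ ≤ (1 + c) * ‖x - y‖ := by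
  have := h.approx x hx y hy
  have h2 := norm_sub_norm_le (flatten φ x₀ e x - flatten φ x₀ e y) (x - y)
  simp only [ContinuousLinearEquiv.coe_coe, ContinuousLinearEquiv.refl_apply] at this
  linarith

theorem norm_sub_le {x y : Space d} (hx : x ∈ B) (hy : y ∈ B) :
    ‖x - y‖ ≤ ((1 - c)⁻¹ : ℝ≥0) * ‖flatten φ x₀ e x - flatten φ x₀ e y‖ := by
  have := h.approx x hx y hy
  have h2 := norm_sub_norm_le (x - y) (flatten φ x₀ e x - flatten φ x₀ e y)
  rw [norm_sub_rev (x - y)] at h2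
  simp only [ContinuousLinearEquiv.coe_coe, ContinuousLinearEquiv.refl_apply] at this
  have hc : (0 : ℝ) < 1 - c := sub_pos.2 (by exact_mod_cast h.lt_one)
  rw [NNReal.coe_inv, NNReal.coe_sub h.lt_one.le, NNReal.coe_one, inv_mul_eq_div, le_div_iff₀ hc]
  linarith

theorem isBounded_target : Bornology.IsBounded h.homeo.target := by
  obtain ⟨C, hC⟩ := Metric.isBounded_iff.1 h.isBounded
  rw [h.homeo_target, Metric.isBounded_iff]
  refine ⟨(1 + c) * C, ?_⟩
  rintro _ ⟨x, hx, rfl⟩ _ ⟨y, hy, rfl⟩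
  rw [dist_eq_norm]
  refine (h.norm_flatten_sub_le hx hy).trans ?_
  have := hC hx hy
  rw [dist_eq_norm] at this
  gcongr

end IsFlatChart

end NSF

/-! ### Parametrizing the boundary by a hyperplane; integrals over thin layers -/

namespace NSF

open Filter Topology Metric
open scoped NNReal ENNReal

variable {d : ℕ} {M U B : Set (Space d)} {φ : Space d → ℝ} {x₀ e : Space d} {c : ℝ≥0}

/-- The coordinate on the hyperplane of a point near the boundary. -/
noncomputable def coord (φ : Space d → ℝ) (x₀ e x : Space d) :
    ((ℝ ∙ e)ᗮ : Submodule ℝ (Space d)) :=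
  (ℝ ∙ e)ᗮ.orthogonalProjectionOnto (flatten φ x₀ e x - x₀)

theorem inner_coe_orthogonal (y : ((ℝ ∙ e)ᗮ : Submodule ℝ (Space d))) :
    inner ℝ e (y : Space d) = 0 :=
  Submodule.mem_orthogonal_singleton_iff_inner_right.1 y.2

namespace IsFlatChart

variable (h : IsFlatChart M B φ x₀ e c)
include h

/-- The part of the hyperplane that corresponds to the boundary. -/
def base : Set ((ℝ ∙ e)ᗮ : Submodule ℝ (Space d)) := {y | x₀ + (y : Space d) ∈ h.homeo.target}

/-- The parametrization of the boundary by the hyperplane. -/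
noncomputable def param (y : ((ℝ ∙ e)ᗮ : Submodule ℝ (Space d))) : Space d :=
  h.homeo.symm (x₀ + y)

theorem isOpen_base : IsOpen h.base :=
  h.homeo.open_target.preimage (by fun_prop)

theorem isBounded_base : Bornology.IsBounded h.base := by
  obtain ⟨C, hC⟩ := Metric.isBounded_iff.1 h.isBounded_target
  refine Metric.isBounded_iff.2 ⟨C, fun y hy z hz => ?_⟩
  have := hC hy hz
  rwa [dist_add_left] at this

theorem param_mem {y : ((ℝ ∙ e)ᗮ : Submodule ℝ (Space d))} (hy : y ∈ h.base) :
    h.param y ∈ B := h.symm_mem hy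

theorem phi_param {y : ((ℝ ∙ e)ᗮ : Submodule ℝ (Space d))} (hy : y ∈ h.base) :
    φ (h.param y) = 0 := by
  rw [param, h.phi_symm hy, add_sub_cancel_left, inner_coe_orthogonal]

theorem flatten_param {y : ((ℝ ∙ e)ᗮ : Submodule ℝ (Space d))} (hy : y ∈ h.base) :
    flatten φ x₀ e (h.param y) = x₀ + y := h.flatten_symm hy

theorem continuousOn_param : ContinuousOn h.param h.base :=
  h.homeo.continuousOn_symm.comp (by fun_prop) fun _ hy => hy

theorem coord_param {y : ((ℝ ∙ e)ᗮ : Submodule ℝ (Space d))} (hy : y ∈ h.base) :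
    (coord φ x₀ e) (h.param y) = y := by
  rw [coord, h.flatten_param hy, add_sub_cancel_left,
    Submodule.orthogonalProjectionOnto_mem_subspace_eq_self]

theorem exists_param_eq {x : Space d} (hx : x ∈ B) (h0 : φ x = 0) :
    ∃ y ∈ h.base, h.param y = x := by
  have hm : flatten φ x₀ e x - x₀ ∈ (ℝ ∙ e)ᗮ := by
    rw [Submodule.mem_orthogonal_singleton_iff_inner_right, h.inner_flatten, h0]
  have hb : x₀ + (flatten φ x₀ e x - x₀) = flatten φ x₀ e x := by abel
  refine ⟨⟨_, hm⟩, ?_, ?_⟩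
  · change x₀ + (flatten φ x₀ e x - x₀) ∈ h.homeo.target
    rw [hb, h.homeo_target]
    exact mem_image_of_mem _ hx
  · change h.homeo.symm (x₀ + (flatten φ x₀ e x - x₀)) = x
    rw [hb, h.symm_flatten hx]

theorem lipschitzOnWith_param : LipschitzOnWith (1 - c)⁻¹ h.param h.base :=
  LipschitzOnWith.of_dist_le_mul fun y hy z hz => by
    have := h.norm_sub_le (h.param_mem hy) (h.param_mem hz)
    rw [h.flatten_param hy, h.flatten_param hz, add_sub_add_left_eq_sub] at this
    rw [dist_eq_norm, dist_eq_norm]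
    exact this

theorem lipschitzOnWith_coord : LipschitzOnWith (1 + c) (coord φ x₀ e) B :=
  LipschitzOnWith.of_dist_le_mul fun x hx y hy => by
    rw [dist_eq_norm, dist_eq_norm, coord, coord, ← map_sub, sub_sub_sub_cancel_right]
    refine (Submodule.norm_orthogonalProjectionOnto_apply_le _ _).trans ?_
    exact_mod_cast h.norm_flatten_sub_le hx hy

theorem aemeasurable_param : AEMeasurable h.param (volume.restrict h.base) :=
  h.continuousOn_param.aemeasurable h.isOpen_base.measurableSet

/-- Lebesgue measure of the hyperplane, transported to the boundary. -/
noncomputable def flatMeasure : Measure (Space d) := (volume.restrict h.base).map h.param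

theorem finrank_orthogonal : Module.finrank ℝ ((ℝ ∙ e)ᗮ : Submodule ℝ (Space d)) = d - 1 := by
  have he : e ≠ 0 := fun h0 => by simpa [h0] using h.norm_eq
  have := Submodule.finrank_add_finrank_orthogonal (𝕜 := ℝ) (ℝ ∙ e)
  rw [finrank_span_singleton he, finrank_euclideanSpace, Fintype.card_fin] at this
  omega

/-- With the Euclidean normalization, Lebesgue measure on the hyperplane is itself a Hausdorff
measure, so Lipschitz bounds compare it directly with the surface measure. -/
theorem volume_eq : (volume : Measure ((ℝ ∙ e)ᗮ : Submodule ℝ (Space d)))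
    = Measure.euclideanHausdorffMeasure (d - 1) := by
  rw [← h.finrank_orthogonal, InnerProductSpace.euclideanHausdorffMeasure_eq_volume]

theorem surfaceMeasure_restrict_apply (hM : IsOpen M) {A : Set (Space d)} (hA : MeasurableSet A) :
    (surfaceMeasure M).restrict B A
      = Measure.euclideanHausdorffMeasure (d - 1) (A ∩ (B ∩ {x | φ x = 0})) := by
  rw [Measure.restrict_apply hA, surfaceMeasure,
    Measure.restrict_apply (hA.inter h.defining.isOpen.measurableSet), inter_assoc]
  congr 1
  ext x
  simp only [mem_inter_iff, mem_ofPred_eq]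
  exact and_congr_right fun _ => and_congr_right fun hx => h.defining.mem_frontier_iff hM hx

/-- The coordinate map is `(1 + c)`-Lipschitz and inverts the parametrization, so it covers the
parameter set of `A` by an image of the boundary part of `A`. -/
theorem flatMeasure_le (hM : IsOpen M) :
    h.flatMeasure ≤ ((1 - c)⁻¹ ^ (d - 1)) • (surfaceMeasure M).restrict B := by
  refine Measure.le_iff.2 fun A hA => ?_
  rw [flatMeasure, Measure.map_apply_of_aemeasurable h.aemeasurable_param hA, Measure.smul_apply,
    h.surfaceMeasure_restrict_apply hM hA, Measure.restrict_apply₀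
      (h.aemeasurable_param.nullMeasurableSet_preimage hA), h.volume_eq]
  have hsub : h.param ⁻¹' A ∩ h.base ⊆ (coord φ x₀ e) '' (A ∩ (B ∩ {x | φ x = 0})) := fun y hy =>
    ⟨h.param y, ⟨hy.1, h.param_mem hy.2, h.phi_param hy.2⟩, h.coord_param hy.2⟩
  refine (measure_mono hsub).trans ((euclideanHausdorffMeasure_image_le
    (h.lipschitzOnWith_coord.mono fun x hx => hx.2.1) _).trans ?_)
  rw [ENNReal.smul_def, smul_eq_mul]
  gcongr
  rw [ENNReal.coe_pow]
  gcongr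
  -- Since `(1 + c) (1 - c) ≤ 1`, the constant `1 + c` can be weakened to `(1 - c)⁻¹`, so that both
  -- comparisons use the same factor.
  have hc : (0 : ℝ) < 1 - c := sub_pos.2 (by exact_mod_cast h.lt_one)
  rw [← NNReal.coe_le_coe, NNReal.coe_inv, NNReal.coe_sub h.lt_one.le, ← one_div, NNReal.coe_one,
    le_div_iff₀ hc]
  push_cast
  nlinarith [sq_nonneg (c : ℝ)]

/-- The parametrization is `(1 - c)⁻¹`-Lipschitz and reaches every boundary point in the chart. -/
theorem le_flatMeasure (hM : IsOpen M) :
    (surfaceMeasure M).restrict B ≤ ((1 - c)⁻¹ ^ (d - 1)) • h.flatMeasure := by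
  refine Measure.le_iff.2 fun A hA => ?_
  rw [flatMeasure, Measure.smul_apply, Measure.map_apply_of_aemeasurable h.aemeasurable_param hA,
    h.surfaceMeasure_restrict_apply hM hA, Measure.restrict_apply₀
      (h.aemeasurable_param.nullMeasurableSet_preimage hA), h.volume_eq]
  have hsub : A ∩ (B ∩ {x | φ x = 0}) ⊆ h.param '' (h.param ⁻¹' A ∩ h.base) := by
    rintro x ⟨hxA, hxB, hx⟩
    obtain ⟨y, hy, rfl⟩ := h.exists_param_eq hxB hx
    exact ⟨y, ⟨hxA, hy⟩, rfl⟩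
  refine (measure_mono hsub).trans ((euclideanHausdorffMeasure_image_le
    (h.lipschitzOnWith_param.mono inter_subset_right) _).trans ?_)
  rw [ENNReal.smul_def, smul_eq_mul, ENNReal.coe_pow]

theorem flatMeasure_univ_lt_top : h.flatMeasure univ < ⊤ := by
  rw [flatMeasure, Measure.map_apply_of_aemeasurable h.aemeasurable_param .univ, preimage_univ,
    Measure.restrict_apply_univ]
  exact h.isBounded_base.measure_lt_top

theorem surfaceMeasure_lt_top (hM : IsOpen M) : surfaceMeasure M B < ⊤ := by
  have := h.le_flatMeasure hM univ
  rw [Measure.restrict_apply_univ, Measure.smul_apply, ENNReal.smul_def, smul_eq_mul] at this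
  exact this.trans_lt (ENNReal.mul_lt_top ENNReal.coe_lt_top h.flatMeasure_univ_lt_top)

theorem flatMeasure_ae_mem (hM : IsOpen M) : ∀ᵐ x ∂h.flatMeasure, x ∈ B ∩ frontier M := by
  have hm : MeasurableSet (B ∩ frontier M) :=
    h.defining.isOpen.measurableSet.inter isClosed_frontier.measurableSet
  refine (ae_map_iff h.aemeasurable_param hm).2 ?_
  exact (ae_restrict_mem h.isOpen_base.measurableSet).mono fun y hy =>
    ⟨h.param_mem hy, (h.defining.mem_frontier_iff hM (h.param_mem hy)).2 (h.phi_param hy)⟩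

theorem aestronglyMeasurable_flatMeasure (hM : IsOpen M) {f : Space d → ℝ}
    (hf : ContinuousOn f (B ∩ frontier M)) : AEStronglyMeasurable f h.flatMeasure := by
  rw [← Measure.restrict_eq_self_of_ae_mem (h.flatMeasure_ae_mem hM)]
  exact hf.aestronglyMeasurable
    (h.defining.isOpen.measurableSet.inter isClosed_frontier.measurableSet)

/-- Integrals over thin layers inside the boundary tend to an integral over the boundary. -/
theorem tendsto_integral_layer (hM : IsOpen M) {G : Space d → ℝ}
    (hG : ContinuousOn G (closure M ∩ B))
    {K : Set (Space d)} (hK : IsCompact K) (hKB : K ⊆ B) (hGK : ∀ x ∉ K, G x = 0) :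
    Tendsto (fun n : ℕ => ∫ x in M ∩ B, |(fderiv ℝ (flatten φ x₀ e) x).det| *
        (G x * ((n + 1) * deriv cutoff ((n + 1) * φ x))))
      atTop (𝓝 (-∫ x, G x ∂h.flatMeasure)) := by
  set T := h.homeo.target with hT
  set A := T ∩ {z | inner ℝ e (z - x₀) ≤ 0} with hA
  have hTo : IsOpen T := h.homeo.open_target
  have hAm : MeasurableSet A := hTo.measurableSet.inter
    (isClosed_le (by fun_prop) continuous_const).measurableSet
  have hmaps : MapsTo h.homeo.symm A (closure M ∩ B) := fun z hz =>
    ⟨(h.defining.mem_closure_iff (h.symm_mem hz.1)).2 ((h.phi_symm hz.1).trans_le hz.2),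
      h.symm_mem hz.1⟩
  have hcont : ContinuousOn (fun z => G (h.homeo.symm z)) A :=
    hG.comp (h.homeo.continuousOn_symm.mono inter_subset_left) hmaps
  -- `G` in flat coordinates, extended by zero across the hyperplane: outside `closure M` nothing is
  -- known about `G`.
  set W := indicator A fun z => G (h.homeo.symm z) with hW
  have hWm : Measurable W := by
    classical
    rw [hW, ← piecewise_eq_indicator]
    exact hcont.measurable_piecewise continuousOn_const hAm
  obtain ⟨C, hC⟩ := (hK.inter_right (isClosed_closure (s := M))).exists_bound_of_continuousOn
    (hG.mono fun x hx => ⟨hx.2, hKB hx.1⟩)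
  have hWC : ∀ z, |W z| ≤ max C 0 := by
    intro z
    by_cases hz : z ∈ A
    · rw [hW, indicator_of_mem hz]
      by_cases hzK : h.homeo.symm z ∈ K
      · exact (hC _ ⟨hzK, (hmaps hz).1⟩).trans (le_max_left _ _)
      · rw [hGK _ hzK]; simp
    · rw [hW, indicator_of_notMem hz]; simp
  obtain ⟨R, hR⟩ := h.isBounded_target.subset_closedBall x₀
  have hWR : ∀ z, R < ‖z - x₀‖ → W z = 0 := by
    intro z hz
    refine indicator_of_notMem (fun hzA => ?_) _
    have := hR hzA.1
    rw [mem_closedBall, dist_eq_norm] at this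
    exact absurd hz (not_lt.2 this)
  have hin : ∀ (t : ℝ) (y : ((ℝ ∙ e)ᗮ : Submodule ℝ (Space d))),
      inner ℝ e (x₀ + t • e + (y : Space d) - x₀) = t := by
    intro t y
    rw [show x₀ + t • e + (y : Space d) - x₀ = t • e + y by abel, inner_add_right,
      inner_coe_orthogonal, inner_smul_right, real_inner_self_eq_norm_sq, h.norm_eq]
    simp
  have hlim : ∀ y : ((ℝ ∙ e)ᗮ : Submodule ℝ (Space d)),
      Tendsto (fun t : ℝ => W (x₀ + t • e + y)) (𝓝[<] 0) (𝓝 (W (x₀ + y))) := by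
    intro y
    have ht : Tendsto (fun t : ℝ => x₀ + t • e + (y : Space d)) (𝓝[<] 0) (𝓝 (x₀ + y)) := by
      have : Continuous (fun t : ℝ => x₀ + t • e + (y : Space d)) := by fun_prop
      simpa using (this.tendsto 0).mono_left nhdsWithin_le_nhds
    by_cases hy : x₀ + (y : Space d) ∈ T
    · have hyA : x₀ + (y : Space d) ∈ A := ⟨hy, by simp [inner_coe_orthogonal]⟩
      have hWc : ContinuousOn W A := hcont.congr fun z hz => indicator_of_mem hz _
      refine (hWc _ hyA).tendsto.comp (tendsto_nhdsWithin_iff.2 ⟨ht, ?_⟩)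
      filter_upwards [ht.eventually (hTo.mem_nhds hy), self_mem_nhdsWithin] with t htT (ht0 : t < 0)
      exact ⟨htT, ((hin t y).trans_lt ht0).le⟩
    -- A point of the hyperplane off the image of the chart is also off the closed image of `K`, so
    -- `W` vanishes near it.
    · have hKc : IsClosed (flatten φ x₀ e '' K) :=
        (hK.image_of_continuousOn (h.approx.continuousOn.mono hKB)).isClosed
      have hyK : x₀ + (y : Space d) ∉ flatten φ x₀ e '' K := fun hm => hy (image_mono hKB hm)
      have hz : ∀ z ∉ flatten φ x₀ e '' K, W z = 0 := by
        intro z hz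
        by_cases hzA : z ∈ A
        · rw [hW, indicator_of_mem hzA]
          exact hGK _ fun hk => hz ⟨_, hk, h.flatten_symm hzA.1⟩
        · exact indicator_of_notMem hzA _
      rw [hz _ hyK]
      refine tendsto_const_nhds.congr' ?_
      filter_upwards [ht.eventually (hKc.isOpen_compl.mem_nhds hyK)] with t ht'
      exact (hz _ ht').symm
  have main := tendsto_integral_mul_deriv_cutoff x₀ h.norm_eq hWm hWC hWR hlim
  have hfl : ∫ x, G x ∂h.flatMeasure
      = ∫ y : ((ℝ ∙ e)ᗮ : Submodule ℝ (Space d)), W (x₀ + y) := by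
    rw [flatMeasure, integral_map h.aemeasurable_param (h.aestronglyMeasurable_flatMeasure hM
      (hG.mono fun x hx => ⟨frontier_subset_closure hx.2, hx.1⟩)),
      ← integral_indicator h.isOpen_base.measurableSet]
    congr 1
    ext y
    by_cases hy : y ∈ h.base
    · have hyA : x₀ + (y : Space d) ∈ A := ⟨hy, by simp [inner_coe_orthogonal]⟩
      rw [indicator_of_mem hy, hW, indicator_of_mem hyA]
      rfl
    · have hyA : x₀ + (y : Space d) ∉ A := fun hyA => hy hyA.1
      rw [indicator_of_notMem hy, hW, indicator_of_notMem hyA]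
  rw [hfl]
  refine main.congr fun n => ?_
  have hMB : MeasurableSet (M ∩ B) := hM.measurableSet.inter h.defining.isOpen.measurableSet
  have hdiff : ∀ x ∈ M ∩ B, HasFDerivWithinAt (flatten φ x₀ e) (fderiv ℝ (flatten φ x₀ e) x)
      (M ∩ B) x := fun x hx =>
    (((contDiffOn_flatten h.defining x₀ e).contDiffAt
      (h.defining.isOpen.mem_nhds hx.2)).differentiableAt (by simp)).hasFDerivAt.hasFDerivWithinAt
  have hinj : InjOn (flatten φ x₀ e) (M ∩ B) := h.homeo.injOn.mono inter_subset_right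
  -- Change of variables by the flattening map, under which the normal coordinate of the image point
  -- is `φ x`.
  have hch := integral_image_eq_integral_abs_det_fderiv_smul volume hMB hdiff hinj
    (fun z => W z * ((n + 1) * deriv cutoff ((n + 1) * inner ℝ e (z - x₀))))
  rw [← setIntegral_eq_integral_of_forall_compl_eq_zero (s := flatten φ x₀ e '' (M ∩ B)), hch]
  · refine setIntegral_congr_fun hMB fun x hx => ?_
    have hxA : flatten φ x₀ e x ∈ A := by
      refine ⟨mem_image_of_mem _ hx.2, ?_⟩
      rw [mem_ofPred_eq, h.inner_flatten]
      exact ((h.defining.mem_iff hx.2).1 hx.1).le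
    simp only [smul_eq_mul]
    rw [h.inner_flatten, hW, indicator_of_mem hxA, h.symm_flatten hx.2]
  · intro z hz
    by_cases hzA : z ∈ A
    · rcases lt_or_eq_of_le (show inner ℝ e (z - x₀) ≤ 0 from hzA.2) with hlt | heq
      · refine absurd ⟨h.homeo.symm z, ⟨?_, h.symm_mem hzA.1⟩, h.flatten_symm hzA.1⟩ hz
        rw [h.defining.mem_iff (h.symm_mem hzA.1), h.phi_symm hzA.1]
        exact hlt
      -- Points on the hyperplane belong to `A` but not to the image of `M ∩ B`; there the layer
      -- factor vanishes, since `0` lies outside `[-2, -1]`.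
      · rw [heq, mul_zero, deriv_cutoff_eq_zero (by norm_num)]
        simp
    · rw [hW, indicator_of_notMem hzA, zero_mul]

end IsFlatChart

end NSF

namespace NSF

open Filter Topology Metric
open scoped NNReal ENNReal

variable {d : ℕ} {M U B : Set (Space d)} {φ : Space d → ℝ} {x₀ e : Space d} {c : ℝ≥0}

/-! ### The divergence theorem -/

namespace IsSmoothBoundedDomain

theorem integrableOn_of_continuousOn_closure (hM : IsSmoothBoundedDomain M) {f : Space d → ℝ}
    (hf : ContinuousOn f (closure M)) : IntegrableOn f M :=
  (hf.integrableOn_compact hM.isCompact_closure).mono_set subset_closure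

/-- At boundary points `fderiv` depends on uncontrolled values of `F` outside `closure M`. The
derivative within the closure is the continuous extension of its values on `M`. -/
theorem exists_continuousOn_fderiv (hM : IsSmoothBoundedDomain M) {E : Type*}
    [NormedAddCommGroup E] [NormedSpace ℝ E] {F : Space d → E} (hF : ContDiffOn ℝ 1 F (closure M)) :
    ∃ F' : Space d → (Space d →L[ℝ] E), ContinuousOn F' (closure M) ∧
      ∀ x ∈ M, fderiv ℝ F x = F' x := by
  refine ⟨fderivWithin ℝ F (closure M), hF.continuousOn_fderivWithin hM.uniqueDiffOn_closure
    (by simp), fun x hx => ?_⟩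
  exact (fderivWithin_of_mem_nhds (mem_of_superset (hM.isOpen.mem_nhds hx) subset_closure)).symm

theorem exists_continuousOn_div (hM : IsSmoothBoundedDomain M) {F : Space d → Space d}
    (hF : ContDiffOn ℝ 1 F (closure M)) :
    ∃ D : Space d → ℝ, ContinuousOn D (closure M) ∧ ∀ x ∈ M, div F x = D x := by
  obtain ⟨F', hF', h⟩ := hM.exists_continuousOn_fderiv hF
  refine ⟨fun x => ∑ i, F' x (EuclideanSpace.single i 1) i, ?_, fun x hx => by rw [div, h x hx]⟩
  refine continuousOn_finsetSum _ fun i _ => ?_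
  exact (EuclideanSpace.proj (𝕜 := ℝ) i).continuous.comp_continuousOn
    (hF'.clm_apply continuousOn_const)

theorem continuousOn_normalComponent (hM : IsSmoothBoundedDomain M) {F : Space d → Space d}
    (hF : ContinuousOn F (closure M)) : ContinuousOn (normalComponent M F) (frontier M) :=
  (hF.mono frontier_subset_closure).inner hM.continuousOn_outwardNormal

end IsSmoothBoundedDomain

theorem hasFDerivAt_mul_cutoff (h : IsDefiningFunction M B φ) {ψ : Space d → ℝ}
    (hψ : ContDiff ℝ 1 ψ) {x : Space d} (hx : x ∈ B) (a : ℝ) :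
    HasFDerivAt (fun y => ψ y * cutoff (a * φ y))
      (ψ x • (deriv cutoff (a * φ x) • (a • fderiv ℝ φ x)) + cutoff (a * φ x) • fderiv ℝ ψ x) x := by
  have h1 := (hψ.differentiable (by simp) x).hasFDerivAt
  have h2 : HasDerivAt cutoff (deriv cutoff (a * φ x)) (a * φ x) :=
    (contDiff_cutoff.differentiable (by simp) _).hasDerivAt
  have h3 : HasFDerivAt (fun y => cutoff (a * φ y))
      (deriv cutoff (a * φ x) • (a • fderiv ℝ φ x)) x :=
    HasDerivAt.comp_hasFDerivAt (h₂ := cutoff) x h2 ((h.hasFDerivAt hx).const_mul a)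
  exact h1.mul h3

/-- `cutoff (a φ)` vanishes where `φ ≥ -a⁻¹`, so the support is confined to `φ ≤ -a⁻¹` and stays off
the boundary. -/
theorem tsupport_mul_cutoff_subset (h : IsDefiningFunction M B φ) {ψ : Space d → ℝ}
    (hs : tsupport ψ ⊆ B) {a : ℝ} (ha : 0 < a) :
    tsupport (fun y => ψ y * cutoff (a * φ y)) ⊆ M ∩ B := by
  have hcl : IsClosed (tsupport ψ ∩ φ ⁻¹' Iic (-a⁻¹)) :=
    (h.continuousOn.mono hs).preimage_isClosed_of_isClosed (isClosed_tsupport _) isClosed_Iic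
  have hsub : tsupport (fun y => ψ y * cutoff (a * φ y)) ⊆ tsupport ψ ∩ φ ⁻¹' Iic (-a⁻¹) := by
    refine closure_minimal (fun y hy => ?_) hcl
    refine ⟨subset_tsupport _ (left_ne_zero_of_mul hy), ?_⟩
    by_contra hlt
    refine right_ne_zero_of_mul hy (cutoff_eq_zero ?_)
    rw [mem_preimage, mem_Iic, not_le] at hlt
    have := mul_lt_mul_of_pos_left hlt ha
    rw [mul_neg, mul_inv_cancel₀ ha.ne'] at this
    exact this.le
  intro y hy
  obtain ⟨h1, h2⟩ := hsub hy
  refine ⟨(h.mem_iff (hs h1)).2 (lt_of_le_of_lt h2 ?_), hs h1⟩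
  simpa using ha

theorem contDiff_mul_cutoff (h : IsDefiningFunction M B φ) {ψ : Space d → ℝ}
    (hψ : ContDiff ℝ 1 ψ) (hs : tsupport ψ ⊆ B) (a : ℝ) :
    ContDiff ℝ 1 (fun y => ψ y * cutoff (a * φ y)) := by
  refine contDiff_iff_contDiffAt.2 fun x => ?_
  by_cases hx : x ∈ tsupport ψ
  · have hφ : ContDiffAt ℝ 1 φ x :=
      (h.smooth.contDiffAt (h.isOpen.mem_nhds (hs hx))).of_le (by simp)
    exact hψ.contDiffAt.mul
      ((contDiff_cutoff.of_le (by simp)).contDiffAt.comp x (contDiffAt_const.mul hφ))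
  · have : (fun y => ψ y * cutoff (a * φ y)) =ᶠ[𝓝 x] fun _ => 0 := by
      filter_upwards [(isClosed_tsupport ψ).isOpen_compl.mem_nhds hx] with y hy
      rw [image_eq_zero_of_notMem_tsupport hy, zero_mul]
    exact contDiffAt_const.congr_of_eventuallyEq this

/-- The divergence theorem in a chart, with the boundary integral in flat coordinates. -/
theorem IsFlatChart.integral_div_eq (h : IsFlatChart M B φ x₀ e c)
    (hM : IsSmoothBoundedDomain M) {F : Space d → Space d} (hF : ContDiffOn ℝ 1 F (closure M))
    {ψ : Space d → ℝ} (hψ : ContDiff ℝ 1 ψ) (hc : HasCompactSupport ψ) (hs : tsupport ψ ⊆ B) :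
    ∫ x in M, (ψ x * div F x + fderiv ℝ ψ x (F x))
      = ∫ x, ψ x * fderiv ℝ φ x (F x) / |(fderiv ℝ (flatten φ x₀ e) x).det| ∂h.flatMeasure := by
  set G := fun x => ψ x * fderiv ℝ φ x (F x) / |(fderiv ℝ (flatten φ x₀ e) x).det| with hG
  have hBo := h.defining.isOpen
  have hMB : MeasurableSet (M ∩ B) := hM.isOpen.measurableSet.inter hBo.measurableSet
  have hGc : ContinuousOn G (closure M ∩ B) := by
    have hFc : ContinuousOn F (closure M ∩ B) := hF.continuousOn.mono inter_subset_left
    have hdet : ContinuousOn (fun x => (fderiv ℝ (flatten φ x₀ e) x).det) B :=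
      ContinuousLinearMap.continuous_det.comp_continuousOn
        ((contDiffOn_flatten h.defining x₀ e).continuousOn_fderiv_of_isOpen hBo (by simp))
    refine (hψ.continuous.continuousOn.mul
      ((h.defining.continuousOn_fderiv.mono inter_subset_right).clm_apply hFc)).div
      (hdet.mono inter_subset_right).abs fun x hx => ?_
    exact abs_ne_zero.2 (h.det_ne_zero x hx.2)
  have hlim1 := h.tendsto_integral_layer hM.isOpen hGc hc hs fun x hx => by
    rw [hG]; simp [image_eq_zero_of_notMem_tsupport hx]
  obtain ⟨D, hD, hDdiv⟩ := hM.exists_continuousOn_div hF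
  have hψ' : Continuous (fderiv ℝ ψ) := hψ.continuous_fderiv (by simp)
  set Q := fun x => ψ x * D x + fderiv ℝ ψ x (F x) with hQ
  have hQc : ContinuousOn Q (closure M) :=
    (hψ.continuous.continuousOn.mul hD).add (hψ'.continuousOn.clm_apply hF.continuousOn)
  have hQi : IntegrableOn Q M := hM.integrableOn_of_continuousOn_closure hQc
  have hQi' : IntegrableOn Q (M ∩ B) := hQi.mono_set inter_subset_left
  -- At each point of `M ∩ B` one has `φ < 0`, so the cutoff is eventually `1`.
  have hlim2 : Tendsto (fun n : ℕ => ∫ x in M ∩ B, cutoff ((n + 1) * φ x) * Q x) atTop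
      (𝓝 (∫ x in M ∩ B, Q x)) := by
    have hcφ : ∀ n : ℕ, ContinuousOn (fun x => cutoff ((n + 1) * φ x)) (M ∩ B) := fun n =>
      contDiff_cutoff.continuous.comp_continuousOn
        (continuousOn_const.mul (h.defining.continuousOn.mono inter_subset_right))
    refine tendsto_integral_of_dominated_convergence (fun x => ‖Q x‖) (fun n => ?_) hQi'.norm
      (fun n => ?_) ?_
    · exact ((hcφ n).aestronglyMeasurable hMB).mul hQi'.aestronglyMeasurable
    · refine Eventually.of_forall fun x => ?_
      rw [norm_mul]
      exact mul_le_of_le_one_left (norm_nonneg _) (abs_cutoff_le _)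
    · refine (ae_restrict_mem hMB).mono fun x hx => ?_
      have hφx : φ x < 0 := (h.defining.mem_iff hx.2).1 hx.1
      have hev : ∀ᶠ n : ℕ in atTop, ((n : ℝ) + 1) * φ x ≤ -2 := by
        have : Tendsto (fun n : ℕ => ((n : ℝ) + 1) * φ x) atTop atBot :=
          (tendsto_atTop_add_const_right _ _ tendsto_natCast_atTop_atTop).atTop_mul_const_of_neg hφx
        exact this.eventually_le_atBot (-2)
      refine tendsto_const_nhds.congr' (hev.mono fun n hn => ?_)
      simp only [cutoff_eq_one hn, one_mul]
  -- The cut-off function `g` has compact support in `M`, so `∫ (g div F + dg(F)) = 0`. By the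
  -- product rule this integrand is `cutoff * Q` plus the term in which the cutoff is
  -- differentiated; the determinant in the latter cancels the denominator of `G`.
  have hstep : ∀ n : ℕ, ∫ x in M ∩ B, |(fderiv ℝ (flatten φ x₀ e) x).det| *
        (G x * ((n + 1) * deriv cutoff ((n + 1) * φ x)))
      = -∫ x in M ∩ B, cutoff ((n + 1) * φ x) * Q x := by
    intro n
    have hn : (0 : ℝ) < n + 1 := by positivity
    set g := fun y => ψ y * cutoff ((n + 1) * φ y) with hg
    have hgd : ContDiff ℝ 1 g := contDiff_mul_cutoff h.defining hψ hs _
    have hgs : tsupport g ⊆ M ∩ B := tsupport_mul_cutoff_subset h.defining hs hn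
    have hgcs : HasCompactSupport g := hc.mul_right
    have hibp := integral_fderiv_apply_eq_neg_integral_mul_div hM.isOpen
      (hF.mono subset_closure) hgd hgcs (hgs.trans inter_subset_left)
    have hz1 : ∫ x in M ∩ B, fderiv ℝ g x (F x) = ∫ x, fderiv ℝ g x (F x) := by
      refine setIntegral_eq_integral_of_forall_compl_eq_zero fun x hx => ?_
      have : fderiv ℝ g x = 0 := by
        refine image_eq_zero_of_notMem_tsupport fun hx' => hx (hgs ?_)
        exact tsupport_fderiv_subset ℝ hx'
      rw [this]; rfl
    have hz2 : ∫ x in M ∩ B, g x * div F x = ∫ x, g x * div F x := by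
      refine setIntegral_eq_integral_of_forall_compl_eq_zero fun x hx => ?_
      rw [image_eq_zero_of_notMem_tsupport fun hx' => hx (hgs hx'), zero_mul]
    have i1 : IntegrableOn (fun x => fderiv ℝ g x (F x)) (M ∩ B) :=
      (hM.integrableOn_of_continuousOn_closure ((hgd.continuous_fderiv
        (by simp)).continuousOn.clm_apply hF.continuousOn)).mono_set inter_subset_left
    have i2 : IntegrableOn (fun x => g x * div F x) (M ∩ B) :=
      ((hM.integrableOn_of_continuousOn_closure (hgd.continuous.continuousOn.mul hD)).congr_fun
        (fun x hx => by simp only [Pi.mul_apply, hDdiv x hx])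
        hM.isOpen.measurableSet).mono_set inter_subset_left
    have i3 : IntegrableOn (fun x => cutoff ((n + 1) * φ x) * Q x) (M ∩ B) := by
      refine hQi'.norm.mono' ((ContinuousOn.aestronglyMeasurable ?_ hMB).mul
        hQi'.aestronglyMeasurable) (Eventually.of_forall fun x => ?_)
      · exact contDiff_cutoff.continuous.comp_continuousOn
          (continuousOn_const.mul (h.defining.continuousOn.mono inter_subset_right))
      · rw [norm_mul]
        exact mul_le_of_le_one_left (norm_nonneg _) (abs_cutoff_le _)
    have e0 : ∀ x ∈ M ∩ B, |(fderiv ℝ (flatten φ x₀ e) x).det| *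
        (G x * ((n + 1) * deriv cutoff ((n + 1) * φ x)))
        = (fderiv ℝ g x (F x) + g x * div F x) - cutoff ((n + 1) * φ x) * Q x := by
      intro x hx
      rw [(hasFDerivAt_mul_cutoff h.defining hψ hx.2 _).fderiv, hG, hg, hQ, hDdiv x hx.1]
      simp only [add_apply, smul_apply, smul_eq_mul]
      field_simp [abs_ne_zero.2 (h.det_ne_zero x hx.2)]
      ring
    have e1 := integral_add i1 i2
    have e2 := integral_sub (i1.add i2) i3
    simp only [Pi.add_apply] at e2
    rw [setIntegral_congr_fun hMB e0, e2, e1, hz1, hz2, hibp]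
    ring
  simp only [hstep] at hlim1
  have := tendsto_nhds_unique hlim1 hlim2.neg
  have hfin : ∫ x in M, (ψ x * div F x + fderiv ℝ ψ x (F x)) = ∫ x in M ∩ B, Q x := by
    rw [setIntegral_congr_fun hM.isOpen.measurableSet (g := Q)
      (fun x hx => by simp only [hQ, hDdiv x hx])]
    rw [← setIntegral_eq_of_subset_of_forall_sdiff_eq_zero hM.isOpen.measurableSet
      (inter_subset_left (t := B)) (fun x hx => ?_)]
    have hxB : x ∉ tsupport ψ := fun hx' => hx.2 ⟨hx.1, hs hx'⟩
    have : fderiv ℝ ψ x = 0 :=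
      image_eq_zero_of_notMem_tsupport fun hx' => hxB (tsupport_fderiv_subset ℝ hx')
    simp [hQ, image_eq_zero_of_notMem_tsupport hxB, this]
  rw [hfin]
  linarith

end NSF

/-! ### From charts to the global divergence theorem -/

namespace NSF

open Filter Topology Metric
open scoped NNReal ENNReal

variable {d : ℕ} {M U B : Set (Space d)} {φ : Space d → ℝ} {x₀ e : Space d} {c : ℝ≥0}

/-- The factor by which the surface measure is distorted in a flat chart. -/
noncomputable def distortion (d : ℕ) (c : ℝ≥0) : ℝ≥0 := (1 - c)⁻¹ ^ (d - 1)

theorem one_le_distortion (d : ℕ) (hc : c < 1) : 1 ≤ distortion d c := by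
  refine one_le_pow₀ ?_
  rw [one_le_inv₀ (tsub_pos_of_lt hc)]
  exact tsub_le_self

/-- The relative error is continuous in `c` and vanishes at `c = 0`, so small enough charts beat any
tolerance. -/
theorem exists_distortion_le (d : ℕ) {ε : ℝ} (hε : 0 < ε) :
    ∃ c : ℝ≥0, 0 < c ∧ c < 1 ∧ (c : ℝ) * distortion d c + (distortion d c - 1) ≤ ε := by
  have h1 : ContinuousAt (fun t : ℝ => t * (1 - t)⁻¹ ^ (d - 1) + ((1 - t)⁻¹ ^ (d - 1) - 1)) 0 := by
    have : ContinuousAt (fun t : ℝ => (1 - t)⁻¹) 0 :=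
      (continuousAt_const.sub continuousAt_id).inv₀ (by simp)
    exact (continuousAt_id.mul (this.pow _)).add ((this.pow _).sub continuousAt_const)
  have h2 : ∀ᶠ t : ℝ in 𝓝 0, t * (1 - t)⁻¹ ^ (d - 1) + ((1 - t)⁻¹ ^ (d - 1) - 1) < ε :=
    h1.eventually_lt continuousAt_const (by simpa using hε)
  have h3 : ∀ᶠ t : ℝ in 𝓝[>] 0, t < 1 :=
    nhdsWithin_le_nhds (Iio_mem_nhds one_pos)
  obtain ⟨t, ht, ht1, ht0⟩ :=
    ((h2.filter_mono nhdsWithin_le_nhds).and (h3.and self_mem_nhdsWithin)).exists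
  have ht0' : (0 : ℝ) < t := ht0
  lift t to ℝ≥0 using ht0'.le with c
  refine ⟨c, by exact_mod_cast ht0', by exact_mod_cast ht1, ?_⟩
  have hle : c ≤ 1 := by exact_mod_cast ht1.le
  have heq : (distortion d c : ℝ) = (1 - (c : ℝ))⁻¹ ^ (d - 1) := by
    simp only [distortion, NNReal.coe_pow, NNReal.coe_inv, NNReal.coe_sub hle, NNReal.coe_one]
  rw [heq]
  exact ht.le

theorem IsSmoothBoundedDomain.surfaceMeasure_univ_lt_top (hM : IsSmoothBoundedDomain M) :
    surfaceMeasure M univ < ⊤ := by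
  have hcomp : IsCompact (frontier M) :=
    hM.isCompact_closure.of_isClosed_subset isClosed_frontier frontier_subset_closure
  have : surfaceMeasure M (frontier M) < ⊤ := by
    refine hcomp.measure_lt_top_of_nhdsWithin fun x hx => ?_
    obtain ⟨B, φ, e, hxB, h⟩ := exists_isFlatChart hM hx (c := 1 / 2) (by simp)
      (by rw [← NNReal.coe_lt_coe]; norm_num)
    exact ⟨B, mem_nhdsWithin_of_mem_nhds (h.defining.isOpen.mem_nhds hxB),
      h.surfaceMeasure_lt_top hM.isOpen⟩
  rw [surfaceMeasure, Measure.restrict_apply_univ]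
  rwa [surfaceMeasure, Measure.restrict_apply_self] at this

theorem IsSmoothBoundedDomain.isFiniteMeasure_surfaceMeasure (hM : IsSmoothBoundedDomain M) :
    IsFiniteMeasure (surfaceMeasure M) := ⟨hM.surfaceMeasure_univ_lt_top⟩

theorem IsSmoothBoundedDomain.integrable_surfaceMeasure (hM : IsSmoothBoundedDomain M)
    {f : Space d → ℝ} (hf : ContinuousOn f (frontier M)) : Integrable f (surfaceMeasure M) := by
  have := hM.isFiniteMeasure_surfaceMeasure
  have hcomp : IsCompact (frontier M) :=
    hM.isCompact_closure.of_isClosed_subset isClosed_frontier frontier_subset_closure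
  obtain ⟨C, hC⟩ := hcomp.exists_bound_of_continuousOn hf
  refine Integrable.of_bound ?_ C
    (ae_restrict_of_forall_mem isClosed_frontier.measurableSet hC)
  exact hf.aestronglyMeasurable isClosed_frontier.measurableSet

/-- The divergence theorem in a flat chart holds up to a small relative error. -/
theorem IsFlatChart.abs_integral_div_sub_flux_le (h : IsFlatChart M B φ x₀ e c)
    (hM : IsSmoothBoundedDomain M) {F : Space d → Space d} (hF : ContDiffOn ℝ 1 F (closure M))
    {ψ : Space d → ℝ} (hψ : ContDiff ℝ 1 ψ) (hc : HasCompactSupport ψ) (hs : tsupport ψ ⊆ B) :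
    |(∫ x in M, (ψ x * div F x + fderiv ℝ ψ x (F x)))
        - ∫ x, ψ x * normalComponent M F x ∂(surfaceMeasure M)|
      ≤ (c * distortion d c + (distortion d c - 1))
        * ∫ x, |ψ x * normalComponent M F x| ∂(surfaceMeasure M) := by
  have hBm : MeasurableSet B := h.defining.isOpen.measurableSet
  set g := fun x => ψ x * normalComponent M F x with hg
  -- On the boundary `fderiv ℝ φ x (F x)` is `‖gradient φ x‖` times the normal component. So `κ` is
  -- the density left over in the chart formula, and it is within `c` of `1`.
  set κ := fun x => ‖gradient φ x‖ / |(fderiv ℝ (flatten φ x₀ e) x).det| with hκ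
  have hgi : Integrable g (surfaceMeasure M) := hM.integrable_surfaceMeasure
    (hψ.continuous.continuousOn.mul (hM.continuousOn_normalComponent hF.continuousOn))
  have hz : ∀ x ∉ B, g x = 0 := fun x hx => by
    simp [hg, image_eq_zero_of_notMem_tsupport fun h' => hx (hs h')]
  have e1 : ∫ x in B, g x ∂(surfaceMeasure M) = ∫ x, g x ∂(surfaceMeasure M) :=
    setIntegral_eq_integral_of_forall_compl_eq_zero hz
  have e2 : ∫ x in B, |g x| ∂(surfaceMeasure M) = ∫ x, |g x| ∂(surfaceMeasure M) :=
    setIntegral_eq_integral_of_forall_compl_eq_zero fun x hx => by rw [hz x hx, abs_zero]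
  have hκc : ContinuousOn κ B := by
    have hdet : ContinuousOn (fun x => (fderiv ℝ (flatten φ x₀ e) x).det) B :=
      ContinuousLinearMap.continuous_det.comp_continuousOn
        ((contDiffOn_flatten h.defining x₀ e).continuousOn_fderiv_of_isOpen
          h.defining.isOpen (by simp))
    exact h.defining.continuousOn_gradient.norm.div hdet.abs
      fun x hx => abs_ne_zero.2 (h.det_ne_zero x hx)
  have e3 : ∫ x, ψ x * fderiv ℝ φ x (F x) / |(fderiv ℝ (flatten φ x₀ e) x).det| ∂h.flatMeasure
      = ∫ x, g x * κ x ∂h.flatMeasure := by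
    refine integral_congr_ae ((h.flatMeasure_ae_mem hM.isOpen).mono fun x hx => ?_)
    have hg0 : ‖gradient φ x‖ ≠ 0 := norm_ne_zero_iff.2 (h.defining.gradient_ne_zero x hx.1)
    simp only [hg, hκ, normalComponent]
    rw [outwardNormal_eq hM.isOpen h.defining hx.1 hx.2, inner_smul_right,
      fderiv_eq_inner_gradient, real_inner_comm (F x)]
    field_simp
  rw [h.integral_div_eq hM hF hψ hc hs, e3, ← e1, ← e2]
  exact abs_integral_mul_sub_integral_le (one_le_distortion d h.lt_one)
    (h.flatMeasure_le hM.isOpen) (h.le_flatMeasure hM.isOpen) hgi.restrict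
    (h.aestronglyMeasurable_flatMeasure hM.isOpen (hκc.mono inter_subset_left))
    ((h.flatMeasure_ae_mem hM.isOpen).mono fun x hx => h.ratio x hx.1) c.2

/-- The divergence theorem for fields localized in the interior. -/
theorem integral_div_eq_zero_of_tsupport_subset (hM : IsSmoothBoundedDomain M)
    {F : Space d → Space d} (hF : ContDiffOn ℝ 1 F (closure M))
    {ψ : Space d → ℝ} (hψ : ContDiff ℝ 1 ψ) (hs : tsupport ψ ⊆ M) :
    ∫ x in M, (ψ x * div F x + fderiv ℝ ψ x (F x)) = 0 := by
  have hcs : HasCompactSupport ψ := hM.isCompact_closure.of_isClosed_subset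
    (isClosed_tsupport _) (hs.trans subset_closure)
  have hibp := integral_fderiv_apply_eq_neg_integral_mul_div hM.isOpen
    (hF.mono subset_closure) hψ hcs hs
  obtain ⟨D, hD, hDdiv⟩ := hM.exists_continuousOn_div hF
  have i1 : IntegrableOn (fun x => fderiv ℝ ψ x (F x)) M :=
    hM.integrableOn_of_continuousOn_closure
      ((hψ.continuous_fderiv (by simp)).continuousOn.clm_apply hF.continuousOn)
  have i2 : IntegrableOn (fun x => ψ x * div F x) M :=
    (hM.integrableOn_of_continuousOn_closure (hψ.continuous.continuousOn.mul hD)).congr_fun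
      (fun x hx => by simp only [Pi.mul_apply, hDdiv x hx]) hM.isOpen.measurableSet
  have hz1 : ∫ x in M, fderiv ℝ ψ x (F x) = ∫ x, fderiv ℝ ψ x (F x) := by
    refine setIntegral_eq_integral_of_forall_compl_eq_zero fun x hx => ?_
    have : fderiv ℝ ψ x = 0 :=
      image_eq_zero_of_notMem_tsupport fun hx' => hx (hs (tsupport_fderiv_subset ℝ hx'))
    rw [this]; rfl
  have hz2 : ∫ x in M, ψ x * div F x = ∫ x, ψ x * div F x :=
    setIntegral_eq_integral_of_forall_compl_eq_zero fun x hx => by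
      rw [image_eq_zero_of_notMem_tsupport fun hx' => hx (hs hx'), zero_mul]
  rw [integral_add i2 i1, hz1, hz2, hibp]
  ring

/-- The local errors are relative to `∫ |ψ F · n|`. For a partition of unity with nonnegative
members these integrals sum to `∫ |F · n|`, so the total error does not grow with the number of
charts, although that number depends on `ε`. -/
theorem abs_integral_div_sub_flux_le (hM : IsSmoothBoundedDomain M) {F : Space d → Space d}
    (hF : ContDiffOn ℝ 1 F (closure M)) {ε : ℝ} (hε : 0 < ε) :
    |(∫ x in M, div F x) - flux M F|
      ≤ ε * ∫ x, |normalComponent M F x| ∂(surfaceMeasure M) := by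
  obtain ⟨c, hc0, hc1, hcε⟩ := exists_distortion_le d hε
  have hloc : ∀ x : closure M, ∃ V : Set (Space d), IsOpen V ∧ (x : Space d) ∈ V ∧
      ∀ ψ : Space d → ℝ, ContDiff ℝ 1 ψ → tsupport ψ ⊆ V →
      |(∫ x in M, (ψ x * div F x + fderiv ℝ ψ x (F x)))
          - ∫ x, ψ x * normalComponent M F x ∂(surfaceMeasure M)|
        ≤ ε * ∫ x, |ψ x * normalComponent M F x| ∂(surfaceMeasure M) := by
    rintro ⟨x, hx⟩
    by_cases hxM : x ∈ M
    · refine ⟨M, hM.isOpen, hxM, fun ψ hψ hs => ?_⟩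
      have : ∫ x, ψ x * normalComponent M F x ∂(surfaceMeasure M) = 0 := by
        rw [surfaceMeasure]
        refine setIntegral_eq_zero_of_forall_eq_zero fun y hy => ?_
        rw [hM.isOpen.frontier_eq] at hy
        rw [image_eq_zero_of_notMem_tsupport fun hy' => hy.2 (hs hy'), zero_mul]
      rw [integral_div_eq_zero_of_tsupport_subset hM hF hψ hs, this, sub_zero, abs_zero]
      exact mul_nonneg hε.le (integral_nonneg fun _ => abs_nonneg _)
    · obtain ⟨B, φ, e, hxB, h⟩ := exists_isFlatChart hM
        (by rw [hM.isOpen.frontier_eq]; exact ⟨hx, hxM⟩) hc0 hc1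
      refine ⟨B, h.defining.isOpen, hxB, fun ψ hψ hs => ?_⟩
      have hcs : HasCompactSupport ψ := isCompact_of_isClosed_isBounded
        (isClosed_tsupport _) (h.isBounded.subset hs)
      refine (h.abs_integral_div_sub_flux_le hM hF hψ hcs hs).trans ?_
      exact mul_le_mul_of_nonneg_right hcε (integral_nonneg fun _ => abs_nonneg _)
  choose V hVo hVx hV using hloc
  obtain ⟨t, ht⟩ := hM.isCompact_closure.elim_finite_subcover V hVo
    fun x hx => mem_iUnion.2 ⟨⟨x, hx⟩, hVx _⟩
  obtain ⟨f, hf⟩ := SmoothPartitionOfUnity.exists_isSubordinate (modelWithCornersSelf ℝ (Space d))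
    (isClosed_closure (s := M)) (fun i : t => V i) (fun i => hVo i)
    (fun x hx => by
      obtain ⟨i, hi, hxi⟩ := mem_iUnion₂.1 (ht hx)
      exact mem_iUnion.2 ⟨⟨i, hi⟩, hxi⟩)
  have hsm : ∀ i, ContDiff ℝ 1 (f i) := fun i => (f i).contMDiff.contDiff.of_le (by simp)
  have hsum : ∀ x ∈ closure M, ∑ i, f i x = 1 := fun x hx => by
    rw [← finsum_eq_sum_of_fintype]; exact f.sum_eq_one hx
  have hN : ContinuousOn (normalComponent M F) (frontier M) :=
    hM.continuousOn_normalComponent hF.continuousOn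
  have e1 : ∫ x in M, div F x
      = ∑ i, ∫ x in M, (f i x * div F x + fderiv ℝ (f i) x (F x)) := by
    rw [← integral_finsetSum]
    · refine setIntegral_congr_fun hM.isOpen.measurableSet fun x hx => ?_
      rw [Finset.sum_add_distrib, ← Finset.sum_mul, hsum x (subset_closure hx), one_mul]
      -- The partition sums to `1` on all of the open set `M`, so its derivatives cancel there.
      have hd : ∑ i, fderiv ℝ (f i) x = 0 := by
        have h1 : HasFDerivAt (fun y => ∑ i, f i y) (∑ i, fderiv ℝ (f i) x) x :=
          HasFDerivAt.fun_sum fun i _ => ((hsm i).differentiable (by simp) x).hasFDerivAt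
        have h2 : (fun y => ∑ i, f i y) =ᶠ[𝓝 x] fun _ => 1 := by
          filter_upwards [hM.isOpen.mem_nhds hx] with y hy using hsum y (subset_closure hy)
        rw [← h1.fderiv, h2.fderiv_eq]
        simp
      have := congrArg (fun L : Space d →L[ℝ] ℝ => L (F x)) hd
      simp only [sum_apply, zero_apply] at this
      rw [this, add_zero]
    · intro i _
      obtain ⟨D, hD, hDdiv⟩ := hM.exists_continuousOn_div hF
      refine (hM.integrableOn_of_continuousOn_closure (f := fun x => f i x * D x
        + fderiv ℝ (f i) x (F x)) ?_).congr_fun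
        (fun x hx => by simp only [hDdiv x hx]) hM.isOpen.measurableSet
      exact ((hsm i).continuous.continuousOn.mul hD).add
        (((hsm i).continuous_fderiv (by simp)).continuousOn.clm_apply hF.continuousOn)
  have hint : ∀ i, Integrable (fun x => f i x * normalComponent M F x) (surfaceMeasure M) :=
    fun i => hM.integrable_surfaceMeasure ((hsm i).continuous.continuousOn.mul hN)
  have e2 : flux M F = ∑ i, ∫ x, f i x * normalComponent M F x ∂(surfaceMeasure M) := by
    rw [flux, ← integral_finsetSum _ fun i _ => hint i]
    refine setIntegral_congr_fun isClosed_frontier.measurableSet fun x hx => ?_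
    rw [← Finset.sum_mul, hsum x (frontier_subset_closure hx), one_mul]
  have e3 : ∫ x, |normalComponent M F x| ∂(surfaceMeasure M)
      = ∑ i, ∫ x, |f i x * normalComponent M F x| ∂(surfaceMeasure M) := by
    rw [← integral_finsetSum _ fun i _ => (hint i).abs]
    refine setIntegral_congr_fun isClosed_frontier.measurableSet fun x hx => ?_
    simp only [abs_mul, abs_of_nonneg (f.nonneg _ _)]
    rw [← Finset.sum_mul, hsum x (frontier_subset_closure hx), one_mul]
  rw [e1, e2, e3, ← Finset.sum_sub_distrib, Finset.mul_sum]
  exact (Finset.abs_sum_le_sum_abs _ _).trans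
    (Finset.sum_le_sum fun i _ => hV i (f i) (hsm i) (hf i))

/-- **The divergence theorem** on a bounded domain with smooth boundary. -/
theorem integral_div_eq_flux (hM : IsSmoothBoundedDomain M) {F : Space d → Space d}
    (hF : ContDiffOn ℝ 1 F (closure M)) : ∫ x in M, div F x = flux M F := by
  set A := ∫ x, |normalComponent M F x| ∂(surfaceMeasure M) with hA
  have hA0 : 0 ≤ A := integral_nonneg fun _ => abs_nonneg _
  rw [← sub_eq_zero, ← abs_nonpos_iff]
  refine le_of_forall_pos_le_add fun ε hε => ?_
  -- Dividing by `A + 1` makes the error at most `ε` and stays valid when `A = 0`.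
  have h := abs_integral_div_sub_flux_le hM hF (ε := ε / (A + 1)) (by positivity)
  rw [zero_add]
  refine h.trans ?_
  rw [← hA, div_mul_eq_mul_div, div_le_iff₀ (by positivity)]
  nlinarith

end NSF

namespace NSF

open Filter Topology Metric

variable {d : ℕ} {M : Set (Space d)} {T : ℝ}

/-! ### Calculus of smooth fields on space-time -/

/-- The closed space-time cylinder. -/
abbrev cylinder (T : ℝ) (M : Set (Space d)) : Set (ℝ × Space d) := Icc 0 T ×ˢ closure M

theorem uniqueDiffOn_cylinder (hM : IsSmoothBoundedDomain M) (hT : 0 < T) :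
    UniqueDiffOn ℝ (cylinder T M) :=
  (uniqueDiffOn_Icc hT).prod hM.uniqueDiffOn_closure

theorem IsSmoothBoundedDomain.isCompact_cylinder (hM : IsSmoothBoundedDomain M) (T : ℝ) :
    IsCompact (cylinder T M) := isCompact_Icc.prod hM.isCompact_closure

namespace SmoothField

variable {F : Type*} [NormedAddCommGroup F] [NormedSpace ℝ F]

theorem continuousOn {f : ℝ → Space d → F} (hf : SmoothField T M f) :
    ContinuousOn (fun p : ℝ × Space d => f p.1 p.2) (cylinder T M) := ContDiffOn.continuousOn hf

theorem const (a : F) : SmoothField T M (fun _ _ => a) := contDiffOn_const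

theorem of_contDiff {f : ℝ → Space d → F}
    (hf : ContDiff ℝ ∞ (fun p : ℝ × Space d => f p.1 p.2)) : SmoothField T M f := hf.contDiffOn

theorem add {f g : ℝ → Space d → F} (hf : SmoothField T M f) (hg : SmoothField T M g) :
    SmoothField T M (fun t x => f t x + g t x) := ContDiffOn.add hf hg

theorem sub {f g : ℝ → Space d → F} (hf : SmoothField T M f) (hg : SmoothField T M g) :
    SmoothField T M (fun t x => f t x - g t x) := ContDiffOn.sub hf hg

theorem neg {f : ℝ → Space d → F} (hf : SmoothField T M f) :
    SmoothField T M (fun t x => -f t x) := ContDiffOn.neg hf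

theorem smul {f : ℝ → Space d → ℝ} {g : ℝ → Space d → F} (hf : SmoothField T M f)
    (hg : SmoothField T M g) : SmoothField T M (fun t x => f t x • g t x) := ContDiffOn.smul hf hg

theorem mul {f g : ℝ → Space d → ℝ} (hf : SmoothField T M f) (hg : SmoothField T M g) :
    SmoothField T M (fun t x => f t x * g t x) := ContDiffOn.mul hf hg

theorem div {f g : ℝ → Space d → ℝ} (hf : SmoothField T M f) (hg : SmoothField T M g)
    (h0 : ∀ t ∈ Icc 0 T, ∀ x ∈ closure M, g t x ≠ 0) :
    SmoothField T M (fun t x => f t x / g t x) := ContDiffOn.div hf hg fun _ hp => h0 _ hp.1 _ hp.2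

theorem coord {f : ℝ → Space d → Space d} (hf : SmoothField T M f) (i : Fin d) :
    SmoothField T M (fun t x => f t x i) :=
  (EuclideanSpace.proj (𝕜 := ℝ) i).contDiff.comp_contDiffOn hf

theorem contDiffOn_slice {f : ℝ → Space d → F} (hf : SmoothField T M f) {t : ℝ}
    (ht : t ∈ Icc 0 T) : ContDiffOn ℝ ∞ (f t) (closure M) :=
  ContDiffOn.comp (g := fun p : ℝ × Space d => f p.1 p.2) hf
    (contDiff_const.prodMk contDiff_id).contDiffOn fun _ hx => ⟨ht, hx⟩

theorem hasFDerivWithinAt {f : ℝ → Space d → F} (hf : SmoothField T M f) {p : ℝ × Space d}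
    (hp : p ∈ cylinder T M) : HasFDerivWithinAt (fun p : ℝ × Space d => f p.1 p.2)
      (fderivWithin ℝ (fun p : ℝ × Space d => f p.1 p.2) (cylinder T M) p) (cylinder T M) p :=
  (ContDiffOn.differentiableOn hf (by simp) p hp).hasFDerivWithinAt

theorem hasDerivWithinAt_dt {f : ℝ → Space d → F} (hf : SmoothField T M f) (hT : 0 < T) {t : ℝ}
    (ht : t ∈ Icc 0 T) {x : Space d} (hx : x ∈ closure M) :
    HasDerivWithinAt (fun τ => f τ x) (dt T f t x) (Icc 0 T) t ∧
    dt T f t x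
      = fderivWithin ℝ (fun p : ℝ × Space d => f p.1 p.2) (cylinder T M) (t, x) (1, 0) := by
  have h1 : HasDerivWithinAt (fun τ : ℝ => (τ, x)) ((1 : ℝ), (0 : Space d)) (Icc 0 T) t :=
    (hasDerivWithinAt_id t _).prodMk (hasDerivWithinAt_const t _ x)
  have h2 := (hf.hasFDerivWithinAt (p := (t, x)) ⟨ht, hx⟩).comp_hasDerivWithinAt t h1
    (show MapsTo (fun τ : ℝ => (τ, x)) (Icc 0 T) (cylinder T M) from fun τ hτ => ⟨hτ, hx⟩)
  have h3 := h2.derivWithin (uniqueDiffOn_Icc hT t ht)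
  have h4 : dt T f t x
      = fderivWithin ℝ (fun p : ℝ × Space d => f p.1 p.2) (cylinder T M) (t, x) (1, 0) := h3
  refine ⟨?_, h4⟩
  rw [h4]
  exact h2

theorem hasFDerivAt_slice {f : ℝ → Space d → F} (hf : SmoothField T M f) (hM : IsOpen M) {t : ℝ}
    (ht : t ∈ Icc 0 T) {x : Space d} (hx : x ∈ M) :
    HasFDerivAt (f t) ((fderivWithin ℝ (fun p : ℝ × Space d => f p.1 p.2) (cylinder T M) (t, x)).comp
      (ContinuousLinearMap.inr ℝ ℝ (Space d))) x := by
  have h1 : HasFDerivWithinAt (fun y : Space d => (t, y)) (ContinuousLinearMap.inr ℝ ℝ (Space d))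
      (closure M) x := (hasFDerivAt_prodMk_right t x).hasFDerivWithinAt
  have h2 := (hf.hasFDerivWithinAt (p := (t, x)) ⟨ht, subset_closure hx⟩).comp x h1
    (show MapsTo (fun y : Space d => (t, y)) (closure M) (cylinder T M) from fun y hy => ⟨ht, hy⟩)
  exact h2.hasFDerivAt (mem_of_superset (hM.mem_nhds hx) subset_closure)

theorem fderiv_slice_apply {f : ℝ → Space d → F} (hf : SmoothField T M f) (hM : IsOpen M) {t : ℝ}
    (ht : t ∈ Icc 0 T) {x : Space d} (hx : x ∈ M) (w : Space d) :
    fderiv ℝ (f t) x w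
      = fderivWithin ℝ (fun p : ℝ × Space d => f p.1 p.2) (cylinder T M) (t, x) (0, w) := by
  rw [(hf.hasFDerivAt_slice hM ht hx).fderiv]
  simp

theorem differentiableAt_slice {f : ℝ → Space d → F} (hf : SmoothField T M f) (hM : IsOpen M)
    {t : ℝ} (ht : t ∈ Icc 0 T) {x : Space d} (hx : x ∈ M) : DifferentiableAt ℝ (f t) x :=
  (hf.hasFDerivAt_slice hM ht hx).differentiableAt

theorem contDiffOn_fderivWithin {f : ℝ → Space d → F} (hf : SmoothField T M f)
    (hM : IsSmoothBoundedDomain M) (hT : 0 < T) :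
    ContDiffOn ℝ ∞ (fderivWithin ℝ (fun p : ℝ × Space d => f p.1 p.2) (cylinder T M))
      (cylinder T M) :=
  ContDiffOn.fderivWithin hf (uniqueDiffOn_cylinder hM hT) (by simp)

/-- In the interior of the cylinder, one-sided and two-sided derivatives agree. -/
theorem fderivWithin_eq_fderiv (f : ℝ → Space d → F) (hM : IsOpen M)
    {p : ℝ × Space d} (hp : p ∈ Ioo 0 T ×ˢ M) :
    fderivWithin ℝ (fun p : ℝ × Space d => f p.1 p.2) (cylinder T M) p
      = fderiv ℝ (fun p : ℝ × Space d => f p.1 p.2) p :=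
  fderivWithin_of_mem_nhds (mem_of_superset ((isOpen_Ioo.prod hM).mem_nhds hp)
    (prod_mono Ioo_subset_Icc_self subset_closure))

end SmoothField

/-- The field agrees on `[0,T] × M` with a field that is smooth up to the boundary. -/
def SmoothInside {F : Type*} [NormedAddCommGroup F] [NormedSpace ℝ F]
    (T : ℝ) (M : Set (Space d)) (f : ℝ → Space d → F) : Prop :=
  ∃ g, SmoothField T M g ∧ ∀ t ∈ Icc 0 T, ∀ x ∈ M, f t x = g t x

theorem SmoothField.smoothInside {F : Type*} [NormedAddCommGroup F] [NormedSpace ℝ F]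
    {f : ℝ → Space d → F} (hf : SmoothField T M f) : SmoothInside T M f := ⟨f, hf, fun _ _ _ _ => rfl⟩

theorem SmoothField.smoothInside_dt {F : Type*} [NormedAddCommGroup F] [NormedSpace ℝ F]
    {f : ℝ → Space d → F} (hf : SmoothField T M f) (hM : IsSmoothBoundedDomain M) (hT : 0 < T) :
    SmoothInside T M (dt T f) :=
  ⟨fun t x => fderivWithin ℝ (fun p : ℝ × Space d => f p.1 p.2) (cylinder T M) (t, x) (1, 0),
    (hf.contDiffOn_fderivWithin hM hT).clm_apply contDiffOn_const,
    fun _ ht _ hx => (hf.hasDerivWithinAt_dt hT ht (subset_closure hx)).2⟩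

/-- Two-sided spatial derivatives are controlled only on `M`. The derivative within the closed
cylinder represents them by a field smooth up to the boundary, which supplies integrability and
uniform bounds. -/
theorem SmoothField.smoothInside_fderiv {F : Type*} [NormedAddCommGroup F] [NormedSpace ℝ F]
    {f : ℝ → Space d → F} (hf : SmoothField T M f) (hM : IsSmoothBoundedDomain M) (hT : 0 < T)
    {X : ℝ → Space d → Space d} (hX : SmoothField T M X) :
    SmoothInside T M (fun t x => fderiv ℝ (f t) x (X t x)) :=
  ⟨fun t x => fderivWithin ℝ (fun p : ℝ × Space d => f p.1 p.2) (cylinder T M) (t, x) (0, X t x),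
    (hf.contDiffOn_fderivWithin hM hT).clm_apply (contDiffOn_const.prodMk hX),
    fun _ ht _ hx => hf.fderiv_slice_apply hM.isOpen ht hx _⟩

namespace SmoothInside

variable {F : Type*} [NormedAddCommGroup F] [NormedSpace ℝ F]

theorem add {f g : ℝ → Space d → F} (hf : SmoothInside T M f) (hg : SmoothInside T M g) :
    SmoothInside T M (fun t x => f t x + g t x) := by
  obtain ⟨f', hf', ef⟩ := hf
  obtain ⟨g', hg', eg⟩ := hg
  exact ⟨_, hf'.add hg', fun t ht x hx => by simp only [ef t ht x hx, eg t ht x hx]⟩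

theorem sub {f g : ℝ → Space d → F} (hf : SmoothInside T M f) (hg : SmoothInside T M g) :
    SmoothInside T M (fun t x => f t x - g t x) := by
  obtain ⟨f', hf', ef⟩ := hf
  obtain ⟨g', hg', eg⟩ := hg
  exact ⟨_, hf'.sub hg', fun t ht x hx => by simp only [ef t ht x hx, eg t ht x hx]⟩

theorem mul {f g : ℝ → Space d → ℝ} (hf : SmoothInside T M f) (hg : SmoothInside T M g) :
    SmoothInside T M (fun t x => f t x * g t x) := by
  obtain ⟨f', hf', ef⟩ := hf
  obtain ⟨g', hg', eg⟩ := hg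
  exact ⟨_, hf'.mul hg', fun t ht x hx => by simp only [ef t ht x hx, eg t ht x hx]⟩

theorem sum {ι : Type*} {s : Finset ι} {f : ι → ℝ → Space d → F}
    (hf : ∀ i ∈ s, SmoothInside T M (f i)) : SmoothInside T M (fun t x => ∑ i ∈ s, f i t x) := by
  classical
  induction s using Finset.induction_on with
  | empty => simpa using (SmoothField.const (T := T) (M := M) (0 : F)).smoothInside
  | insert i s hi ih =>
    simp only [Finset.sum_insert hi]
    exact (hf i (Finset.mem_insert_self i s)).add
      (ih fun k hk => hf k (Finset.mem_insert_of_mem hk))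

theorem coord {f : ℝ → Space d → Space d} (hf : SmoothInside T M f) (i : Fin d) :
    SmoothInside T M (fun t x => f t x i) := by
  obtain ⟨f', hf', ef⟩ := hf
  exact ⟨_, hf'.coord i, fun t ht x hx => by simp only [ef t ht x hx]⟩

theorem integrableOn {f : ℝ → Space d → ℝ} (hf : SmoothInside T M f)
    (hM : IsSmoothBoundedDomain M) {t : ℝ} (ht : t ∈ Icc 0 T) : IntegrableOn (f t) M := by
  obtain ⟨f', hf', ef⟩ := hf
  exact (hM.integrableOn_of_continuousOn_closure (hf'.contDiffOn_slice ht).continuousOn).congr_fun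
    (fun x hx => (ef t ht x hx).symm) hM.isOpen.measurableSet

theorem exists_bound {f : ℝ → Space d → F} (hf : SmoothInside T M f)
    (hM : IsSmoothBoundedDomain M) : ∃ C, ∀ t ∈ Icc 0 T, ∀ x ∈ M, ‖f t x‖ ≤ C := by
  obtain ⟨f', hf', ef⟩ := hf
  obtain ⟨C, hC⟩ := (hM.isCompact_cylinder T).exists_bound_of_continuousOn hf'.continuousOn
  exact ⟨C, fun t ht x hx => by rw [ef t ht x hx]; exact hC (t, x) ⟨ht, subset_closure hx⟩⟩

end SmoothInside

namespace SmoothField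

theorem smoothInside_div {X : ℝ → Space d → Space d} (hX : SmoothField T M X)
    (hM : IsSmoothBoundedDomain M) (hT : 0 < T) :
    SmoothInside T M (fun t x => NSF.div (X t) x) :=
  SmoothInside.sum fun i _ =>
    (hX.smoothInside_fderiv hM hT (SmoothField.const (EuclideanSpace.single i (1 : ℝ)))).coord i

theorem smoothInside_functionRate {f : ℝ → Space d → ℝ} {u : ℝ → Space d → Space d}
    (hf : SmoothField T M f) (hu : SmoothField T M u) (hM : IsSmoothBoundedDomain M)
    (hT : 0 < T) : SmoothInside T M (functionRate T u f) :=
  (hf.smoothInside_dt hM hT).add (hf.smoothInside_fderiv hM hT hu)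

theorem smoothInside_contractGrad {A : ℝ → Space d → Matrix (Fin d) (Fin d) ℝ}
    {u : ℝ → Space d → Space d} (hA : ∀ i k, SmoothField T M (fun t x => A t x i k))
    (hu : SmoothField T M u) (hM : IsSmoothBoundedDomain M) (hT : 0 < T) :
    SmoothInside T M (fun t x => contractGrad (A t x) (u t) x) :=
  SmoothInside.sum fun i _ => SmoothInside.sum fun k _ => (hA i k).smoothInside.mul
    ((hu.smoothInside_fderiv hM hT (SmoothField.const (EuclideanSpace.single k (1 : ℝ)))).coord i)

end SmoothField

end NSF

namespace NSF

open Filter Topology Metric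

variable {d : ℕ} {M : Set (Space d)} {T : ℝ}

/-! ### Differentiation under the integral sign and the fundamental lemma -/

/-- Differentiation under the integral sign over a subset of a compact set. -/
theorem hasDerivAt_setIntegral_of_continuousOn {X : Type*} [TopologicalSpace X]
    [TopologicalSpace.PseudoMetrizableSpace X] [MeasurableSpace X] [BorelSpace X] {μ : Measure X}
    [IsFiniteMeasureOnCompacts μ] {K S : Set X} (hK : IsCompact K) (hS : MeasurableSet S)
    (hSK : S ⊆ K) {g g' : ℝ → X → ℝ} {r : ℝ} (hr : 0 < r)
    (hg : ∀ η ∈ closedBall (0 : ℝ) r, ContinuousOn (g η) K)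
    (hg' : ContinuousOn (fun p : ℝ × X => g' p.1 p.2) (closedBall 0 r ×ˢ K))
    (hd : ∀ η ∈ closedBall (0 : ℝ) r, ∀ x ∈ K, HasDerivAt (fun η => g η x) (g' η x) η) :
    HasDerivAt (fun η => ∫ x in S, g η x ∂μ) (∫ x in S, g' 0 x ∂μ) 0 := by
  have hμ : μ S < ⊤ := (measure_mono hSK).trans_lt hK.measure_lt_top
  obtain ⟨C, hC⟩ := ((isCompact_closedBall (0 : ℝ) r).prod hK).exists_bound_of_continuousOn hg'
  have h0 : (0 : ℝ) ∈ closedBall (0 : ℝ) r := mem_closedBall_self hr.le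
  have hslice : ContinuousOn (g' 0) K :=
    hg'.comp (f := fun x => ((0 : ℝ), x)) (by fun_prop) fun x hx => ⟨h0, hx⟩
  refine (hasDerivAt_integral_of_dominated_loc_of_deriv_le (s := closedBall (0 : ℝ) r)
    (bound := fun _ => C) (closedBall_mem_nhds _ hr) ?_ ?_ ?_ ?_ ?_ ?_).2
  · filter_upwards [closedBall_mem_nhds (0 : ℝ) hr] with η hη
    exact ((hg η hη).mono hSK).aestronglyMeasurable hS
  · obtain ⟨C', hC'⟩ := hK.exists_bound_of_continuousOn (hg 0 h0)
    exact IntegrableOn.of_bound hμ (((hg 0 h0).mono hSK).aestronglyMeasurable hS) C'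
      (ae_restrict_of_forall_mem hS fun x hx => hC' x (hSK hx))
  · exact (hslice.mono hSK).aestronglyMeasurable hS
  · exact ae_restrict_of_forall_mem hS fun x hx η hη => hC (η, x) ⟨hη, hSK hx⟩
  · exact integrableOn_const hμ.ne
  · exact ae_restrict_of_forall_mem hS fun x hx η hη => hd η hη x (hSK hx)

/-- States that are perturbed by a small multiple of a continuous function on a compact set stay
in an open set of states. -/
theorem exists_forall_perturbed_mem {X : Type*} [TopologicalSpace X] {K : Set X}
    (hK : IsCompact K) {D : Set (ℝ × ℝ)} (hD : IsOpen D) {a b δ : X → ℝ} (ha : ContinuousOn a K)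
    (hb : ContinuousOn b K) (hδ : ContinuousOn δ K) (hab : ∀ x ∈ K, (a x, b x) ∈ D) :
    ∃ r > 0, ∀ η ∈ closedBall (0 : ℝ) r, ∀ x ∈ K, (a x, b x + η * δ x) ∈ D := by
  have : CompactSpace K := isCompact_iff_compactSpace.1 hK
  have hc : Continuous fun p : ℝ × K => (a p.2, b p.2 + p.1 * δ p.2) := by
    have ha' := ha.domRestrict
    have hb' := hb.domRestrict
    have hδ' := hδ.domRestrict
    exact (ha'.comp continuous_snd).prodMk
      ((hb'.comp continuous_snd).add (continuous_fst.mul (hδ'.comp continuous_snd)))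
  -- The slice `η = 0` over the compact set lies in the open preimage of `D`, so a whole tube around
  -- it does; this makes the radius uniform in `x`.
  obtain ⟨u, v, hu, _, h0u, hv, huv⟩ := generalized_tube_lemma (isCompact_singleton (x := (0 : ℝ)))
    (isCompact_univ (X := K)) (hD.preimage hc) (by
      rintro ⟨η, x⟩ ⟨hη, _⟩
      change η = 0 at hη
      subst hη
      simpa using hab x x.2)
  obtain ⟨r, hr, hru⟩ := nhds_basis_closedBall.mem_iff.1 (hu.mem_nhds (h0u rfl))
  exact ⟨r, hr, fun η hη x hx => huv (show (η, (⟨x, hx⟩ : K)) ∈ u ×ˢ v from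
    ⟨hru hη, hv (mem_univ _)⟩)⟩

/-- The fundamental lemma of the calculus of variations for continuous functions. -/
theorem eqOn_zero_of_forall_setIntegral_mul_eq_zero {E : Type*} [NormedAddCommGroup E]
    [NormedSpace ℝ E] [FiniteDimensional ℝ E] [MeasurableSpace E] [BorelSpace E] (μ : Measure E)
    [μ.IsAddHaarMeasure] {O : Set E} (hO : IsOpen O) {f : E → ℝ} (hf : ContinuousOn f (closure O))
    (h : ∀ χ : E → ℝ, ContDiff ℝ ∞ χ → HasCompactSupport χ → tsupport χ ⊆ O →
      ∫ x in O, χ x * f x ∂μ = 0) : ∀ x ∈ closure O, f x = 0 := by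
  have hae := hO.ae_eq_zero_of_integral_contDiff_smul_eq_zero (μ := μ) (f := f)
    ((hf.mono subset_closure).locallyIntegrableOn hO.measurableSet) fun χ h1 h2 h3 => by
      rw [← h χ h1 h2 h3, setIntegral_eq_integral_of_forall_compl_eq_zero]
      · rfl
      · intro x hx
        rw [image_eq_zero_of_notMem_tsupport fun hx' => hx (h3 hx'), zero_mul]
  have heq : EqOn f (fun _ => 0) O := Measure.eqOn_open_of_ae_eq
    ((ae_restrict_iff' hO.measurableSet).2 hae) hO (hf.mono subset_closure) continuousOn_const
  exact heq.of_subset_closure hf continuousOn_const subset_closure subset_rfl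

/-! ### The variational derivative with respect to the entropy density -/

/-- The partial derivative `∂ε/∂s`. -/
noncomputable def energyDeriv (ε : ℝ → ℝ → ℝ) (a b : ℝ) : ℝ :=
  fderiv ℝ (fun p : ℝ × ℝ => ε p.1 p.2) (a, b) (0, 1)

theorem contDiffOn_energyDeriv {D : Set (ℝ × ℝ)} (hD : IsOpen D) {ε : ℝ → ℝ → ℝ}
    (hε : ContDiffOn ℝ ∞ (fun p : ℝ × ℝ => ε p.1 p.2) D) :
    ContDiffOn ℝ ∞ (fun p : ℝ × ℝ => energyDeriv ε p.1 p.2) D :=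
  (hε.fderiv_of_isOpen hD (by simp)).clm_apply contDiffOn_const

theorem hasDerivAt_energy {D : Set (ℝ × ℝ)} (hD : IsOpen D) {ε : ℝ → ℝ → ℝ}
    (hε : ContDiffOn ℝ ∞ (fun p : ℝ × ℝ => ε p.1 p.2) D) {a b δ η : ℝ}
    (h : (a, b + η * δ) ∈ D) :
    HasDerivAt (fun η => ε a (b + η * δ)) (energyDeriv ε a (b + η * δ) * δ) η := by
  have h1 : HasFDerivAt (fun p : ℝ × ℝ => ε p.1 p.2)
      (fderiv ℝ (fun p : ℝ × ℝ => ε p.1 p.2) (a, b + η * δ)) (a, b + η * δ) :=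
    ((hε.contDiffAt (hD.mem_nhds h)).differentiableAt (by simp)).hasFDerivAt
  have h2 : HasDerivAt (fun η => (a, b + η * δ)) ((0 : ℝ), δ) η :=
    (hasDerivAt_const η a).prodMk (by simpa using ((hasDerivAt_id η).mul_const δ).const_add b)
  have h3 := h1.comp_hasDerivAt η h2
  have h4 : ((0 : ℝ), δ) = δ • ((0 : ℝ), (1 : ℝ)) := by simp
  rw [h4, map_smul, smul_eq_mul, mul_comm] at h3
  exact h3

theorem continuousOn_perturbed {X : Type*} [TopologicalSpace X] {K : Set X} {I : Set ℝ}
    {D : Set (ℝ × ℝ)} {f : ℝ × ℝ → ℝ} (hf : ContinuousOn f D) {a b δ : X → ℝ}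
    (ha : ContinuousOn a K) (hb : ContinuousOn b K) (hδ : ContinuousOn δ K)
    (h : ∀ η ∈ I, ∀ x ∈ K, (a x, b x + η * δ x) ∈ D) :
    ContinuousOn (fun p : ℝ × X => f (a p.2, b p.2 + p.1 * δ p.2)) (I ×ˢ K) := by
  have hs : MapsTo (Prod.snd : ℝ × X → X) (I ×ˢ K) K := fun p hp => hp.2
  have ha' := ha.comp continuousOn_snd hs
  have hb' := hb.comp continuousOn_snd hs
  have hδ' := hδ.comp continuousOn_snd hs
  exact hf.comp (ha'.prodMk (hb'.add (continuousOn_fst.mul hδ'))) fun p hp => h _ hp.1 _ hp.2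

/-- The variational derivative of the Lagrangian is `-∂ε/∂s`. -/
theorem IsVariationalDerivative.eq_neg_energyDeriv (hM : IsSmoothBoundedDomain M)
    {D : Set (ℝ × ℝ)} (hD : IsOpen D) {ε : ℝ → ℝ → ℝ}
    (hε : ContDiffOn ℝ ∞ (fun p : ℝ × ℝ => ε p.1 p.2) D) {u : Space d → Space d}
    {ρ s w : Space d → ℝ} (hu : ContinuousOn u (closure M)) (hρ : ContinuousOn ρ (closure M))
    (hs : ContinuousOn s (closure M)) (hρs : ∀ x ∈ closure M, (ρ x, s x) ∈ D)
    (h : IsVariationalDerivative M ε u ρ s w) :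
    ∀ x ∈ closure M, w x = -energyDeriv ε (ρ x) (s x) := by
  have hec : ContinuousOn (fun x => energyDeriv ε (ρ x) (s x)) (closure M) :=
    (contDiffOn_energyDeriv hD hε).continuousOn.comp (hρ.prodMk hs) hρs
  suffices H : ∀ x ∈ closure M, w x + energyDeriv ε (ρ x) (s x) = 0 from
    fun x hx => eq_neg_of_add_eq_zero_left (H x hx)
  refine eqOn_zero_of_forall_setIntegral_mul_eq_zero volume hM.isOpen (h.continuousOn.add hec)
    fun χ hχ hχc _ => ?_
  have hχK : ContinuousOn χ (closure M) := hχ.continuous.continuousOn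
  obtain ⟨r, hr, hrD⟩ := exists_forall_perturbed_mem hM.isCompact_closure hD hρ hs hχK hρs
  have hder := hasDerivAt_setIntegral_of_continuousOn (μ := volume) hM.isCompact_closure
    hM.isOpen.measurableSet subset_closure
    (g := fun η x => 1 / 2 * ρ x * inner ℝ (u x) (u x) - ε (ρ x) (s x + η * χ x))
    (g' := fun η x => -(energyDeriv ε (ρ x) (s x + η * χ x) * χ x)) hr ?_ ?_ ?_
  -- The derivative postulated through `w` and the one computed under the integral sign are
  -- derivatives of the same function.
  · have huniq := (h.hasDerivAt χ hχ.contDiffOn).unique hder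
    have i1 : IntegrableOn (fun x => w x * χ x) M :=
      hM.integrableOn_of_continuousOn_closure (h.continuousOn.mul hχK)
    have i2 : IntegrableOn (fun x => energyDeriv ε (ρ x) (s x) * χ x) M :=
      hM.integrableOn_of_continuousOn_closure (hec.mul hχK)
    simp only [zero_mul, add_zero, integral_neg] at huniq
    calc ∫ x in M, χ x * (w x + energyDeriv ε (ρ x) (s x))
        = ∫ x in M, (w x * χ x + energyDeriv ε (ρ x) (s x) * χ x) := by
          congr 1; ext x; ring
      _ = 0 := by rw [integral_add i1 i2, huniq]; ring
  · intro η hη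
    have := continuousOn_perturbed (I := closedBall 0 r) hε.continuousOn hρ hs hχK hrD
    exact ((continuousOn_const.mul hρ).mul (hu.inner hu)).sub
      (this.comp (f := fun x => (η, x)) (by fun_prop) fun x hx => ⟨hη, hx⟩)
  · exact ((continuousOn_perturbed (contDiffOn_energyDeriv hD hε).continuousOn hρ hs hχK hrD).mul
      (hχK.comp continuousOn_snd fun p hp => hp.2)).neg
  · intro η hη x hx
    exact (hasDerivAt_energy hD hε (hrD η hη x hx)).const_sub _

end NSF

namespace NSF

open Filter Topology Metric

variable {d : ℕ} {M : Set (Space d)} {T : ℝ}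

/-! ### The first variation of the action -/

/-- Fubini turns the action into one integral over the cylinder, so that a single differentiation
under the integral sign suffices. `L` and `W` are continuous on the compact closure, where the
original integrands need not be. -/
theorem action_eq_setIntegral (hM : IsSmoothBoundedDomain M) (hT : 0 < T) {ε : ℝ → ℝ → ℝ}
    {m : Motion d} {L W : ℝ × Space d → ℝ} (hL : ContinuousOn L (cylinder T M))
    (hW : ContinuousOn W (cylinder T M))
    (eL : ∀ t ∈ Icc 0 T, ∀ x ∈ M,
      1 / 2 * m.ρ t x * inner ℝ (m.u t x) (m.u t x) - ε (m.ρ t x) (m.s t x) = L (t, x))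
    (eW : ∀ t ∈ Icc 0 T, ∀ x ∈ M,
      (m.s t x - m.σ t x) * functionRate T m.u m.γ t x = W (t, x)) :
    action T M ε m = ∫ p in Ioc 0 T ×ˢ M, (L p + W p) := by
  have hi : IntegrableOn (fun p => L p + W p) (Ioc 0 T ×ˢ M) (volume.prod volume) :=
    ((hL.add hW).integrableOn_compact (hM.isCompact_cylinder T)).mono_set
      (prod_mono Ioc_subset_Icc_self subset_closure)
  have hslice : ∀ f : ℝ × Space d → ℝ, ContinuousOn f (cylinder T M) → ∀ t ∈ Icc 0 T,
      IntegrableOn (fun x => f (t, x)) M := fun f hf t ht =>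
    hM.integrableOn_of_continuousOn_closure
      (hf.comp (f := fun x => (t, x)) (by fun_prop) fun x hx => ⟨ht, hx⟩)
  rw [Measure.volume_eq_prod, setIntegral_prod _ hi, action,
    intervalIntegral.integral_of_le hT.le]
  refine setIntegral_congr_fun measurableSet_Ioc fun t ht => ?_
  have ht' : t ∈ Icc 0 T := Ioc_subset_Icc_self ht
  rw [integral_add (hslice L hL t ht') (hslice W hW t ht'), lagrangian]
  congr 1
  · exact setIntegral_congr_fun hM.isOpen.measurableSet fun x hx => eL t ht' x hx
  · exact setIntegral_congr_fun hM.isOpen.measurableSet fun x hx => eW t ht' x hx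

/-- With `ζ = 0` velocity and mass density stay fixed. These variations already yield (T) and (R).
-/
theorem Motion.vary_of_zeta_eq_zero (m : Motion d) (χ ψ κ : ℝ → Space d → ℝ) (η : ℝ) :
    m.vary T ⟨fun _ _ => 0, χ, ψ, κ⟩ η = ⟨m.u, m.ρ, fun t x => m.s t x + η * χ t x,
      fun t x => m.γ t x + η * ψ t x, fun t x => m.σ t x + η * κ t x⟩ := by
  have h0 : ∀ (X : Space d → Space d) (x : Space d),
      VectorField.lieBracket ℝ X (fun _ => 0) x = 0 := fun X x => by
    simp [VectorField.lieBracket]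
  have h1 : ∀ t x, dt T (fun (_ : ℝ) (_ : Space d) => (0 : Space d)) t x = 0 := fun t x => by
    simp [dt]
  simp [Motion.vary, h0, h1, NSF.div]

theorem functionRate_add_mul (hM : IsOpen M) (hT : 0 < T) {u : ℝ → Space d → Space d}
    {γ ψ : ℝ → Space d → ℝ} (hγ : SmoothField T M γ) (hψ : SmoothField T M ψ) (η : ℝ) {t : ℝ}
    (ht : t ∈ Icc 0 T) {x : Space d} (hx : x ∈ M) :
    functionRate T u (fun t x => γ t x + η * ψ t x) t x
      = functionRate T u γ t x + η * functionRate T u ψ t x := by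
  have h1 : dt T (fun t x => γ t x + η * ψ t x) t x = dt T γ t x + η * dt T ψ t x :=
    ((hγ.hasDerivWithinAt_dt hT ht (subset_closure hx)).1.add
      ((hψ.hasDerivWithinAt_dt hT ht (subset_closure hx)).1.const_mul η)).derivWithin
      (uniqueDiffOn_Icc hT t ht)
  have h2 : fderiv ℝ (fun x => γ t x + η * ψ t x) x = fderiv ℝ (γ t) x + η • fderiv ℝ (ψ t) x :=
    ((hγ.differentiableAt_slice hM ht hx).hasFDerivAt.add
      ((hψ.differentiableAt_slice hM ht hx).hasFDerivAt.const_mul η)).fderiv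
  simp only [functionRate]
  rw [h1, h2]
  simp only [add_apply, smul_apply, smul_eq_mul]
  ring

/-- The first variation of the action with respect to `s`, `γ` and `σ`. -/
theorem hasDerivAt_action (hM : IsSmoothBoundedDomain M) (hT : 0 < T) {D : Set (ℝ × ℝ)}
    (hD : IsOpen D) {ε : ℝ → ℝ → ℝ} (hε : ContDiffOn ℝ ∞ (fun p : ℝ × ℝ => ε p.1 p.2) D)
    {m : Motion d} (hm : m.IsRegular T M)
    (hmD : ∀ t ∈ Icc 0 T, ∀ x ∈ closure M, (m.ρ t x, m.s t x) ∈ D)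
    {χ ψ κ : ℝ → Space d → ℝ} (hχ : SmoothField T M χ) (hψ : SmoothField T M ψ)
    (hκ : SmoothField T M κ) :
    HasDerivAt (fun η : ℝ => action T M ε (m.vary T ⟨fun _ _ => 0, χ, ψ, κ⟩ η))
      (∫ p in Ioc 0 T ×ˢ M, (-(energyDeriv ε (m.ρ p.1 p.2) (m.s p.1 p.2) * χ p.1 p.2)
        + ((χ p.1 p.2 - κ p.1 p.2) * functionRate T m.u m.γ p.1 p.2
          + (m.s p.1 p.2 - m.σ p.1 p.2) * functionRate T m.u ψ p.1 p.2))) 0 := by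
  -- `a` and `b` stand for the rates of `γ` and `ψ`, with which they agree on `M`, and are
  -- continuous on the compact cylinder over which the integrand is differentiated.
  obtain ⟨a, ha, ea⟩ := hm.γ.smoothInside_functionRate hm.u hM hT
  obtain ⟨b, hb, eb⟩ := hψ.smoothInside_functionRate hm.u hM hT
  have hK := hM.isCompact_cylinder T
  have hρc := hm.ρ.continuousOn
  have hsc := hm.s.continuousOn
  have hχc := hχ.continuousOn
  obtain ⟨r, hr, hrD⟩ := exists_forall_perturbed_mem hK hD hρc hsc hχc
    fun p hp => hmD _ hp.1 _ hp.2
  have hsub : Ioc 0 T ×ˢ M ⊆ cylinder T M := prod_mono Ioc_subset_Icc_self subset_closure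
  have hmeas : MeasurableSet (Ioc 0 T ×ˢ M) := measurableSet_Ioc.prod hM.isOpen.measurableSet
  have hLc : ∀ η ∈ closedBall (0 : ℝ) r, ContinuousOn (fun p : ℝ × Space d =>
      1 / 2 * m.ρ p.1 p.2 * inner ℝ (m.u p.1 p.2) (m.u p.1 p.2)
        - ε (m.ρ p.1 p.2) (m.s p.1 p.2 + η * χ p.1 p.2)) (cylinder T M) := by
    intro η hη
    have := continuousOn_perturbed (I := closedBall 0 r) hε.continuousOn hρc hsc hχc hrD
    exact ((continuousOn_const.mul hρc).mul (hm.u.continuousOn.inner hm.u.continuousOn)).sub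
      (this.comp (f := fun x => (η, x)) (by fun_prop) fun x hx => ⟨hη, hx⟩)
  have hWc : ∀ η : ℝ, ContinuousOn (fun p : ℝ × Space d =>
      (m.s p.1 p.2 + η * χ p.1 p.2 - (m.σ p.1 p.2 + η * κ p.1 p.2))
        * (a p.1 p.2 + η * b p.1 p.2)) (cylinder T M) := fun η =>
    ((hsc.add (continuousOn_const.mul hχc)).sub
      (hm.σ.continuousOn.add (continuousOn_const.mul hκ.continuousOn))).mul
      (ha.continuousOn.add (continuousOn_const.mul hb.continuousOn))
  have hder := hasDerivAt_setIntegral_of_continuousOn (μ := volume) hK hmeas hsub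
    (g := fun η p => 1 / 2 * m.ρ p.1 p.2 * inner ℝ (m.u p.1 p.2) (m.u p.1 p.2)
        - ε (m.ρ p.1 p.2) (m.s p.1 p.2 + η * χ p.1 p.2)
        + (m.s p.1 p.2 + η * χ p.1 p.2 - (m.σ p.1 p.2 + η * κ p.1 p.2))
          * (a p.1 p.2 + η * b p.1 p.2))
    (g' := fun η p => -(energyDeriv ε (m.ρ p.1 p.2) (m.s p.1 p.2 + η * χ p.1 p.2) * χ p.1 p.2)
        + ((χ p.1 p.2 - κ p.1 p.2) * (a p.1 p.2 + η * b p.1 p.2)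
          + (m.s p.1 p.2 + η * χ p.1 p.2 - (m.σ p.1 p.2 + η * κ p.1 p.2)) * b p.1 p.2))
    hr ?_ ?_ ?_
  · have hval : ∫ p in Ioc 0 T ×ˢ M, (-(energyDeriv ε (m.ρ p.1 p.2) (m.s p.1 p.2) * χ p.1 p.2)
        + ((χ p.1 p.2 - κ p.1 p.2) * functionRate T m.u m.γ p.1 p.2
          + (m.s p.1 p.2 - m.σ p.1 p.2) * functionRate T m.u ψ p.1 p.2))
        = ∫ p in Ioc 0 T ×ˢ M, (-(energyDeriv ε (m.ρ p.1 p.2) (m.s p.1 p.2 + 0 * χ p.1 p.2)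
            * χ p.1 p.2) + ((χ p.1 p.2 - κ p.1 p.2) * (a p.1 p.2 + 0 * b p.1 p.2)
          + (m.s p.1 p.2 + 0 * χ p.1 p.2 - (m.σ p.1 p.2 + 0 * κ p.1 p.2)) * b p.1 p.2)) := by
      refine setIntegral_congr_fun hmeas fun p hp => ?_
      simp only [zero_mul, add_zero]
      rw [ea _ (Ioc_subset_Icc_self hp.1) _ hp.2, eb _ (Ioc_subset_Icc_self hp.1) _ hp.2]
    rw [hval]
    refine hder.congr_of_eventuallyEq ?_
    filter_upwards [closedBall_mem_nhds (0 : ℝ) hr] with η hη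
    rw [Motion.vary_of_zeta_eq_zero]
    refine action_eq_setIntegral hM hT (hLc η hη) (hWc η) (fun t _ x _ => rfl)
      fun t ht x hx => ?_
    simp only
    rw [functionRate_add_mul hM.isOpen hT hm.γ hψ η ht hx, ea t ht x hx, eb t ht x hx]
  · exact fun η hη => (hLc η hη).add (hWc η)
  · have hs : MapsTo (Prod.snd : ℝ × ℝ × Space d → ℝ × Space d)
        (closedBall 0 r ×ˢ cylinder T M) (cylinder T M) := fun p hp => hp.2
    have lift : ∀ f : ℝ × Space d → ℝ, ContinuousOn f (cylinder T M) →
        ContinuousOn (fun q : ℝ × ℝ × Space d => f q.2) (closedBall 0 r ×ˢ cylinder T M) :=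
      fun f hf => hf.comp continuousOn_snd hs
    have hχ' := lift _ hχc
    have hκ' := lift _ hκ.continuousOn
    have ha' := lift _ ha.continuousOn
    have hb' := lift _ hb.continuousOn
    have hs' := lift _ hsc
    have hσ' := lift _ hm.σ.continuousOn
    have h1 : ContinuousOn (fun q : ℝ × ℝ × Space d => q.1) (closedBall 0 r ×ˢ cylinder T M) :=
      continuousOn_fst
    exact ((continuousOn_perturbed (contDiffOn_energyDeriv hD hε).continuousOn hρc hsc hχc
      hrD).mul hχ').neg.add (((hχ'.sub hκ').mul (ha'.add (h1.mul hb'))).add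
      (((hs'.add (h1.mul hχ')).sub (hσ'.add (h1.mul hκ'))).mul hb'))
  · intro η hη p hp
    have h1 := (hasDerivAt_energy hD hε (hrD η hη p hp)).const_sub
      (1 / 2 * m.ρ p.1 p.2 * inner ℝ (m.u p.1 p.2) (m.u p.1 p.2))
    have lin : ∀ x y : ℝ, HasDerivAt (fun η : ℝ => x + η * y) y η := fun x y => by
      simpa using ((hasDerivAt_id η).mul_const y).const_add x
    exact h1.add ((((lin _ _).sub (lin _ _)).mul (lin _ _)))

end NSF

namespace NSF

open Filter Topology Metric

variable {d : ℕ} {M : Set (Space d)} {T : ℝ}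

/-! ### Consequences of criticality -/

theorem div_add {F G : Space d → Space d} {x : Space d} (hF : DifferentiableAt ℝ F x)
    (hG : DifferentiableAt ℝ G x) : div (fun y => F y + G y) x = div F x + div G x := by
  simp only [div, fderiv_fun_add hF hG, ← Finset.sum_add_distrib]
  rfl

theorem div_sub {F G : Space d → Space d} {x : Space d} (hF : DifferentiableAt ℝ F x)
    (hG : DifferentiableAt ℝ G x) : div (fun y => F y - G y) x = div F x - div G x := by
  simp only [div, fderiv_fun_sub hF hG, ← Finset.sum_sub_distrib]
  rfl

/-- Admissibility of the variations that do not move the fluid particles. -/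
theorem isAdmissible_of_zeta_eq_zero {m : Motion d} {dlds : ℝ → Space d → ℝ}
    {σfr : ℝ → Space d → Matrix (Fin d) (Fin d) ℝ} {j : ℝ → Space d → Space d}
    {χ κ : ℝ → Space d → ℝ} {ψ : ℝ × Space d → ℝ} (hχ : SmoothField T M χ)
    (hψ : ContDiff ℝ ∞ ψ) (hψs : tsupport ψ ⊆ Ioo 0 T ×ˢ M) (hκ : SmoothField T M κ)
    (hM : IsOpen M)
    (h : ∀ t ∈ Icc 0 T, ∀ x ∈ M,
      dlds t x * κ t x = fderiv ℝ (fun y => ψ (t, y)) x (j t x)) :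
    (⟨fun _ _ => 0, χ, fun t x => ψ (t, x), κ⟩ : Variation d).IsAdmissible T M m dlds σfr j := by
  have hz : ∀ p : ℝ × Space d, p ∉ Ioo 0 T ×ˢ M → ψ p = 0 := fun p hp =>
    image_eq_zero_of_notMem_tsupport fun h' => hp (hψs h')
  refine ⟨SmoothField.const 0, hχ, SmoothField.of_contDiff hψ, hκ, fun _ _ _ _ => rfl,
    fun t _ x hx => hz _ fun hp => ?_, fun _ _ => ⟨rfl, rfl⟩,
    fun x _ => ⟨hz _ fun hp => lt_irrefl _ hp.1.1, hz _ fun hp => lt_irrefl _ hp.1.2⟩,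
    fun t ht x hx => ?_⟩
  · rw [hM.frontier_eq] at hx
    exact hx.2 hp.2
  · simpa [div, contractGrad] using h t ht x hx

theorem setIntegral_cylinder_eq {f : ℝ × Space d → ℝ} (h : ∀ p ∉ Ioo 0 T ×ˢ M, f p = 0) :
    ∫ p in Ioc 0 T ×ˢ M, f p = ∫ p, f p :=
  setIntegral_eq_integral_of_forall_compl_eq_zero fun p hp =>
    h p fun hp' => hp ⟨Ioo_subset_Ioc_self hp'.1, hp'.2⟩

/-- A field on the cylinder vanishes if it is orthogonal to all test functions. -/
theorem SmoothInside.eq_zero_of_forall_integral_mul_eq_zero (hM : IsSmoothBoundedDomain M)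
    (hT : 0 < T) {f : ℝ → Space d → ℝ} (hf : SmoothInside T M f)
    (h : ∀ χ : ℝ × Space d → ℝ, ContDiff ℝ ∞ χ → HasCompactSupport χ →
      tsupport χ ⊆ Ioo 0 T ×ˢ M → ∫ p in Ioo 0 T ×ˢ M, χ p * f p.1 p.2 = 0) :
    ∀ t ∈ Icc 0 T, ∀ x ∈ M, f t x = 0 := by
  obtain ⟨g, hg, eg⟩ := hf
  have hcl : closure (Ioo 0 T ×ˢ M) = cylinder T M := by
    rw [closure_prod_eq, closure_Ioo hT.ne]
  have hO : IsOpen (Ioo 0 T ×ˢ M) := isOpen_Ioo.prod hM.isOpen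
  have key := eqOn_zero_of_forall_setIntegral_mul_eq_zero
    ((volume : Measure ℝ).prod (volume : Measure (Space d))) hO
    (f := fun p => g p.1 p.2) (by rw [hcl]; exact hg.continuousOn) fun χ h1 h2 h3 => by
      refine Eq.trans ?_ (h χ h1 h2 h3)
      rw [Measure.volume_eq_prod]
      refine setIntegral_congr_fun (f := fun p => χ p * g p.1 p.2)
        (g := fun p => χ p * f p.1 p.2) hO.measurableSet fun p hp => ?_
      simp only [eg _ (Ioo_subset_Icc_self hp.1) _ hp.2]
  intro t ht x hx
  rw [eg t ht x hx]
  exact key (t, x) (by rw [hcl]; exact ⟨ht, subset_closure hx⟩)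

section Critical

variable {D : Set (ℝ × ℝ)} {ε : ℝ → ℝ → ℝ} {m : Motion d}
  {σfr : ℝ → Space d → Matrix (Fin d) (Fin d) ℝ} {j : ℝ → Space d → Space d}
  {dlds : ℝ → Space d → ℝ}

theorem smoothField_energyDeriv (hD : IsOpen D)
    (hε : ContDiffOn ℝ ∞ (fun p : ℝ × ℝ => ε p.1 p.2) D) (hm : m.IsRegular T M)
    (hmD : ∀ t ∈ Icc 0 T, ∀ x ∈ closure M, (m.ρ t x, m.s t x) ∈ D) :
    SmoothField T M (fun t x => energyDeriv ε (m.ρ t x) (m.s t x)) :=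
  ContDiffOn.comp (contDiffOn_energyDeriv hD hε) (ContDiffOn.prodMk hm.ρ hm.s)
    fun _ hp => hmD _ hp.1 _ hp.2

/-- With `δγ = δσ = 0` and `ζ = 0` the constraint reads `0 = 0`, so `δs` is free, and its
coefficient in the first variation must vanish. -/
theorem IsCritical.temperatureRelation (hM : IsSmoothBoundedDomain M) (hT : 0 < T)
    (hD : IsOpen D) (hε : ContDiffOn ℝ ∞ (fun p : ℝ × ℝ => ε p.1 p.2) D) (hm : m.IsRegular T M)
    (hmD : ∀ t ∈ Icc 0 T, ∀ x ∈ closure M, (m.ρ t x, m.s t x) ∈ D)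
    (hdl : ∀ t ∈ Icc 0 T, ∀ x ∈ closure M, dlds t x = -energyDeriv ε (m.ρ t x) (m.s t x))
    (h : IsCritical T M ε m dlds σfr j) : TemperatureRelation T M m dlds := by
  have hE := smoothField_energyDeriv hD hε hm hmD
  have key := ((hm.γ.smoothInside_functionRate hm.u hM hT).sub
    hE.smoothInside).eq_zero_of_forall_integral_mul_eq_zero hM hT fun χ h1 h2 h3 => ?_
  · intro t ht x hx
    rw [hdl t ht x (subset_closure hx), sub_eq_zero.1 (key t ht x hx)]
  · have hχ : SmoothField T M (fun t x => χ (t, x)) := SmoothField.of_contDiff h1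
    have h0 : SmoothField T M (fun (_ : ℝ) (_ : Space d) => (0 : ℝ)) := SmoothField.const 0
    have hz : ∀ p ∉ Ioo 0 T ×ˢ M, χ p = 0 := fun p hp =>
      image_eq_zero_of_notMem_tsupport fun h' => hp (h3 h')
    have hadm : (⟨fun _ _ => 0, fun t x => χ (t, x), fun _ _ => 0, fun _ _ => 0⟩ :
        Variation d).IsAdmissible T M m dlds σfr j :=
      isAdmissible_of_zeta_eq_zero (ψ := fun _ => 0) hχ contDiff_const
        (by simp [tsupport]) h0 hM.isOpen (by simp)
    have hder := (hasDerivAt_action hM hT hD hε hm hmD hχ h0 h0).unique (h _ hadm)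
    have hr0 : ∀ t x, functionRate T m.u (fun _ _ => (0 : ℝ)) t x = 0 := fun t x => by
      simp [functionRate, dt]
    simp only [hr0, mul_zero, add_zero, sub_zero] at hder
    refine Eq.trans ?_ hder
    rw [setIntegral_cylinder_eq]
    · rw [setIntegral_eq_integral_of_forall_compl_eq_zero]
      · congr 1; ext p; ring
      · intro p hp; rw [hz p hp, zero_mul]
    · intro p hp
      simp [hz p hp]

/-- Integration by parts for the space-time vector field `(Y, Z)`, whose divergence is `∂ₜY + div
Z`. The test function vanishes near the boundary of the cylinder, so no boundary terms appear. -/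
theorem integral_fderiv_apply_cylinder (hM : IsSmoothBoundedDomain M) (hT : 0 < T)
    {Y : ℝ → Space d → ℝ} {Z : ℝ → Space d → Space d} (hY : SmoothField T M Y)
    (hZ : SmoothField T M Z) {ψ : ℝ × Space d → ℝ} (hψ : ContDiff ℝ ∞ ψ)
    (hc : HasCompactSupport ψ) (hs : tsupport ψ ⊆ Ioo 0 T ×ˢ M) :
    ∫ p, fderiv ℝ ψ p (Y p.1 p.2, Z p.1 p.2)
      = -∫ p in Ioo 0 T ×ˢ M, ψ p * (dt T Y p.1 p.2 + div (Z p.1) p.2) := by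
  have hO : IsOpen (Ioo 0 T ×ˢ M) := isOpen_Ioo.prod hM.isOpen
  have hOc : Ioo 0 T ×ˢ M ⊆ cylinder T M := prod_mono Ioo_subset_Icc_self subset_closure
  have hψ1 : ContDiff ℝ 1 ψ := hψ.of_le (by simp)
  have hYc : ContDiffOn ℝ 1 (fun p : ℝ × Space d => Y p.1 p.2) (Ioo 0 T ×ˢ M) :=
    (ContDiffOn.of_le hY (by simp)).mono hOc
  have hZc : ∀ i, ContDiffOn ℝ 1 (fun p : ℝ × Space d => Z p.1 p.2 i) (Ioo 0 T ×ˢ M) :=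
    fun i => (ContDiffOn.of_le (hZ.coord i) (by simp)).mono hOc
  have k0 := integral_mul_fderiv_of_tsupport_subset
    ((volume : Measure ℝ).prod (volume : Measure (Space d))) hO hYc hψ1 hc hs (1, 0)
  have k1 := fun i => integral_mul_fderiv_of_tsupport_subset
    ((volume : Measure ℝ).prod (volume : Measure (Space d))) hO (hZc i) hψ1 hc hs
    (0, EuclideanSpace.single i 1)
  have e1 : ∀ p : ℝ × Space d, fderiv ℝ ψ p (Y p.1 p.2, Z p.1 p.2)
      = Y p.1 p.2 * fderiv ℝ ψ p (1, 0)
        + ∑ i, Z p.1 p.2 i * fderiv ℝ ψ p (0, EuclideanSpace.single i 1) := by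
    intro p
    have h1 : (Y p.1 p.2, Z p.1 p.2) = Y p.1 p.2 • ((1 : ℝ), (0 : Space d))
        + ((0 : ℝ), Z p.1 p.2) := by simp
    have h2 := clm_apply_eq_sum ((fderiv ℝ ψ p).comp (ContinuousLinearMap.inr ℝ ℝ (Space d)))
      (Z p.1 p.2)
    simp only [ContinuousLinearMap.comp_apply, ContinuousLinearMap.inr_apply] at h2
    rw [h1, map_add, map_smul, h2, smul_eq_mul]
  have e2 : ∀ p ∈ Ioo 0 T ×ˢ M, ψ p * (dt T Y p.1 p.2 + div (Z p.1) p.2)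
      = fderiv ℝ (fun p : ℝ × Space d => Y p.1 p.2) p (1, 0) * ψ p
        + ∑ i, fderiv ℝ (fun p : ℝ × Space d => Z p.1 p.2 i) p (0, EuclideanSpace.single i 1)
          * ψ p := by
    rintro ⟨t, x⟩ hp
    have ht : t ∈ Icc 0 T := Ioo_subset_Icc_self hp.1
    have hx : x ∈ M := hp.2
    rw [(hY.hasDerivWithinAt_dt hT ht (subset_closure hx)).2,
      SmoothField.fderivWithin_eq_fderiv Y hM.isOpen hp, div, mul_add, mul_comm (ψ _),
      Finset.mul_sum]
    congr 1
    refine Finset.sum_congr rfl fun i _ => ?_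
    rw [← SmoothField.fderivWithin_eq_fderiv (fun t x => Z t x i) hM.isOpen hp,
      ← (hZ.coord i).fderiv_slice_apply hM.isOpen ht hx,
      fderiv_coord (hZ.differentiableAt_slice hM.isOpen ht hx), mul_comm]
  simp only [Measure.volume_eq_prod]
  rw [setIntegral_congr_fun hO.measurableSet e2,
    setIntegral_eq_integral_of_forall_compl_eq_zero, integral_congr_ae (.of_forall e1),
    integral_add k0.1 (integrable_finsetSum _ fun i _ => (k1 i).1),
    integral_add k0.2.1 (integrable_finsetSum _ fun i _ => (k1 i).2.1),
    integral_finsetSum _ fun i _ => (k1 i).1, integral_finsetSum _ fun i _ => (k1 i).2.1,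
    k0.2.2, neg_add, ← Finset.sum_neg_distrib]
  · congr 1
    exact Finset.sum_congr rfl fun i _ => (k1 i).2.2
  · intro p hp
    simp [image_eq_zero_of_notMem_tsupport fun h' => hp (hs h')]

/-- Here `δγ = ψ` is free and `δσ` is dictated by the constraint. After (T) the first variation is
the derivative of `ψ` along `(s - σ, (s - σ) u + j)`, and the vanishing of that field's space-time
divergence is (R). -/
theorem IsCritical.entropyFluxRelation (hM : IsSmoothBoundedDomain M) (hT : 0 < T)
    (hD : IsOpen D) (hε : ContDiffOn ℝ ∞ (fun p : ℝ × ℝ => ε p.1 p.2) D) (hm : m.IsRegular T M)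
    (hmD : ∀ t ∈ Icc 0 T, ∀ x ∈ closure M, (m.ρ t x, m.s t x) ∈ D) (hj : SmoothField T M j)
    (hdls : SmoothField T M dlds) (hdl0 : ∀ t ∈ Icc 0 T, ∀ x ∈ closure M, dlds t x ≠ 0)
    (hdl : TemperatureRelation T M m dlds)
    (h : IsCritical T M ε m dlds σfr j) : EntropyFluxRelation T M m j := by
  set Y : ℝ → Space d → ℝ := fun t x => m.s t x - m.σ t x with hYdef
  have hY : SmoothField T M Y := hm.s.sub hm.σ
  have hYu : SmoothField T M (fun t x => Y t x • m.u t x) := hY.smul hm.u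
  set Z : ℝ → Space d → Space d := fun t x => Y t x • m.u t x + j t x with hZdef
  have hZ : SmoothField T M Z := hYu.add hj
  have key := ((hY.smoothInside_dt hM hT).add
    (hZ.smoothInside_div hM hT)).eq_zero_of_forall_integral_mul_eq_zero hM hT
      fun ψ h1 h2 h3 => ?_
  · intro t ht x hx
    have := key t ht x hx
    rw [div_add (hYu.differentiableAt_slice hM.isOpen ht hx)
      (hj.differentiableAt_slice hM.isOpen ht hx)] at this
    rw [densityRate]
    linarith
  · have hψ : SmoothField T M (fun t x => ψ (t, x)) := SmoothField.of_contDiff h1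
    have h0 : SmoothField T M (fun (_ : ℝ) (_ : Space d) => (0 : ℝ)) := SmoothField.const 0
    have hsl : ∀ t x, HasFDerivAt (fun y => ψ (t, y))
        ((fderiv ℝ ψ (t, x)).comp (ContinuousLinearMap.inr ℝ ℝ (Space d))) x := fun t x =>
      (h1.differentiable (by simp) (t, x)).hasFDerivAt.comp x (hasFDerivAt_prodMk_right t x)
    have hsl' : ∀ t x w, fderiv ℝ (fun y => ψ (t, y)) x w = fderiv ℝ ψ (t, x) (0, w) :=
      fun t x w => by rw [(hsl t x).fderiv]; simp
    -- The constraint solved for `δσ`. Smoothness of this variation requires `dlds` to be smooth and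
    -- nonvanishing up to the boundary.
    set κ : ℝ → Space d → ℝ := fun t x => fderiv ℝ ψ (t, x) (0, j t x) / dlds t x with hκdef
    have hκ : SmoothField T M κ := by
      refine SmoothField.div ?_ hdls hdl0
      exact (h1.fderiv_right (m := ∞) (by simp)).contDiffOn.clm_apply
        (contDiffOn_const.prodMk hj)
    have hadm : (⟨fun _ _ => 0, fun _ _ => 0, fun t x => ψ (t, x), κ⟩ :
        Variation d).IsAdmissible T M m dlds σfr j := by
      refine isAdmissible_of_zeta_eq_zero h0 h1 h3 hκ hM.isOpen fun t ht x hx => ?_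
      rw [hsl', hκdef]
      exact mul_div_cancel₀ _ (hdl0 t ht x (subset_closure hx))
    have hder := (hasDerivAt_action hM hT hD hε hm hmD h0 hψ hκ).unique (h _ hadm)
    have hmeas : MeasurableSet (Ioc 0 T ×ˢ M) := measurableSet_Ioc.prod hM.isOpen.measurableSet
    have hcongr : ∀ p ∈ Ioc 0 T ×ˢ M,
        (-(energyDeriv ε (m.ρ p.1 p.2) (m.s p.1 p.2) * 0)
        + ((0 - κ p.1 p.2) * functionRate T m.u m.γ p.1 p.2
          + (m.s p.1 p.2 - m.σ p.1 p.2) * functionRate T m.u (fun t x => ψ (t, x)) p.1 p.2))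
        = fderiv ℝ ψ p (Y p.1 p.2, Z p.1 p.2) := by
      rintro ⟨t, x⟩ hp
      have ht : t ∈ Icc 0 T := Ioc_subset_Icc_self hp.1
      have hx : x ∈ M := hp.2
      have hdt : dt T (fun t x => ψ (t, x)) t x = fderiv ℝ ψ (t, x) (1, 0) := by
        have h4 : HasDerivAt (fun τ : ℝ => (τ, x)) ((1 : ℝ), (0 : Space d)) t :=
          (hasDerivAt_id t).prodMk (hasDerivAt_const t x)
        exact ((h1.differentiable (by simp) (t, x)).hasFDerivAt.comp_hasDerivAt t
          h4).hasDerivWithinAt.derivWithin (uniqueDiffOn_Icc hT t ht)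
      have hγ : functionRate T m.u m.γ t x = -dlds t x := by rw [hdl t ht x hx, neg_neg]
      have hfr : functionRate T m.u (fun t x => ψ (t, x)) t x
          = fderiv ℝ ψ (t, x) (1, 0) + fderiv ℝ ψ (t, x) (0, m.u t x) := by
        rw [functionRate, hdt, hsl']
      have hκ' : κ t x * dlds t x = fderiv ℝ ψ (t, x) (0, j t x) :=
        div_mul_cancel₀ _ (hdl0 t ht x (subset_closure hx))
      have hsplit : (Y t x, Z t x) = Y t x • ((1 : ℝ), (0 : Space d))
          + Y t x • ((0 : ℝ), m.u t x) + ((0 : ℝ), j t x) := by simp [hZdef]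
      simp only
      rw [hγ, hfr, hsplit, map_add, map_add, map_smul, map_smul, ← hκ', smul_eq_mul, smul_eq_mul]
      ring
    rw [setIntegral_congr_fun hmeas hcongr, setIntegral_cylinder_eq,
      integral_fderiv_apply_cylinder hM hT hY hZ h1 h2 h3, neg_eq_zero] at hder
    · exact hder
    · intro p hp
      have : fderiv ℝ ψ p = 0 :=
        image_eq_zero_of_notMem_tsupport fun h' => hp (h3 (tsupport_fderiv_subset ℝ h'))
      rw [this]; rfl

end Critical

end NSF

namespace NSF

open Filter Topology Metric

variable {d : ℕ} {M : Set (Space d)} {T : ℝ}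

/-! ### The balance of entropy -/

/-- Differentiation of the total amount of a density. -/
theorem SmoothField.hasDerivWithinAt_integral {f : ℝ → Space d → ℝ} (hf : SmoothField T M f)
    (hM : IsSmoothBoundedDomain M) (hT : 0 < T) {t : ℝ} (ht : t ∈ Icc 0 T) :
    HasDerivWithinAt (fun τ => ∫ x in M, f τ x) (∫ x in M, dt T f t x) (Icc 0 T) t := by
  rw [hasDerivWithinAt_iff_tendsto_slope]
  have hi : ∀ τ ∈ Icc 0 T, IntegrableOn (f τ) M := fun τ hτ => hf.smoothInside.integrableOn hM hτ
  obtain ⟨C, hC⟩ := (hf.smoothInside_dt hM hT).exists_bound hM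
  have hfin : volume M < ⊤ := hM.isBounded.measure_lt_top
  have hev : ∀ᶠ τ in 𝓝[Icc 0 T \ {t}] t, τ ∈ Icc 0 T \ {t} := self_mem_nhdsWithin
  have hlim : Tendsto (fun τ => ∫ x in M, slope (fun τ => f τ x) t τ) (𝓝[Icc 0 T \ {t}] t)
      (𝓝 (∫ x in M, dt T f t x)) := by
    refine tendsto_integral_filter_of_dominated_convergence (fun _ => C) ?_ ?_ ?_ ?_
    · filter_upwards [hev] with τ hτ
      simp only [slope_def_field]
      exact (((hi τ hτ.1).sub (hi t ht)).div_const _).aestronglyMeasurable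
    · filter_upwards [hev] with τ hτ
      refine ae_restrict_of_forall_mem hM.isOpen.measurableSet fun x hx => ?_
      -- The mean value inequality bounds all difference quotients by one constant. Working with
      -- slopes within `[0, T]` also covers the endpoints.
      have hmv := (convex_Icc 0 T).norm_image_sub_le_of_norm_hasDerivWithin_le
        (fun y hy => (hf.hasDerivWithinAt_dt hT hy (subset_closure hx)).1)
        (fun y hy => hC y hy x hx) ht hτ.1
      have hne : 0 < ‖τ - t‖ := norm_pos_iff.2 (sub_ne_zero.2 hτ.2)
      rw [slope_def_field, norm_div, div_le_iff₀ hne]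
      exact hmv
    · exact integrableOn_const hfin.ne
    · exact ae_restrict_of_forall_mem hM.isOpen.measurableSet fun x hx =>
        hasDerivWithinAt_iff_tendsto_slope.1 (hf.hasDerivWithinAt_dt hT ht (subset_closure hx)).1
  refine hlim.congr' ?_
  filter_upwards [hev] with τ hτ
  simp only [slope_def_field]
  rw [integral_div, integral_sub (hi τ hτ.1) (hi t ht)]

theorem densityRate_sub (hM : IsOpen M) (hT : 0 < T) {u : ℝ → Space d → Space d}
    {f g : ℝ → Space d → ℝ} (hu : SmoothField T M u) (hf : SmoothField T M f)
    (hg : SmoothField T M g) {t : ℝ} (ht : t ∈ Icc 0 T) {x : Space d} (hx : x ∈ M) :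
    densityRate T u (fun t x => f t x - g t x) t x
      = densityRate T u f t x - densityRate T u g t x := by
  have h1 : dt T (fun t x => f t x - g t x) t x = dt T f t x - dt T g t x :=
    ((hf.hasDerivWithinAt_dt hT ht (subset_closure hx)).1.sub
      (hg.hasDerivWithinAt_dt hT ht (subset_closure hx)).1).derivWithin
      (uniqueDiffOn_Icc hT t ht)
  have h2 := div_sub ((hf.smul hu).differentiableAt_slice hM ht hx)
    ((hg.smul hu).differentiableAt_slice hM ht hx)
  simp only [densityRate]
  rw [h1]
  simp only [sub_smul]
  rw [h2]
  ring

theorem integral_div_smul_eq_zero (hM : IsSmoothBoundedDomain M) {f : ℝ → Space d → ℝ}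
    {u : ℝ → Space d → Space d} (hf : SmoothField T M f) (hu : SmoothField T M u) {t : ℝ}
    (ht : t ∈ Icc 0 T) (h0 : ∀ x ∈ frontier M, u t x = 0) :
    ∫ x in M, div (fun y => f t y • u t y) x = 0 := by
  rw [integral_div_eq_flux hM (((hf.smul hu).contDiffOn_slice ht).of_le (by simp)), flux,
    surfaceMeasure]
  exact setIntegral_eq_zero_of_forall_eq_zero fun x hx => by simp [normalComponent, h0 x hx]

section Balance

variable {m : Motion d} {σfr : ℝ → Space d → Matrix (Fin d) (Fin d) ℝ}
  {j : ℝ → Space d → Space d} {r : ℝ → Space d → ℝ} {dlds θ : ℝ → Space d → ℝ}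

/-- (R) and linearity of the density rate give the first equality; (P) divided by `-θ` gives the
second. -/
theorem local_entropy_balance (hM : IsOpen M) (hT : 0 < T) (hm : m.IsRegular T M)
    (hθ : ∀ t x, θ t x = -dlds t x) (hθ0 : ∀ t ∈ Icc 0 T, ∀ x ∈ closure M, θ t x ≠ 0)
    (h1 : TemperatureRelation T M m dlds) (h2 : EntropyFluxRelation T M m j)
    (h3 : PhenomenologicalConstraint T M m dlds σfr j r) {t : ℝ} (ht : t ∈ Icc 0 T)
    {x : Space d} (hx : x ∈ M) :
    densityRate T m.u m.s t x + div (j t) x = densityRate T m.u m.σ t x ∧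
    densityRate T m.u m.σ t x
      = internalProduction m θ σfr j t x + externalProduction m θ r t x := by
  constructor
  · have h := h2 t ht x hx
    rw [densityRate_sub hM hT hm.u hm.s hm.σ ht hx] at h
    linarith
  · have h := h3 t ht x hx
    -- (T) holds on a neighbourhood of `x` in the open set `M`, so it may be differentiated in
    -- space.
    have hfd : fderiv ℝ (functionRate T m.u m.γ t) x = fderiv ℝ (θ t) x := by
      refine Filter.EventuallyEq.fderiv_eq ?_
      filter_upwards [hM.mem_nhds hx] with y hy
      rw [hθ, h1 t ht y hy, neg_neg]
    have hne := hθ0 t ht x (subset_closure hx)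
    have hd : dlds t x = -θ t x := by rw [hθ, neg_neg]
    rw [hfd, hd] at h
    rw [internalProduction, externalProduction]
    field_simp
    linarith

theorem smoothInside_internalProduction (hM : IsSmoothBoundedDomain M) (hT : 0 < T)
    (hm : m.IsRegular T M) (hσfr : ∀ i k, SmoothField T M (fun t x => σfr t x i k))
    (hj : SmoothField T M j) (hθs : SmoothField T M θ)
    (hθ0 : ∀ t ∈ Icc 0 T, ∀ x ∈ closure M, θ t x ≠ 0) :
    SmoothInside T M (internalProduction m θ σfr j) :=
  ((SmoothField.const (1 : ℝ)).div hθs hθ0).smoothInside.mul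
    ((SmoothField.smoothInside_contractGrad hσfr hm.u hM hT).sub
      (hθs.smoothInside_fderiv hM hT hj))

/-- The local balance integrated over `M`: convection carries no entropy through the boundary
because of no slip, and the divergence theorem turns `div j` into the flux. -/
theorem global_entropy_balance (hM : IsSmoothBoundedDomain M) (hT : 0 < T)
    (hm : m.IsRegular T M) (hj : SmoothField T M j) {P Q : ℝ → Space d → ℝ}
    (hP : SmoothInside T M P) (hQ : SmoothInside T M Q)
    (hloc : ∀ t ∈ Icc 0 T, ∀ x ∈ M,
      densityRate T m.u m.s t x + div (j t) x = P t x + Q t x) {t : ℝ} (ht : t ∈ Icc 0 T) :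
    ∃ S' : ℝ, HasDerivWithinAt (fun τ => ∫ x in M, m.s τ x) S' (Icc 0 T) t ∧
      S' + flux M (j t) = (∫ x in M, P t x) + ∫ x in M, Q t x := by
  refine ⟨_, hm.s.hasDerivWithinAt_integral hM hT ht, ?_⟩
  have i1 : IntegrableOn (dt T m.s t) M := (hm.s.smoothInside_dt hM hT).integrableOn hM ht
  have i2 : IntegrableOn (div (fun y => m.s t y • m.u t y)) M :=
    ((hm.s.smul hm.u).smoothInside_div hM hT).integrableOn hM ht
  have i3 : IntegrableOn (div (j t)) M := (hj.smoothInside_div hM hT).integrableOn hM ht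
  rw [← integral_add (hP.integrableOn hM ht) (hQ.integrableOn hM ht),
    ← setIntegral_congr_fun hM.isOpen.measurableSet (hloc t ht),
    ← integral_div_eq_flux hM ((hj.contDiffOn_slice ht).of_le (by simp))]
  have e : ∫ x in M, (densityRate T m.u m.s t x + div (j t) x)
      = (∫ x in M, (dt T m.s t x + div (fun y => m.s t y • m.u t y) x)) + ∫ x in M, div (j t) x :=
    integral_add (i1.add i2) i3
  rw [e, integral_add i1 i2, integral_div_smul_eq_zero hM hm.s hm.u ht (hm.noSlip t ht), add_zero]

end Balance

end NSF

theorem mainTheorem6 {d : ℕ} (hd : d = 2 ∨ d = 3)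
    (M : Set (Space d)) (hM : IsSmoothBoundedDomain M)
    (T : ℝ) (hT : 0 < T)
    -- internal energy density, smooth on an open set of thermodynamic states
    (D : Set (ℝ × ℝ)) (hD : IsOpen D)
    (ε : ℝ → ℝ → ℝ) (hε : ContDiffOn ℝ ∞ (fun p : ℝ × ℝ => ε p.1 p.2) D)
    -- the fields
    (m : Motion d) (hm : m.IsRegular T M)
    (hmD : ∀ t ∈ Icc 0 T, ∀ x ∈ closure M, (m.ρ t x, m.s t x) ∈ D)
    (σfr : ℝ → Space d → Matrix (Fin d) (Fin d) ℝ)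
    (hσfr : ∀ i k, SmoothField T M (fun t x => σfr t x i k))
    (j : ℝ → Space d → Space d) (hj : SmoothField T M j)
    (r : ℝ → Space d → ℝ) (hr : SmoothField T M r)
    -- `δℓ/δs` and the temperature `θ = -δℓ/δs`
    (dlds θ : ℝ → Space d → ℝ)
    (hdlds : ∀ t ∈ Icc 0 T,
      IsVariationalDerivative M ε (m.u t) (m.ρ t) (m.s t) (dlds t))
    (hθ : ∀ t x, θ t x = -dlds t x)
    (hθ0 : ∀ t ∈ Icc 0 T, ∀ x ∈ closure M, θ t x ≠ 0) :
    (IsCritical T M ε m dlds σfr j →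
      TemperatureRelation T M m dlds ∧ EntropyFluxRelation T M m j) ∧
    (TemperatureRelation T M m dlds → EntropyFluxRelation T M m j →
      PhenomenologicalConstraint T M m dlds σfr j r →
      -- local balance of entropy
      (∀ t ∈ Icc 0 T, ∀ x ∈ M,
        densityRate T m.u m.s t x + div (j t) x = densityRate T m.u m.σ t x ∧
        densityRate T m.u m.σ t x
          = internalProduction m θ σfr j t x + externalProduction m θ r t x) ∧
      -- global balance of entropy
      (∀ t ∈ Icc 0 T,
        IntegrableOn (m.s t) M ∧
        Integrable (normalComponent M (j t)) (surfaceMeasure M) ∧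
        IntegrableOn (internalProduction m θ σfr j t) M ∧
        IntegrableOn (externalProduction m θ r t) M ∧
        ∃ S' : ℝ, HasDerivWithinAt (fun τ => ∫ x in M, m.s τ x) S' (Icc 0 T) t ∧
          S' + flux M (j t)
            = (∫ x in M, internalProduction m θ σfr j t x)
              + ∫ x in M, externalProduction m θ r t x)) := by
  have hdl : ∀ t ∈ Icc 0 T, ∀ x ∈ closure M,
      dlds t x = -energyDeriv ε (m.ρ t x) (m.s t x) := fun t ht =>
    (hdlds t ht).eq_neg_energyDeriv hM hD hε (hm.u.contDiffOn_slice ht).continuousOn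
      (hm.ρ.contDiffOn_slice ht).continuousOn (hm.s.contDiffOn_slice ht).continuousOn (hmD t ht)
  have hE := smoothField_energyDeriv hD hε hm hmD
  -- Joint smoothness of `δℓ/δs` in space and time is not assumed; it is inherited from `∂ε/∂s`
  -- through the identification `hdl`.
  have hdls : SmoothField T M dlds := ContDiffOn.congr hE.neg fun p hp => hdl _ hp.1 _ hp.2
  have hθs : SmoothField T M θ := ContDiffOn.congr hdls.neg fun p _ => hθ p.1 p.2
  have hdl0 : ∀ t ∈ Icc 0 T, ∀ x ∈ closure M, dlds t x ≠ 0 := fun t ht x hx h0 =>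
    hθ0 t ht x hx (by rw [hθ, h0, neg_zero])
  refine ⟨fun hcrit => ?_, fun h1 h2 h3 => ?_⟩
  · have hTR := hcrit.temperatureRelation hM hT hD hε hm hmD hdl
    exact ⟨hTR, hcrit.entropyFluxRelation hM hT hD hε hm hmD hj hdls hdl0 hTR⟩
  · have hloc : ∀ t ∈ Icc 0 T, ∀ x ∈ M,
        densityRate T m.u m.s t x + div (j t) x = densityRate T m.u m.σ t x ∧
        densityRate T m.u m.σ t x
          = internalProduction m θ σfr j t x + externalProduction m θ r t x :=
      fun t ht x hx => local_entropy_balance hM.isOpen hT hm hθ hθ0 h1 h2 h3 ht hx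
    have hP := smoothInside_internalProduction hM hT hm hσfr hj hθs hθ0
    have hQ : SmoothInside T M (externalProduction m θ r) :=
      ((hm.ρ.mul hr).div hθs hθ0).smoothInside
    refine ⟨hloc, fun t ht => ⟨hm.s.smoothInside.integrableOn hM ht,
      hM.integrable_surfaceMeasure
        (hM.continuousOn_normalComponent (hj.contDiffOn_slice ht).continuousOn),
      hP.integrableOn hM ht, hQ.integrableOn hM ht, ?_⟩⟩
    exact global_entropy_balance hM hT hm hj hP hQ
      (fun t ht x hx => (hloc t ht x hx).1.trans (hloc t ht x hx).2) ht
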